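/- **Lions forests.** Fix an integer $d\ge 1$. A *Lions forest* is a tuple $T=(N,E,h_0,H,L)$, where $N$ is a finite set of nodes, $(N,E)$ is a directed forest ($(y,z)\in E$ means that $z$ is the parent of $y$), $h_0\subseteq N$, $H$ is a partition of $N\setminus h_0$ into nonempty sets (the elements of $H'=(\{h_0\}\cup H)\setminus\{\emptyset\}$ are called hyperedges) and $L:N\to\{1,\dots,d\}$. Writing $|x|$ for the distance of the node $x$ to the root of its component, one requires: (i) if $h_0\ne\emptyset$, some $x\in h_0$ has $|x|\le|y|$ for all $y\in N$; (ii) if $x,y\in h\in H'$ and $|x|<|y|$, then the parent of $y$ exists and lies in $h$; (iii) if $x_1,y_1\in h\in H'$, $|x_1|=|y_1|$, $(x_1,x_2),(y_1,y_2)\in E$ and $x_2\ne y_2$, then $x_2,y_2\in h$. Forests are considered up to isomorphism; $\mathbf 1$ is the empty forest; a nonempty forest with a single root is a tree. The product $T_1\circledast T_2$ is the disjoint union in which the two sets $h_0$ are merged into one distinguished hyperedge. $\mathcal E[T]=(N,E,\emptyset,H',L)$. For $\alpha,\beta>0$ let $\mathscr G[T]=\alpha|h_0|+\beta|N\setminus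 h_0|$ and $\gamma=\inf\{\mathscr G[T]: T\ne\mathbf 1,\ \mathscr G[T]>1-\alpha\}$. Let $\mathscr F_0$ be the set of all Lions forests, $\mathscr F_0^\gamma=\{T\in\mathscr F_0:\mathscr G[T]\le\gamma\}$, $\mathscr F^\gamma=\mathscr F_0^\gamma\setminus\{\mathbf 1\}$, and let $\mathscr T^\gamma$ be the set of trees in $\mathscr F^\gamma$. **Cuts.** A cut of $T$ is a set $A\subseteq N$ containing the parents of its elements; its root part is the restriction $T|_A$ and its pruned part is $T|_{N\setminus A}$, with hyperedges intersected with $A$ resp. $N\setminus A$ ($A=\emptyset$ and $A=N$ are allowed). $c(T,T_1,T_2)$ is the number of cuts with pruned part $T_1$ and root part $T_2$. **Characters.** Let $(\Omega,\mathbb P)$ be a probability space. Consider families $f=(\langle f,T\rangle)_T$ of random variables (modulo null sets), depending only on the isomorphism class of $T$, with $\langle f,T\rangle=\langle f,T\rangle(\omega_0,(\omega_h)_{h\in H})$ defined on $\Omega\times\Omega^{H}$ with the product measure, with values in $(\mathbb R^d)^{\otimes N}$ (Euclidean norm). For a cut $A$, $\langle f,T|_{N\setminus A}\rangle\otimes^{H}\langle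 g,T|_A\rangle$ denotes the tensor product of the two random variables, where the argument belonging to a hyperedge $h\cap A$ or $h\setminus A$ of a part is $\omega_h$, and $\omega_0$ is common to both factors. The convolution is $\langle f*g,T\rangle=\sum_{A}\langle f,T|_{N\setminus A}\rangle\otimes^{H}\langle g,T|_A\rangle$ (sum over all cuts), with unit $\epsilon$ ($\langle\epsilon,\mathbf 1\rangle=1$, $\langle\epsilon,T\rangle=0$ for $T\neq\mathbf 1$). A *McKean–Vlasov character* is a family indexed by $\mathscr F_0$ with $\langle f,\mathbf 1\rangle=1$, $\langle f,T_1\circledast T_2\rangle=\langle f,T_1\rangle\otimes\langle f,T_2\rangle$ (common $\omega_0$) for all $T_1,T_2$, and $\langle f,T\rangle(\omega_{h_0},\omega_H)=\langle f,\mathcal E[T]\rangle(\omega_0,\omega_{h_0},\omega_H)$ almost everywhere whenever $h_0^T\ne\emptyset$. For families on $\mathscr F_0^\gamma$ put $$\mathbf W^{-1}=\sum_{i\ge0}(\epsilon-\mathbf W)^{*i},\qquad \log_*\mathbf W=\sum_{n\ge1}\tfrac{(-1)^{n+1}}n(\mathbf W-\epsilon)^{*n},\qquad \exp_*f=\sum_{n\ge0}\tfrac1{n!}f^{*n}$$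 (finite sums on each forest when $\langle\mathbf W,\mathbf 1\rangle=1$, $\langle f,\mathbf 1\rangle=0$), and $\delta_t[\mathbf W]=\exp_*\big[(t^{|N^T|}\langle\log_*\mathbf W,T\rangle)_T\big]$ for $t\in\mathbb R$. **Integrability functionals.** $(p,q)$ is a *dual pair* if $p:\mathscr F_0^\gamma\to[1,\infty)$ and $q:\mathscr F^\gamma\to[1,\infty)$ satisfy $\frac1{p[\mathbf 1]}=\frac1{p[T]}+\frac1{q[T]}$ for $T\in\mathscr F^\gamma$; $\frac1{q[T_1]}\ge\frac1{q[T_2]}+\frac1{q[T_3]}$ whenever $T_i\in\mathscr F^\gamma$ and $c(T_1,T_2,T_3)>0$; $q[\mathcal E[T]]=q[T]$ whenever $T,\mathcal E[T]\in\mathscr F^\gamma$; and $\frac1{q[T_1\circledast T_2]}=\frac1{q[T_1]}+\frac1{q[T_2]}$ whenever $T_1,T_2,T_1\circledast T_2\in\mathscr F^\gamma$. Let $G$ be the set of restrictions to $\mathscr F_0^\gamma$ of McKean–Vlasov characters for which all moments $\|\langle\mathbf W,T\rangle\|_{q[T]}:=\mathbb E\big[|\langle\mathbf W,T\rangle|^{q[T]}\big]^{1/q[T]}$,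 $T\in\mathscr F^\gamma$, are finite. With convolution, unit $\epsilon$ and inverse $\mathbf W^{-1}$ it is a group. **Norms.** Let $\mathbf W_{(k)}$ be the part of $\mathbf W$ supported on the forests with exactly $k$ nodes, $$\mathbf N(\mathbf W)=K\sup_{T\in\mathscr F^\gamma}\|\langle\mathbf W,T\rangle\|_{q[T]},\qquad K=\max_{T\in\mathscr F^\gamma}\Big(C(T)^{q[T]-1}\sum_{T_1,T_2\in\mathscr F_0^\gamma}c(T,T_1,T_2)^{q[T]}\Big)^{1/q[T]},$$ where $C(T)$ is the number of pairs $(T_1,T_2)$ with $c(T,T_1,T_2)>0$, and $$\|\mathbf W\|_{cc,q}=\max_{1\le k\le\lfloor\gamma/(\alpha\wedge\beta)\rfloor}\big(k!\,\mathbf N(\mathbf W_{(k)})\big)^{1/k}+\max_{1\le k\le\lfloor\gamma/(\alpha\wedge\beta)\rfloor}\big(k!\,\mathbf N((\mathbf W^{-1})_{(k)})\big)^{1/k}.$$ **Proposition.** Let $d\ge1$, $\alpha,\beta>0$, let $\gamma$ be as above and let $(p,q)$ be a dual pair. 1. For every probability space $(\Omega,\mathbb P)$, $\|\cdot\|_{cc,q}$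 is a finite homogeneous norm on the group $G$: $\|\mathbf W\|_{cc,q}=0$ if and only if $\mathbf W=\epsilon$, and for all $t\in\mathbb R$, $\mathbf W\in G$ one has $\delta_t[\mathbf W]\in G$ and $\|\delta_t[\mathbf W]\|_{cc,q}=|t|\,\|\mathbf W\|_{cc,q}$. It is symmetric, $\|\mathbf W^{-1}\|_{cc,q}=\|\mathbf W\|_{cc,q}$, and sub-additive, $\|\mathbf V*\mathbf W\|_{cc,q}\le\|\mathbf V\|_{cc,q}+\|\mathbf W\|_{cc,q}$. Hence $d_{cc}(\mathbf V,\mathbf W)=\|\mathbf W^{-1}*\mathbf V\|_{cc,q}$ is a metric on $G$, and it is left-invariant: $d_{cc}(\mathbf U*\mathbf V,\mathbf U*\mathbf W)=d_{cc}(\mathbf V,\mathbf W)$. 2. There are constants $c,C>0$, depending only on $d,\alpha,\beta,\gamma,p,q$, such that for every probability space and every $\mathbf W\in G$, with $|||\mathbf W|||=\sup_{T\in\mathscr T^\gamma}\mathbb E\big[|\langle\log_*\mathbf W,T\rangle|^{q[T]}\big]^{1/(q[T]\,|N^T|)}$, $$|||\mathbf W|||\le c\,\|\mathbf W\|_{cc,q}\qquad\text{and}\qquad\|\mathbf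 W\|_{cc,q}\le C\,|||\mathbf W|||.$$ -/

import Mathlib

open MeasureTheory
open scoped ENNReal NNReal

universe u

namespace Lions

/-- Raw data of a labelled directed graph with one distinguished hyperedge `h0`, a family `H` of
further hyperedges and labels in `Fin d`.  An element `(x, y)` of `E` says that `y` is the parent
of `x`. -/
structure HForest (d : ℕ) where
  /-- nodes -/
  N : Finset ℕ
  /-- directed edges, from a node to its parent -/
  E : Finset (ℕ × ℕ)
  /-- the distinguished hyperedge (possibly empty) -/
  h0 : Finset ℕ
  /-- the other hyperedges -/
  H : Finset (Finset ℕ)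
  /-- labels -/
  L : N → Fin d

namespace HForest

variable {d : ℕ}

/-- `T.Edge x y`: the node `y` is the parent of the node `x`. -/
def Edge (T : HForest d) (x y : ℕ) : Prop := (x, y) ∈ T.E

open scoped Classical in
/-- The strict ancestors of a node. -/
noncomputable def ancestors (T : HForest d) (x : ℕ) : Finset ℕ :=
  T.N.filter fun y => Relation.TransGen T.Edge x y

/-- The depth of a node: in a forest, its distance to the root of its component. -/
noncomputable def depth (T : HForest d) (x : ℕ) : ℕ := (T.ancestors x).card

/-- `T` is a Lions forest.  The empty forest (`N = ∅`) is included. -/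
structure IsLions (T : HForest d) : Prop where
  edge_mem : ∀ x y, T.Edge x y → x ∈ T.N ∧ y ∈ T.N
  parent_unique : ∀ x y z, T.Edge x y → T.Edge x z → y = z
  acyclic : ∀ x, ¬ Relation.TransGen T.Edge x x
  h0_subset : T.h0 ⊆ T.N
  H_subset : ∀ h ∈ T.H, h ⊆ T.N \ T.h0
  H_nonempty : ∅ ∉ T.H
  H_disjoint : ∀ h ∈ T.H, ∀ k ∈ T.H, h ≠ k → Disjoint h k
  H_cover : ∀ x ∈ T.N \ T.h0, ∃ h ∈ T.H, x ∈ h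
  /-- a nonempty `h0` contains a node of minimal depth -/
  h0_root : T.h0.Nonempty → ∃ x ∈ T.h0, ∀ y ∈ T.N, T.depth x ≤ T.depth y
  /-- if a hyperedge contains a node less deep than `y ∈ h`, it contains the parent of `y` -/
  chain : ∀ h ∈ insert T.h0 T.H, ∀ x ∈ h, ∀ y ∈ h, T.depth x < T.depth y → ∃ z ∈ h, T.Edge y z
  /-- nodes of a hyperedge of equal depth with distinct parents have their parents in it -/
  sibling : ∀ h ∈ insert T.h0 T.H, ∀ x₁ ∈ h, ∀ y₁ ∈ h, T.depth x₁ = T.depth y₁ →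
    ∀ x₂ y₂, T.Edge x₁ x₂ → T.Edge y₁ y₂ → x₂ ≠ y₂ → x₂ ∈ h ∧ y₂ ∈ h

/-- `T` is a tree: exactly one node can be reached from all nodes along the edges. -/
def IsTree (T : HForest d) : Prop :=
  ∃! x, x ∈ T.N ∧ ∀ y ∈ T.N, Relation.ReflTransGen T.Edge y x

/-- The grading `α |h0| + β |N \ h0|`. -/
noncomputable def grade (α β : ℝ) (T : HForest d) : ℝ :=
  α * (T.h0.card : ℝ) + β * ((T.N \ T.h0).card : ℝ)

/-- The restriction of `T` to the nodes in `A`; hyperedges are intersected with `A`. -/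
def restrict (T : HForest d) (A : Finset ℕ) : HForest d where
  N := T.N ∩ A
  E := T.E.filter fun e => e.1 ∈ A ∧ e.2 ∈ A
  h0 := T.h0 ∩ A
  H := (T.H.image fun h => h ∩ A).erase ∅
  L := fun x => T.L ⟨x.1, Finset.mem_of_mem_inter_left x.2⟩

/-- The operation `𝓔`: the distinguished hyperedge becomes an ordinary one. -/
def detach (T : HForest d) : HForest d where
  N := T.N
  E := T.E
  h0 := ∅
  H := (insert T.h0 T.H).erase ∅
  L := T.L

/-- `A` is closed under taking parents. -/
def ParentClosed (T : HForest d) (A : Finset ℕ) : Prop := ∀ x y, T.Edge x y → x ∈ A → y ∈ A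

/-- `A` is closed under taking children. -/
def ChildClosed (T : HForest d) (A : Finset ℕ) : Prop := ∀ x y, T.Edge x y → y ∈ A → x ∈ A

open scoped Classical in
/-- The sets of nodes that are closed under taking parents.  Such a set `A` is the same as an
admissible cut: the cut edges are those leading from `N \ A` to `A`, the root part is `T|_A` and
the pruned part is `T|_{N \ A}`; `A = ∅` and `A = N` give `T × 1` and `1 × T`. -/
noncomputable def cuts (T : HForest d) : Finset (Finset ℕ) :=
  T.N.powerset.filter fun A => T.ParentClosed A

/-- `A` exhibits `T` as the product `T|_A ⊛ T|_{N \ A}`: no edge and no hyperedge other than the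
distinguished one connects `A` and `N \ A`. -/
structure IsSplit (T : HForest d) (A : Finset ℕ) : Prop where
  subset : A ⊆ T.N
  edges : ∀ x y, T.Edge x y → (x ∈ A ↔ y ∈ A)
  hyperedges : ∀ h ∈ T.H, h ⊆ A ∨ Disjoint h A

/-- The relabelling of nodes `σ` is an isomorphism from `T` to `T'`. -/
structure IsIso (σ : Equiv.Perm ℕ) (T T' : HForest d) : Prop where
  map_N : ∀ x, σ x ∈ T'.N ↔ x ∈ T.N
  map_E : ∀ x y, T'.Edge (σ x) (σ y) ↔ T.Edge x y
  map_h0 : ∀ x, σ x ∈ T'.h0 ↔ x ∈ T.h0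
  map_H : ∀ h : Finset ℕ, h.map σ.toEmbedding ∈ T'.H ↔ h ∈ T.H
  map_L : ∀ (x : ℕ) (hx : x ∈ T.N) (hx' : σ x ∈ T'.N), T'.L ⟨σ x, hx'⟩ = T.L ⟨x, hx⟩

/-! Restriction and `detach` preserve Lions forests. -/

theorem edge_restrict {T : HForest d} {A : Finset ℕ} {x y : ℕ} :
    (T.restrict A).Edge x y ↔ T.Edge x y ∧ x ∈ A ∧ y ∈ A := by
  simp [Edge, restrict]

theorem mem_N_restrict {T : HForest d} {A : Finset ℕ} {x : ℕ} :
    x ∈ (T.restrict A).N ↔ x ∈ T.N ∧ x ∈ A := by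
  simp [restrict]

theorem mem_insert_restrict {T : HForest d} {A h : Finset ℕ}
    (hh : h ∈ insert (T.restrict A).h0 (T.restrict A).H) :
    ∃ k ∈ insert T.h0 T.H, h = k ∩ A := by
  simp only [restrict, Finset.mem_insert, Finset.mem_erase, Finset.mem_image] at hh
  rcases hh with rfl | ⟨-, k, hk, rfl⟩
  · exact ⟨_, Finset.mem_insert_self _ _, rfl⟩
  · exact ⟨k, Finset.mem_insert_of_mem hk, rfl⟩

theorem mem_H_restrict {T : HForest d} {A h : Finset ℕ} (hh : h ∈ (T.restrict A).H) :
    h ≠ ∅ ∧ ∃ k ∈ T.H, k ∩ A = h := by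
  simpa [restrict] using hh

theorem depth_succ {T : HForest d} (he : ∀ x y, T.Edge x y → x ∈ T.N ∧ y ∈ T.N)
    (hu : ∀ x y z, T.Edge x y → T.Edge x z → y = z)
    (ha : ∀ x, ¬ Relation.TransGen T.Edge x x) {x p : ℕ} (h : T.Edge x p) :
    T.depth x = T.depth p + 1 := by
  classical
  have : T.ancestors x = insert p (T.ancestors p) := by
    ext y
    simp only [ancestors, Finset.mem_filter, Finset.mem_insert]
    constructor
    · rintro ⟨hy, hxy⟩
      rcases Relation.TransGen.head'_iff.1 hxy with ⟨z, hxz, hzy⟩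
      obtain rfl := hu _ _ _ h hxz
      rcases Relation.reflTransGen_iff_eq_or_transGen.1 hzy with h1 | h1
      · exact Or.inl h1
      · exact Or.inr ⟨hy, h1⟩
    · rintro (rfl | ⟨hy, hpy⟩)
      · exact ⟨(he _ _ h).2, .single h⟩
      · exact ⟨hy, Relation.TransGen.head h hpy⟩
  unfold depth
  rw [this, Finset.card_insert_of_notMem]
  simp only [ancestors, Finset.mem_filter, not_and]
  exact fun _ => ha p

theorem exists_parent {T : HForest d} {x : ℕ} (h : T.depth x ≠ 0) : ∃ p, T.Edge x p := by
  classical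
  obtain ⟨y, hy⟩ := Finset.card_ne_zero.1 h
  simp only [ancestors, Finset.mem_filter] at hy
  rcases Relation.TransGen.head'_iff.1 hy.2 with ⟨z, hxz, -⟩
  exact ⟨z, hxz⟩

theorem IsLions.depth_succ {T : HForest d} (hT : T.IsLions) {x p : ℕ} (h : T.Edge x p) :
    T.depth x = T.depth p + 1 :=
  HForest.depth_succ hT.edge_mem hT.parent_unique hT.acyclic h

theorem IsLions.depth_succ_restrict {T : HForest d} (hT : T.IsLions) {A : Finset ℕ} {x p : ℕ}
    (h : T.Edge x p) (hx : x ∈ A) (hp : p ∈ A) :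
    (T.restrict A).depth x = (T.restrict A).depth p + 1 := by
  refine HForest.depth_succ ?_ ?_ ?_ (edge_restrict.2 ⟨h, hx, hp⟩)
  · intro x y h
    rw [edge_restrict] at h
    exact ⟨mem_N_restrict.2 ⟨(hT.edge_mem _ _ h.1).1, h.2.1⟩,
      mem_N_restrict.2 ⟨(hT.edge_mem _ _ h.1).2, h.2.2⟩⟩
  · intro x y z h1 h2
    exact hT.parent_unique _ _ _ (edge_restrict.1 h1).1 (edge_restrict.1 h2).1
  · intro x h
    exact hT.acyclic x (Relation.TransGen.lift id (fun a b hab => (edge_restrict.1 hab).1) _ _ h)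

theorem IsLions.restrict_of {T : HForest d} (hT : T.IsLions) {A : Finset ℕ}
    (h1 : (T.h0 ∩ A).Nonempty →
      ∃ x ∈ T.h0 ∩ A, ∀ y ∈ T.N ∩ A, (T.restrict A).depth x ≤ (T.restrict A).depth y)
    (h2 : ∀ h ∈ insert T.h0 T.H, ∀ x ∈ h, x ∈ A → ∀ y ∈ h, y ∈ A →
      (T.restrict A).depth x < (T.restrict A).depth y → ∃ z ∈ h, z ∈ A ∧ T.Edge y z)
    (h3 : ∀ h ∈ insert T.h0 T.H, ∀ x₁ ∈ h, x₁ ∈ A → ∀ y₁ ∈ h, y₁ ∈ A →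
      (T.restrict A).depth x₁ = (T.restrict A).depth y₁ →
      ∀ x₂ y₂, x₂ ∈ A → y₂ ∈ A → T.Edge x₁ x₂ → T.Edge y₁ y₂ → x₂ ≠ y₂ → x₂ ∈ h ∧ y₂ ∈ h) :
    (T.restrict A).IsLions where
  edge_mem := by
    intro x y h
    rw [edge_restrict] at h
    exact ⟨mem_N_restrict.2 ⟨(hT.edge_mem _ _ h.1).1, h.2.1⟩,
      mem_N_restrict.2 ⟨(hT.edge_mem _ _ h.1).2, h.2.2⟩⟩
  parent_unique := fun x y z h1 h2 =>
    hT.parent_unique _ _ _ (edge_restrict.1 h1).1 (edge_restrict.1 h2).1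
  acyclic := fun x h => hT.acyclic x (Relation.TransGen.lift id (fun a b hab => (edge_restrict.1 hab).1) _ _ h)
  h0_subset := Finset.inter_subset_inter_right hT.h0_subset
  H_subset := by
    intro h hh x hx
    obtain ⟨-, k, hk, rfl⟩ := mem_H_restrict hh
    have := hT.H_subset k hk (Finset.mem_inter.1 hx).1
    have hxA := (Finset.mem_inter.1 hx).2
    simp only [restrict, Finset.mem_sdiff, Finset.mem_inter] at this ⊢
    tauto
  H_nonempty := fun h => (mem_H_restrict h).1 rfl
  H_disjoint := by
    intro h hh k hk hne
    obtain ⟨-, h', hh', rfl⟩ := mem_H_restrict hh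
    obtain ⟨-, k', hk', rfl⟩ := mem_H_restrict hk
    have : h' ≠ k' := by rintro rfl; exact hne rfl
    exact (hT.H_disjoint _ hh' _ hk' this).mono Finset.inter_subset_left Finset.inter_subset_left
  H_cover := by
    intro x hx
    simp only [restrict, Finset.mem_sdiff, Finset.mem_inter, not_and] at hx
    obtain ⟨h, hh, hxh⟩ := hT.H_cover x
      (Finset.mem_sdiff.2 ⟨hx.1.1, fun h => hx.2 h hx.1.2⟩)
    have hx' : x ∈ h ∩ A := Finset.mem_inter.2 ⟨hxh, hx.1.2⟩
    exact ⟨h ∩ A, Finset.mem_erase.2 ⟨Finset.ne_empty_of_mem hx',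
      Finset.mem_image_of_mem _ hh⟩, hx'⟩
  h0_root := h1
  chain := by
    intro h hh x hx y hy hd
    obtain ⟨k, hk, rfl⟩ := mem_insert_restrict hh
    rw [Finset.mem_inter] at hx hy
    obtain ⟨z, hz, hzA, he⟩ := h2 k hk x hx.1 hx.2 y hy.1 hy.2 hd
    exact ⟨z, Finset.mem_inter.2 ⟨hz, hzA⟩, edge_restrict.2 ⟨he, hy.2, hzA⟩⟩
  sibling := by
    intro h hh x₁ hx y₁ hy hd x₂ y₂ e1 e2 hne
    obtain ⟨k, hk, rfl⟩ := mem_insert_restrict hh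
    rw [Finset.mem_inter] at hx hy
    rw [edge_restrict] at e1 e2
    obtain ⟨a, b⟩ := h3 k hk x₁ hx.1 hx.2 y₁ hy.1 hy.2 hd x₂ y₂ e1.2.2 e2.2.2 e1.1 e2.1 hne
    exact ⟨Finset.mem_inter.2 ⟨a, e1.2.2⟩, Finset.mem_inter.2 ⟨b, e2.2.2⟩⟩

theorem IsLions.depth_restrict_parentClosed {T : HForest d} (hT : T.IsLions) {A : Finset ℕ}
    (hA : T.ParentClosed A) (x : ℕ) (hx : x ∈ A) : (T.restrict A).depth x = T.depth x := by
  induction hn : T.depth x using Nat.strong_induction_on generalizing x with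
  | _ n ih =>
    by_cases h0 : T.depth x = 0
    · by_contra hne
      obtain ⟨p, hp⟩ := exists_parent (T := T.restrict A) (x := x) (by omega)
      have := hT.depth_succ (edge_restrict.1 hp).1
      omega
    · obtain ⟨p, hp⟩ := exists_parent h0
      have hpA := hA _ _ hp hx
      have e1 := hT.depth_succ hp
      have e2 := hT.depth_succ_restrict hp hx hpA
      have := ih (T.depth p) (by omega) p hpA rfl
      omega

/-- The root part of a cut is a Lions forest. -/
theorem IsLions.restrict_parentClosed {T : HForest d} (hT : T.IsLions) {A : Finset ℕ}
    (hA : T.ParentClosed A) : (T.restrict A).IsLions := by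
  have hd := hT.depth_restrict_parentClosed hA
  refine hT.restrict_of ?_ ?_ ?_
  · intro hne
    obtain ⟨x, hx, hmin⟩ := Finset.exists_min_image (T.h0 ∩ A) T.depth hne
    refine ⟨x, hx, fun y hy => ?_⟩
    rw [Finset.mem_inter] at hx hy
    rw [hd x hx.2, hd y hy.2]
    obtain ⟨r, hr, hrmin⟩ := hT.h0_root ⟨x, hx.1⟩
    by_contra hlt
    have h1 := hrmin y hy.1
    obtain ⟨z, hz, he⟩ := hT.chain T.h0 (Finset.mem_insert_self _ _) r hr x hx.1 (by omega)
    have h2 := hmin z (Finset.mem_inter.2 ⟨hz, hA _ _ he hx.2⟩)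
    have h3 := hT.depth_succ he
    omega
  · intro h hh x hx hxA y hy hyA hlt
    rw [hd x hxA, hd y hyA] at hlt
    obtain ⟨z, hz, he⟩ := hT.chain h hh x hx y hy hlt
    exact ⟨z, hz, hA _ _ he hyA, he⟩
  · intro h hh x₁ hx hxA y₁ hy hyA heq x₂ y₂ _ _ e1 e2 hne
    rw [hd _ hxA, hd _ hyA] at heq
    exact hT.sibling h hh x₁ hx y₁ hy heq x₂ y₂ e1 e2 hne

/-- The pruned part of a cut is a Lions forest. -/
theorem IsLions.restrict_childClosed {T : HForest d} (hT : T.IsLions) {B : Finset ℕ}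
    (hB : T.ChildClosed B) : (T.restrict B).IsLions := by
  have key : ∀ h ∈ insert T.h0 T.H, ∀ y p, y ∈ h → T.Edge y p → y ∈ B → p ∈ B → p ∉ h →
      ∀ n x, x ∈ h → T.depth x = n → T.depth y ≤ n ∧ x ∈ B ∧
        (T.restrict B).depth x + T.depth y = (T.restrict B).depth y + n := by
    intro h hh y p hy hyp hyB hpB hph n
    have hdy := hT.depth_succ hyp
    have hdy' := hT.depth_succ_restrict hyp hyB hpB
    induction n using Nat.strong_induction_on with
    | _ n ih =>
      intro x hx hxn
      have hle : T.depth y ≤ T.depth x := by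
        by_contra hlt
        obtain ⟨z, hz, he⟩ := hT.chain h hh x hx y hy (by omega)
        obtain rfl := hT.parent_unique _ _ _ he hyp
        exact hph hz
      rcases hle.eq_or_lt with heq | hlt
      · obtain ⟨p', hp'⟩ := exists_parent (T := T) (x := x) (by omega)
        have hpp : p = p' := by
          by_contra hne
          exact hph (hT.sibling h hh y hy x hx heq p p' hyp hp' hne).1
        subst hpp
        have hxB := hB _ _ hp' hpB
        have := hT.depth_succ_restrict hp' hxB hpB
        exact ⟨by omega, hxB, by omega⟩
      · obtain ⟨z, hz, he⟩ := hT.chain h hh y hy x hx hlt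
        have hz' := hT.depth_succ he
        obtain ⟨h1, h2, h3⟩ := ih (T.depth z) (by omega) z hz rfl
        have hxB := hB _ _ he h2
        have := hT.depth_succ_restrict he hxB h2
        exact ⟨by omega, hxB, by omega⟩
  have chain' : ∀ h ∈ insert T.h0 T.H, ∀ x ∈ h, x ∈ B → ∀ y ∈ h, y ∈ B →
      (T.restrict B).depth x < (T.restrict B).depth y → ∃ z ∈ h, z ∈ B ∧ T.Edge y z := by
    intro h hh x hx hxB y hy hyB hlt
    obtain ⟨p, hp⟩ := exists_parent (T := T.restrict B) (x := y) (by omega)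
    rw [edge_restrict] at hp
    by_cases hph : p ∈ h
    · exact ⟨p, hph, hp.2.2, hp.1⟩
    · obtain ⟨h1, -, h3⟩ := key h hh y p hy hp.1 hyB hp.2.2 hph _ x hx rfl
      omega
  refine hT.restrict_of ?_ chain' ?_
  · intro hne
    obtain ⟨x, hx, hmin⟩ := Finset.exists_min_image (T.h0 ∩ B) (T.restrict B).depth hne
    refine ⟨x, hx, fun y hy => ?_⟩
    rw [Finset.mem_inter] at hx hy
    suffices h : (T.restrict B).depth x = 0 by omega
    by_contra hx0
    obtain ⟨p, hp⟩ := exists_parent hx0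
    rw [edge_restrict] at hp
    obtain ⟨r, hr, hrmin⟩ := hT.h0_root ⟨x, hx.1⟩
    have h1 := hT.depth_succ hp.1
    have h2 := hrmin p (hT.edge_mem _ _ hp.1).2
    obtain ⟨z, hz, he⟩ := hT.chain T.h0 (Finset.mem_insert_self _ _) r hr x hx.1 (by omega)
    obtain rfl := hT.parent_unique _ _ _ he hp.1
    have h3 := hmin z (Finset.mem_inter.2 ⟨hz, hp.2.2⟩)
    have h4 := hT.depth_succ_restrict hp.1 hx.2 hp.2.2
    omega
  · intro h hh x₁ hx hxB y₁ hy hyB heq x₂ y₂ hx₂ hy₂ e1 e2 hne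
    constructor
    · by_contra hcon
      obtain ⟨h1, -, h3⟩ := key h hh x₁ x₂ hx e1 hxB hx₂ hcon _ y₁ hy rfl
      exact hcon (hT.sibling h hh x₁ hx y₁ hy (by omega) x₂ y₂ e1 e2 hne).1
    · by_contra hcon
      obtain ⟨h1, -, h3⟩ := key h hh y₁ y₂ hy e2 hyB hy₂ hcon _ x₁ hx rfl
      exact hcon (hT.sibling h hh x₁ hx y₁ hy (by omega) x₂ y₂ e1 e2 hne).2

theorem IsLions.detach {T : HForest d} (hT : T.IsLions) : T.detach.IsLions where
  edge_mem := hT.edge_mem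
  parent_unique := hT.parent_unique
  acyclic := hT.acyclic
  h0_subset := Finset.empty_subset _
  H_subset := by
    intro h hh
    simp only [HForest.detach, Finset.mem_erase, Finset.mem_insert, Finset.sdiff_empty] at hh ⊢
    rcases hh.2 with rfl | h1
    · exact hT.h0_subset
    · exact (hT.H_subset h h1).trans Finset.sdiff_subset
  H_nonempty := by simp [HForest.detach]
  H_disjoint := by
    intro h hh k hk hne
    simp only [HForest.detach, Finset.mem_erase, Finset.mem_insert] at hh hk
    rcases hh.2 with rfl | h1 <;> rcases hk.2 with rfl | h2
    · exact absurd rfl hne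
    · exact (Finset.disjoint_of_subset_left (hT.H_subset k h2) Finset.sdiff_disjoint).symm
    · exact Finset.disjoint_of_subset_left (hT.H_subset h h1) Finset.sdiff_disjoint
    · exact hT.H_disjoint h h1 k h2 hne
  H_cover := by
    intro x hx
    simp only [HForest.detach, Finset.sdiff_empty] at hx
    by_cases h : x ∈ T.h0
    · exact ⟨T.h0, by simp [HForest.detach, Finset.ne_empty_of_mem h], h⟩
    · obtain ⟨k, hk, hxk⟩ := hT.H_cover x (Finset.mem_sdiff.2 ⟨hx, h⟩)
      exact ⟨k, by simp [HForest.detach, Finset.ne_empty_of_mem hxk, hk], hxk⟩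
  h0_root := by simp [HForest.detach]
  chain := by
    intro h hh x hx
    have : h ∈ insert T.h0 T.H := by
      simp only [HForest.detach, Finset.mem_insert, Finset.mem_erase] at hh ⊢
      rcases hh with rfl | hh
      · simp at hx
      · exact hh.2
    exact hT.chain h this x hx
  sibling := by
    intro h hh x hx
    have : h ∈ insert T.h0 T.H := by
      simp only [HForest.detach, Finset.mem_insert, Finset.mem_erase] at hh ⊢
      rcases hh with rfl | hh
      · simp at hx
      · exact hh.2
    exact hT.sibling h this x hx

theorem parentClosed_of_mem_cuts {T : HForest d} {A : Finset ℕ} (hA : A ∈ T.cuts) :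
    T.ParentClosed A := by
  classical
  exact (Finset.mem_filter.1 hA).2

theorem IsLions.childClosed_compl {T : HForest d} (hT : T.IsLions) {A : Finset ℕ}
    (hA : T.ParentClosed A) : T.ChildClosed (T.N \ A) := by
  intro x y h hy
  rw [Finset.mem_sdiff] at hy ⊢
  exact ⟨(hT.edge_mem _ _ h).1, fun hx => hy.2 (hA _ _ h hx)⟩

theorem IsSplit.parentClosed {T : HForest d} {A : Finset ℕ} (h : T.IsSplit A) :
    T.ParentClosed A := fun x y e hx => (h.edges x y e).1 hx

theorem grade_restrict_le {α β : ℝ} (hα : 0 < α) (hβ : 0 < β) (T : HForest d) (A : Finset ℕ) :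
    (T.restrict A).grade α β ≤ T.grade α β := by
  have h1 : (T.h0 ∩ A).card ≤ T.h0.card := Finset.card_le_card Finset.inter_subset_left
  have h2 : ((T.N ∩ A) \ (T.h0 ∩ A)).card ≤ (T.N \ T.h0).card := by
    refine Finset.card_le_card fun x hx => ?_
    simp only [Finset.mem_sdiff, Finset.mem_inter] at hx ⊢
    tauto
  have h1' : ((T.h0 ∩ A).card : ℝ) ≤ T.h0.card := by exact_mod_cast h1
  have h2' : (((T.N ∩ A) \ (T.h0 ∩ A)).card : ℝ) ≤ (T.N \ T.h0).card := by exact_mod_cast h2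
  simp only [grade, restrict]
  gcongr

theorem IsIso.refl (T : HForest d) : IsIso (Equiv.refl ℕ) T T where
  map_N := fun _ => Iff.rfl
  map_E := fun _ _ => Iff.rfl
  map_h0 := fun _ => Iff.rfl
  map_H := fun h => by
    rw [show (Equiv.refl ℕ).toEmbedding = Function.Embedding.refl ℕ from rfl, Finset.map_refl]
  map_L := fun _ _ _ => rfl

theorem IsIso.symm {σ : Equiv.Perm ℕ} {T T' : HForest d} (h : IsIso σ T T') :
    IsIso σ.symm T' T where
  map_N := fun x => by rw [← h.map_N]; simp
  map_E := fun x y => by rw [← h.map_E]; simp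
  map_h0 := fun x => by rw [← h.map_h0]; simp
  map_H := fun k => by
    rw [← h.map_H, Finset.map_map]
    have : σ.symm.toEmbedding.trans σ.toEmbedding = Function.Embedding.refl ℕ := by
      ext x
      exact σ.apply_symm_apply x
    rw [this, Finset.map_refl]
  map_L := fun x hx hx' => by
    have := h.map_L (σ.symm x) hx' (by simpa using hx)
    rw [← this]
    exact congrArg T'.L (Subtype.ext (by simp))

theorem IsIso.trans {σ τ : Equiv.Perm ℕ} {T T' T'' : HForest d} (h : IsIso σ T T')
    (h' : IsIso τ T' T'') : IsIso (σ.trans τ) T T'' where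
  map_N := fun x => by rw [← h.map_N, ← h'.map_N]; rfl
  map_E := fun x y => by rw [← h.map_E, ← h'.map_E]; rfl
  map_h0 := fun x => by rw [← h.map_h0, ← h'.map_h0]; rfl
  map_H := fun k => by
    rw [← h.map_H, ← h'.map_H, Finset.map_map]; rfl
  map_L := fun x hx hx' => by
    rw [← h.map_L x hx ((h.map_N x).2 hx), ← h'.map_L (σ x) ((h.map_N x).2 hx) hx']; rfl

end HForest

noncomputable section

open scoped Classical

/-- Lions forests, the empty forest `1` included. -/
def LionsForest (d : ℕ) : Type := {T : HForest d // T.IsLions}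

namespace LionsForest

variable {d : ℕ}

/-- The pruned part of the cut with root part `A`. -/
def prune (T : LionsForest d) (A : Finset ℕ) (hA : T.1.ParentClosed A) : LionsForest d :=
  ⟨T.1.restrict (T.1.N \ A), T.2.restrict_childClosed (T.2.childClosed_compl hA)⟩

/-- The root part of the cut with root part `A`. -/
def root (T : LionsForest d) (A : Finset ℕ) (hA : T.1.ParentClosed A) : LionsForest d :=
  ⟨T.1.restrict A, T.2.restrict_parentClosed hA⟩

/-- The operation `𝓔`. -/
def detach (T : LionsForest d) : LionsForest d := ⟨T.1.detach, T.2.detach⟩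

end LionsForest

/-- The two weights `α, β > 0` of the grading. -/
structure Weights where
  /-- weight of the nodes in the distinguished hyperedge -/
  α : ℝ
  /-- weight of the other nodes -/
  β : ℝ
  α_pos : 0 < α
  β_pos : 0 < β

/-- `γ = inf {𝒢[T] : T ≠ 1 a Lions forest, 𝒢[T] > 1 - α}`. -/
def Weights.γ (w : Weights) (d : ℕ) : ℝ :=
  sInf {g : ℝ | ∃ T : LionsForest d, T.1.N.Nonempty ∧ g = T.1.grade w.α w.β ∧ 1 - w.α < g}

/-- The Lions forests of grade at most `γ`, the empty forest included. -/
def TForest (d : ℕ) (w : Weights) : Type := {T : LionsForest d // T.1.grade w.α w.β ≤ w.γ d}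

namespace TForest

variable {d : ℕ} {w : Weights}

/-- The underlying data. -/
abbrev raw (T : TForest d w) : HForest d := T.1.1

/-- The number of nodes. -/
def size (T : TForest d w) : ℕ := T.raw.N.card

/-- The pruned part of the cut with root part `A`. -/
def prune (T : TForest d w) (A : T.raw.cuts) : TForest d w :=
  ⟨T.1.prune A (HForest.parentClosed_of_mem_cuts A.2),
    (HForest.grade_restrict_le w.α_pos w.β_pos T.raw _).trans T.2⟩

/-- The root part of the cut with root part `A`. -/
def root (T : TForest d w) (A : T.raw.cuts) : TForest d w :=
  ⟨T.1.root A (HForest.parentClosed_of_mem_cuts A.2),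
    (HForest.grade_restrict_le w.α_pos w.β_pos T.raw _).trans T.2⟩

/-- Isomorphism of forests (forests are non-planar and their nodes are not named). -/
instance isoSetoid (d : ℕ) (w : Weights) : Setoid (TForest d w) where
  r T T' := ∃ σ, HForest.IsIso σ T.raw T'.raw
  iseqv :=
    ⟨fun _ => ⟨_, HForest.IsIso.refl _⟩, fun ⟨_, h⟩ => ⟨_, h.symm⟩,
      fun ⟨_, h⟩ ⟨_, h'⟩ => ⟨_, h.trans h'⟩⟩

/-- The pair of isomorphism classes (pruned part, root part) of a cut. -/
def cutType (T : TForest d w) (A : T.raw.cuts) :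
    Quotient (isoSetoid d w) × Quotient (isoSetoid d w) :=
  (Quotient.mk _ (T.prune A), Quotient.mk _ (T.root A))

/-- The pairs `(T₁, T₂)` of (isomorphism classes of) forests with `c(T, T₁, T₂) > 0`. -/
def cutTypes (T : TForest d w) :
    Finset (Quotient (isoSetoid d w) × Quotient (isoSetoid d w)) :=
  Finset.univ.image T.cutType

/-- The coproduct counting function: `c(T, T₁, T₂)` is the number of cuts of `T` with pruned part
`T₁` and root part `T₂`. -/
def count (T : TForest d w) (t : Quotient (isoSetoid d w) × Quotient (isoSetoid d w)) : ℕ :=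
  (Finset.univ.filter fun A => T.cutType A = t).card

end TForest

/-! Integrability functionals. -/

/-- `(p, q)` is a dual pair of integrability functionals. The values of `p` and `q` depend only on
the isomorphism class of the forest; `q` is only used on nonempty forests. -/
structure IsDualPair {d : ℕ} {w : Weights} (p q : TForest d w → ℝ) : Prop where
  one_le_p : ∀ T, 1 ≤ p T
  one_le_q : ∀ T, T.raw.N.Nonempty → 1 ≤ q T
  p_iso : ∀ T T' : TForest d w, T ≈ T' → p T = p T'
  q_iso : ∀ T T' : TForest d w, T ≈ T' → q T = q T'
  dual : ∀ S T : TForest d w, S.raw.N = ∅ → T.raw.N.Nonempty → 1 / p S = 1 / p T + 1 / q T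
  cut : ∀ (T : TForest d w) (A : T.raw.cuts), (T.prune A).raw.N.Nonempty →
    (T.root A).raw.N.Nonempty → 1 / q T ≥ 1 / q (T.prune A) + 1 / q (T.root A)
  detach : ∀ T T' : TForest d w, T.raw.N.Nonempty → T'.1 = T.1.detach → q T' = q T
  prod : ∀ T T₁ T₂ : TForest d w, ∀ A, T.raw.IsSplit A → T₁.raw.N.Nonempty → T₂.raw.N.Nonempty →
    T₁.raw = T.raw.restrict A → T₂.raw = T.raw.restrict (T.raw.N \ A) →
    1 / q T = 1 / q T₁ + 1 / q T₂

/-! Random variables indexed by hyperedges. -/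

theorem measurePreserving_precomp {ι κ Ω : Type*} [Fintype ι] [Fintype κ] [MeasurableSpace Ω]
    (P : Measure Ω) [IsProbabilityMeasure P] {φ : ι → κ} (hφ : Function.Injective φ) :
    MeasurePreserving (fun (ω : κ → Ω) i => ω (φ i)) (Measure.pi fun _ => P)
      (Measure.pi fun _ => P) := by
  have hm : Measurable (fun (ω : κ → Ω) i => ω (φ i)) :=
    measurable_pi_lambda _ fun i => measurable_pi_apply _
  refine ⟨hm, ?_⟩
  have h1 : ProbabilityTheory.iIndepFun (fun k (ω : κ → Ω) => ω k)
      (Measure.pi fun _ : κ => P) :=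
    ProbabilityTheory.iIndepFun_pi (X := fun _ : κ => (id : Ω → Ω)) fun _ => aemeasurable_id
  have h2 := h1.precomp hφ
  rw [ProbabilityTheory.iIndepFun_iff_map_fun_eq_pi_map
    fun i => (measurable_pi_apply _).aemeasurable] at h2
  rw [h2]
  congr 1
  funext i
  exact (measurePreserving_eval (fun _ : κ => P) (φ i)).map_eq

section Families

variable {d : ℕ} {Ω : Type u} [MeasurableSpace Ω] (P : Measure Ω) [IsProbabilityMeasure P]

/-- The index set `{0} ∪ H^T` of the arguments `(ω_0, ω_{H^T})`; `none` is the index `0`. -/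
abbrev Idx (T : HForest d) : Type := Option T.H

/-- `(ℝ^d)^{⊗ N^T}` with its Euclidean (Hilbert–Schmidt) norm, in coordinates. -/
abbrev Tens (T : HForest d) : Type := EuclideanSpace ℝ (T.N → Fin d)

/-- `L^0(Ω × Ω^{H^T}, P × P^{H^T}; (ℝ^d)^{⊗ N^T})`. -/
abbrev L0 (T : HForest d) : Type u := (Idx T → Ω) →ₘ[Measure.pi fun _ => P] Tens T

/-- Regarding a function of the arguments indexed by `ι` as a function of the arguments indexed by
`κ`, through an injection of `ι` into `κ`. -/
def pull {ι κ : Type} [Fintype ι] [Fintype κ] {E : Type} [TopologicalSpace E]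
    (φ : ι → κ) (hφ : Function.Injective φ) (f : (ι → Ω) →ₘ[Measure.pi fun _ => P] E) :
    (κ → Ω) →ₘ[Measure.pi fun _ => P] E :=
  f.compMeasurePreserving (fun ω i => ω (φ i)) (measurePreserving_precomp P hφ)

/-- The coupling of the arguments of the restriction of `T` to `A` with those of `T`: a
hyperedge of the restriction is the trace on `A` of a hyperedge of `T`. -/
def coupling (T : HForest d) (A : Finset ℕ) : Idx (T.restrict A) → Idx T :=
  Option.map fun h =>
    ⟨(HForest.mem_H_restrict h.2).2.choose, (HForest.mem_H_restrict h.2).2.choose_spec.1⟩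

theorem coupling_injective (T : HForest d) (A : Finset ℕ) :
    Function.Injective (coupling T A) := by
  refine Option.map_injective fun h k hhk => Subtype.ext ?_
  rw [← (HForest.mem_H_restrict h.2).2.choose_spec.2,
    ← (HForest.mem_H_restrict k.2).2.choose_spec.2]
  exact congrArg (fun x => x ∩ A) (Subtype.ext_iff.1 hhk)

/-- The tensor product of a tensor on the nodes in `B` and a tensor on the nodes in `A`, as a
tensor on all nodes. -/
def tensor (T : HForest d) (B A : Finset ℕ) (b : Tens (T.restrict B)) (a : Tens (T.restrict A)) :
    Tens T :=
  WithLp.toLp 2 fun i => b (fun x => i ⟨x.1, Finset.mem_of_mem_inter_left x.2⟩) *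
    a (fun x => i ⟨x.1, Finset.mem_of_mem_inter_left x.2⟩)

theorem continuous_tensor (T : HForest d) (B A : Finset ℕ) :
    Continuous (Function.uncurry (tensor T B A)) := by
  unfold tensor Function.uncurry
  fun_prop

/-- The coupled tensor product of `f` and `g`: an argument shared by the two parts, because its
hyperedge meets both of them, is used in both factors; the argument `ω_0` is always shared. -/
def couple (T : HForest d) (B A : Finset ℕ) (f : L0 P (T.restrict B)) (g : L0 P (T.restrict A)) :
    L0 P T :=
  AEEqFun.comp₂ (tensor T B A) (continuous_tensor T B A)
    (pull P (coupling T B) (coupling_injective T B) f)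
    (pull P (coupling T A) (coupling_injective T A) g)

/-- The arguments of `T` as arguments of `𝓔[T]`, when `h0 ≠ ∅`: `ω_0` becomes `ω_{h0}`. -/
def detachIdx (T : LionsForest d) (h : T.1.h0.Nonempty) : Idx T.1 → Idx T.1.detach
  | none => some ⟨T.1.h0, by simp [HForest.detach, h.ne_empty]⟩
  | some k => some ⟨k.1, by
      have : k.1 ≠ ∅ := fun e => T.2.H_nonempty (e ▸ k.2)
      simp [HForest.detach, this]⟩

theorem detachIdx_injective (T : LionsForest d) (h : T.1.h0.Nonempty) :
    Function.Injective (detachIdx T h) := by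
  have key : ∀ k ∈ T.1.H, T.1.h0 ≠ k := by
    intro k hk e
    obtain ⟨x, hx⟩ := h
    have := T.2.H_subset k hk (e ▸ hx)
    exact (Finset.mem_sdiff.1 this).2 hx
  rintro (_ | a) (_ | b) hab
  · rfl
  · exact absurd (Subtype.ext_iff.1 (Option.some.inj hab)) (key _ b.2)
  · exact absurd (Subtype.ext_iff.1 (Option.some.inj hab)).symm (key _ a.2)
  · simp only [detachIdx, Option.some.injEq] at hab
    exact congrArg some (Subtype.ext (congrArg (fun z : T.1.detach.H => z.1) hab))

/-- Transport of the arguments along an isomorphism. -/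
def isoIdx {σ : Equiv.Perm ℕ} {T T' : HForest d} (h : HForest.IsIso σ T T') : Idx T → Idx T' :=
  Option.map fun k => ⟨k.1.map σ.toEmbedding, (h.map_H _).2 k.2⟩

theorem isoIdx_injective {σ : Equiv.Perm ℕ} {T T' : HForest d} (h : HForest.IsIso σ T T') :
    Function.Injective (isoIdx h) := by
  refine Option.map_injective fun a b hab => Subtype.ext ?_
  exact Finset.map_injective _ (Subtype.ext_iff.1 hab)

/-- Transport of tensors along an isomorphism. -/
def isoTens {σ : Equiv.Perm ℕ} {T T' : HForest d} (h : HForest.IsIso σ T T') (a : Tens T) :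
    Tens T' :=
  WithLp.toLp 2 fun i => a fun x => i ⟨σ x.1, (h.map_N _).2 x.2⟩

theorem continuous_isoTens {σ : Equiv.Perm ℕ} {T T' : HForest d} (h : HForest.IsIso σ T T') :
    Continuous (isoTens h) := by
  unfold isoTens
  fun_prop

/-- Transport of random variables along an isomorphism. -/
def transport {σ : Equiv.Perm ℕ} {T T' : HForest d} (h : HForest.IsIso σ T T') (f : L0 P T) :
    L0 P T' :=
  AEEqFun.comp (isoTens h) (continuous_isoTens h) (pull P (isoIdx h) (isoIdx_injective h) f)

/-- A random variable on the empty forest is a scalar: `scalar P T r` is the constant tensor with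
all coordinates `r` (there is exactly one coordinate if `N = ∅`). -/
def scalar (T : HForest d) (r : ℝ) : L0 P T := AEEqFun.const _ (WithLp.toLp 2 fun _ => r)

/-- `F` is a McKean–Vlasov character. -/
structure IsMVChar (F : ∀ T : LionsForest d, L0 P T.1) : Prop where
  /-- `F` depends only on the isomorphism class of the forest -/
  natural : ∀ (T T' : LionsForest d) (σ : Equiv.Perm ℕ) (h : HForest.IsIso σ T.1 T'.1),
    F T' = transport P h (F T)
  unit : ∀ T : LionsForest d, T.1.N = ∅ → F T = scalar P T.1 1
  mul : ∀ (T : LionsForest d) (A : Finset ℕ) (h : T.1.IsSplit A),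
    F T = couple P T.1 (T.1.N \ A) A (F (T.prune A h.parentClosed)) (F (T.root A h.parentClosed))
  detach : ∀ (T : LionsForest d) (h : T.1.h0.Nonempty),
    F T.detach = pull P (detachIdx T h) (detachIdx_injective T h) (F T)

variable {w : Weights}

variable (d w) in
/-- Families of random variables indexed by the truncated forests: the dual module. -/
abbrev Fam : Type u := ∀ T : TForest d w, L0 P T.raw

/-- The convolution product dual to the coproduct. -/
def conv (f g : Fam d P w) : Fam d P w := fun T =>
  ∑ A : T.raw.cuts, couple P T.raw (T.raw.N \ A.1) A.1 (f (T.prune A)) (g (T.root A))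

variable (d w) in
/-- The counit, which is the unit of the convolution. -/
def counit : Fam d P w := fun T => scalar P T.raw (if T.raw.N = ∅ then 1 else 0)

/-- Convolution powers. -/
def convPow (f : Fam d P w) : ℕ → Fam d P w
  | 0 => counit d P w
  | n + 1 => conv P (convPow f n) f

/-- The inverse `∑_{i ≥ 0} (ε - W)^{* i}`. For `W` with value `1` on the empty forest the terms
with `i > |N^T|` vanish on `T`. -/
def antipode (W : Fam d P w) : Fam d P w := fun T =>
  ∑ i ∈ Finset.range (T.size + 1), convPow P (counit d P w - W) i T

/-- `exp_* f = ∑_{n ≥ 0} f^{* n} / n!`. For `f` vanishing on the empty forest the terms with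
`n > |N^T|` vanish on `T`. -/
def expStar (f : Fam d P w) : Fam d P w := fun T =>
  ∑ n ∈ Finset.range (T.size + 1), (1 / (n.factorial : ℝ)) • convPow P f n T

/-- `log_* W = ∑_{n ≥ 1} (-1)^{n+1} (W - ε)^{* n} / n`. For `W` with value `1` on the empty forest
the terms with `n > |N^T|` vanish on `T`. -/
def logStar (W : Fam d P w) : Fam d P w := fun T =>
  ∑ n ∈ Finset.Icc 1 T.size, ((-1 : ℝ) ^ (n + 1) / n) • convPow P (W - counit d P w) n T

/-- The dilation `δ_t = exp_* ∘ δ_t ∘ log_*`, with `⟨δ_t f, T⟩ = t ^ |N^T| ⟨f, T⟩` on the Lie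
algebra. -/
def dilation (t : ℝ) (W : Fam d P w) : Fam d P w :=
  expStar P fun T => t ^ T.size • logStar P W T

/-- The moment `E[|⟨W, T⟩| ^ q[T]] ^ (1 / q[T])`. -/
def moment (q : TForest d w → ℝ) (W : Fam d P w) (T : TForest d w) : ℝ≥0∞ :=
  eLpNorm (W T) (ENNReal.ofReal (q T)) (Measure.pi fun _ => P)

/-- The group of McKean–Vlasov characters on the truncated forests with finite `q`-moments. -/
def MVGroup (q : TForest d w → ℝ) : Type u :=
  {W : Fam d P w // (∃ F, IsMVChar P F ∧ ∀ T : TForest d w, F T.1 = W T) ∧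
    ∀ T : TForest d w, T.raw.N.Nonempty → moment P q W T < ⊤}

/-- The component `W_(k)`, supported on the forests with `k` nodes. -/
def part (k : ℕ) (W : Fam d P w) : Fam d P w := fun T => if T.size = k then W T else 0

/-- The constant `K = max_T (C(T)^{q[T]-1} ∑ c(T,T₁,T₂)^{q[T]})^{1/q[T]}`; here `C(T)` is the
number of elements of `T.cutTypes`, and pairs outside `T.cutTypes` do not contribute. -/
def constK (q : TForest d w → ℝ) : ℝ≥0∞ :=
  ⨆ T : TForest d w, ⨆ _ : T.raw.N.Nonempty, ENNReal.ofReal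
    (((T.cutTypes.card : ℝ) ^ (q T - 1) * ∑ t ∈ T.cutTypes, (T.count t : ℝ) ^ q T) ^ (1 / q T))

/-- `K sup_T E[|⟨W, T⟩| ^ q[T]] ^ (1 / q[T])`. -/
def boldNorm (q : TForest d w → ℝ) (W : Fam d P w) : ℝ≥0∞ :=
  constK q * ⨆ T : TForest d w, ⨆ _ : T.raw.N.Nonempty, moment P q W T

/-- `max_k (k! boldNorm (W_(k)))^{1/k}`, the maximum over `1 ≤ k ≤ ⌊γ / min α β⌋`. -/
def halfNorm (q : TForest d w → ℝ) (W : Fam d P w) : ℝ≥0∞ :=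
  ⨆ k ∈ Finset.Icc 1 ⌊w.γ d / min w.α w.β⌋₊,
    ((k.factorial : ℝ≥0∞) * boldNorm P q (part P k W)) ^ (1 / (k : ℝ))

/-- The norm `‖W‖_{cc,q}`. -/
def ccNorm (q : TForest d w → ℝ) (W : Fam d P w) : ℝ≥0∞ :=
  halfNorm P q W + halfNorm P q (antipode P W)

/-- The norm `sup_T E[|⟨log_* W, T⟩| ^ q[T]] ^ (1 / (q[T] |N^T|))` over the trees `T`. -/
def logNorm (q : TForest d w → ℝ) (W : Fam d P w) : ℝ≥0∞ :=
  ⨆ T : TForest d w, ⨆ _ : T.raw.IsTree, moment P q (logStar P W) T ^ (1 / (T.size : ℝ))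

end Families

end

end Lions

/-! Fix a forest `T`. The value of a family on any restriction `T|_A` can be read inside one
commutative ring attached to `T`: germs of real functions of all arguments of `T` and of a
multi-index in `N → Fin d`. There the coupled tensor product is ordinary multiplication, and the
convolution at `T` is the sum over cuts of `f.val T (N \ A) * g.val T A`. A cut of a part is a step
in a chain of parent-closed sets, so the families on all Lions forests form an associative real
algebra, `FullFam`. A family vanishing on the empty forest has its `k`-th power vanishing on forests
with fewer than `k` nodes. Hence inverse, logarithm and exponential are polynomials on each forest,
and restriction to the truncated forests commutes with every operation.

Products of characters are characters because a cut of a product of forests is a pair of cuts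
(`IsMul.mul`) and because compatibility with isomorphisms and with `𝓔` defines a subalgebra
(`IsCompat.mul`). Inverse and logarithm are reached through powers: if `f` is a character, so is `f
^ m = ∑ (m choose k) (f - 1) ^ k` for every natural `m`. Multiplicativity of `f ^ m` on a fixed
product is thus a polynomial identity in `m` (`binomial_transform_mul`). At `m = -1` it says that
the inverse is a character; its derivative at `m = 0` says that the logarithm vanishes on nontrivial
products. A nonempty forest that is not a tree is a nontrivial product or `𝓔` of one, so the
logarithm lives on trees (`IsChar.log_eq_zero`). Multiplication by `t ^ |N|` is a ring homomorphism,
since cuts distribute the nodes over the two parts; together with `exp_log` this identifies the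
dilation with that scaling (`dilation_res`), and homogeneity follows.

The analysis starts from Hölder's inequality, for which the cut inequality of `q` is made
(`nrm_conv_le`). Written as `|T|! K ‖⟨W, T⟩‖ ≤ a ^ |T|` (`halfNorm_le_iff`), the norm bound is
sub-additive by the binomial theorem, with `K` paying for the number of cuts. Finiteness holds
because there are finitely many truncated forests up to isomorphism. For the equivalence with the
logarithmic norm, bounds of the form `c * a ^ |T|` are stable under convolution with the same rate
`a` (`Growth`). The logarithm is applied with `a = ‖W‖`, and conversely exponential and inverse with
`a = |||W|||`; only `c` changes, by amounts depending on the maximal number of nodes. -/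

namespace Lions

noncomputable section

/-! ### Truncated exponential and logarithm, binomial polynomials -/

section Polynomials

open Polynomial

/-- The truncated exponential series. -/
def expPoly (n : ℕ) : ℝ[X] := ∑ k ∈ Finset.range (n + 1), C (1 / (k.factorial : ℝ)) * X ^ k

/-- The truncated series of `log (1 + X)`. -/
def logPoly (n : ℕ) : ℝ[X] := ∑ k ∈ Finset.Icc 1 n, C ((-1 : ℝ) ^ (k + 1) / k) * X ^ k

theorem derivative_expPoly (n : ℕ) :
    derivative (expPoly n) = expPoly n - C (1 / (n.factorial : ℝ)) * X ^ n := by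
  induction n with
  | zero => simp [expPoly]
  | succ n ih =>
    have h : expPoly (n + 1) = expPoly n + C (1 / ((n + 1).factorial : ℝ)) * X ^ (n + 1) :=
      Finset.sum_range_succ _ _
    rw [h, derivative_add, ih, derivative_C_mul_X_pow]
    have h2 : (1 / ((n + 1).factorial : ℝ)) * ((n + 1 : ℕ) : ℝ) = 1 / (n.factorial : ℝ) := by
      rw [Nat.factorial_succ]; push_cast; field_simp
    rw [h2, Nat.add_sub_cancel]
    ring

theorem derivative_logPoly (n : ℕ) :
    (1 + X) * derivative (logPoly n) = 1 - (-X) ^ n := by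
  induction n with
  | zero => simp [logPoly]
  | succ n ih =>
    have h : logPoly (n + 1) =
        logPoly n + C ((-1 : ℝ) ^ (n + 1 + 1) / (n + 1 : ℕ)) * X ^ (n + 1) :=
      Finset.sum_Icc_succ_top (by omega) _
    rw [h, derivative_add, mul_add, ih, derivative_C_mul_X_pow]
    have h2 : (-1 : ℝ) ^ (n + 1 + 1) / ((n + 1 : ℕ) : ℝ) * ((n + 1 : ℕ) : ℝ) = (-1) ^ n := by
      have : ((n + 1 : ℕ) : ℝ) ≠ 0 := by positivity
      rw [div_mul_cancel₀ _ this]; ring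
    rw [h2, Nat.add_sub_cancel, neg_pow (X : ℝ[X]) n, neg_pow (X : ℝ[X]) (n + 1)]
    simp only [map_pow, map_neg, map_one]
    ring

theorem X_dvd_logPoly (n : ℕ) : X ∣ logPoly n := by
  refine Finset.dvd_sum fun k hk => ?_
  exact Dvd.dvd.mul_left (dvd_pow_self X (by have := (Finset.mem_Icc.1 hk).1; omega)) _

/-- The composition `p` solves `(1 + X) p' = p`, `p(0) = 1` up to high order, and `1 + X` is the
only solution. -/
theorem expPoly_comp_logPoly (n : ℕ) :
    X ^ (n + 1) ∣ (expPoly n).comp (logPoly n) - (1 + X) := by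
  -- Both truncation errors, `(-X) ^ n` from the logarithm and `logPoly n ^ n / n!` from the
  -- exponential, have order at least `n`.
  set p := (expPoly n).comp (logPoly n) with hp
  have h1 : X ^ n ∣ (1 + X) * derivative p - p := by
    rw [hp, derivative_comp, derivative_expPoly, ← hp]
    have : (1 + X) * (derivative (logPoly n) *
        (expPoly n - C (1 / (n.factorial : ℝ)) * X ^ n).comp (logPoly n)) - p =
        -(-X) ^ n * (p - C (1 / (n.factorial : ℝ)) * logPoly n ^ n) -
          C (1 / (n.factorial : ℝ)) * logPoly n ^ n := by
      rw [← mul_assoc, derivative_logPoly]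
      simp only [sub_comp, mul_comp, C_comp, pow_comp, X_comp, ← hp]
      ring
    rw [this]
    refine dvd_sub (Dvd.dvd.mul_right ?_ _) (Dvd.dvd.mul_left (pow_dvd_pow_of_dvd
      (X_dvd_logPoly n) n) _)
    rw [neg_pow, dvd_neg]
    exact Dvd.intro_left _ rfl
  have h0 : p.coeff 0 = 1 := by
    have : eval 0 (logPoly n) = 0 := by
      obtain ⟨g, hg⟩ := X_dvd_logPoly n
      rw [hg]; simp
    rw [coeff_zero_eq_eval_zero, hp, eval_comp, this, expPoly, eval_finsetSum,
      Finset.sum_range_succ']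
    simp
  rw [X_pow_dvd_iff] at h1 ⊢
  -- This is the coefficient of `X ^ k` in the differential equation. The factor `1 - k` vanishes at
  -- `k = 1`, which kills the coefficients from degree two on.
  have hrec : ∀ k < n, ((k : ℝ) + 1) * p.coeff (k + 1) = (1 - k) * p.coeff k := by
    intro k hk
    have := h1 k hk
    rw [add_mul, one_mul, coeff_sub, coeff_add, coeff_derivative] at this
    rcases k with _ | k
    · simp at this ⊢
      linarith
    · rw [coeff_X_mul, coeff_derivative] at this
      push_cast at this ⊢
      linarith
  have hz : ∀ k, k + 2 < n + 1 → p.coeff (k + 2) = 0 := by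
    intro k
    induction k with
    | zero =>
      intro hk
      have := hrec 1 (by omega)
      norm_num at this
      exact this
    | succ k ih =>
      intro hk
      have := hrec (k + 2) (by omega)
      rw [ih (by omega), mul_zero] at this
      have h3 : ((k + 2 : ℕ) : ℝ) + 1 ≠ 0 := by positivity
      exact (mul_eq_zero.1 this).resolve_left h3
  intro k hk
  rcases k with _ | _ | k
  · simp [h0]
  · have := hrec 0 (by omega)
    simp [h0] at this
    simp [this, coeff_one]
  · rw [coeff_sub, hz k hk]
    simp [coeff_one, coeff_X]

/-- The binomial coefficient `X choose k` as a polynomial in `X`. -/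
def binomPoly (k : ℕ) : ℝ[X] := C (1 / (k.factorial : ℝ)) * descPochhammer ℝ k

theorem eval_natCast_binomPoly (k m : ℕ) : (binomPoly k).eval (m : ℝ) = m.choose k := by
  rw [binomPoly, eval_mul, eval_C, descPochhammer_eval_eq_descFactorial,
    Nat.descFactorial_eq_factorial_mul_choose]
  push_cast
  field_simp

theorem eval_neg_one_descPochhammer (k : ℕ) :
    (descPochhammer ℝ k).eval (-1) = (-1) ^ k * k.factorial := by
  induction k with
  | zero => simp
  | succ k ih =>
    rw [descPochhammer_succ_right, eval_mul, ih, Nat.factorial_succ]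
    simp
    ring

/-- These are the coefficients of `(1 + x)⁻¹`, that is, of the inverse for convolution. -/
theorem eval_neg_one_binomPoly (k : ℕ) : (binomPoly k).eval (-1) = (-1) ^ k := by
  rw [binomPoly, eval_mul, eval_C, eval_neg_one_descPochhammer]
  field_simp

theorem eval_zero_binomPoly (k : ℕ) (hk : k ≠ 0) : (binomPoly k).eval 0 = 0 := by
  have := eval_natCast_binomPoly k 0
  obtain ⟨j, rfl⟩ := Nat.exists_eq_succ_of_ne_zero hk
  simpa using this

/-- These are the coefficients of `log (1 + x)`, the derivative of `(1 + x) ^ m = ∑ (m choose k) x ^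
k` at `m = 0`. -/
theorem eval_zero_derivative_binomPoly (k : ℕ) :
    (derivative (binomPoly k)).eval 0 = if k = 0 then 0 else (-1) ^ (k + 1) / (k : ℝ) := by
  rcases k with _ | k
  · simp [binomPoly]
  · rw [binomPoly, descPochhammer_succ_left, derivative_C_mul, derivative_mul]
    simp only [derivative_X, one_mul, eval_mul, eval_C, eval_add, eval_X, zero_mul, add_zero,
      eval_comp, eval_sub, eval_one, zero_sub]
    rw [eval_neg_one_descPochhammer, Nat.factorial_succ]
    have : ((k : ℝ) + 1) ≠ 0 := by positivity
    push_cast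
    simp
    field_simp
    ring

theorem eq_zero_of_eval_natCast {p : ℝ[X]} (h : ∀ m : ℕ, p.eval (m : ℝ) = 0) : p = 0 := by
  refine eq_zero_of_infinite_isRoot p (Set.Infinite.mono ?_ (Set.infinite_range_of_injective
    (Nat.cast_injective (R := ℝ))))
  rintro _ ⟨m, rfl⟩
  exact h m

/-- If binomial transforms of three sequences satisfy `a = b * c` at all natural numbers, then
also at `-1`, and the derivative of `a` at `0` vanishes when `b` and `c` vanish at `0`. -/
theorem binomial_transform_mul {R : Type*} [CommRing R] [Module ℝ R] [SMulCommClass ℝ R R]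
    [IsScalarTower ℝ R R] (n : ℕ) (a b c : ℕ → R)
    (h : ∀ m : ℕ, ∑ k ∈ Finset.range (n + 1), (m.choose k : ℝ) • a k =
      (∑ k ∈ Finset.range (n + 1), (m.choose k : ℝ) • b k) *
        ∑ k ∈ Finset.range (n + 1), (m.choose k : ℝ) • c k) :
    (∑ k ∈ Finset.range (n + 1), (-1 : ℝ) ^ k • a k =
      (∑ k ∈ Finset.range (n + 1), (-1 : ℝ) ^ k • b k) *
        ∑ k ∈ Finset.range (n + 1), (-1 : ℝ) ^ k • c k) ∧
    (b 0 = 0 → c 0 = 0 → ∑ k ∈ Finset.Icc 1 n, ((-1 : ℝ) ^ (k + 1) / k) • a k = 0) := by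
  -- A linear functional turns the identity in `R` into an identity of real polynomials in `m`. It
  -- holds at all natural numbers, hence identically, and linear functionals separate points.
  set P : Module.Dual ℝ R → ℝ[X] := fun φ =>
    ∑ k ∈ Finset.range (n + 1), C (φ (a k)) * binomPoly k -
      ∑ i ∈ Finset.range (n + 1), ∑ j ∈ Finset.range (n + 1),
        C (φ (b i * c j)) * (binomPoly i * binomPoly j) with hP
  have hmul : ∀ s : ℕ → ℝ, (∑ k ∈ Finset.range (n + 1), s k • b k) *
      (∑ k ∈ Finset.range (n + 1), s k • c k) =
      ∑ i ∈ Finset.range (n + 1), ∑ j ∈ Finset.range (n + 1), (s i * s j) • (b i * c j) := by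
    intro s
    rw [Finset.sum_mul_sum]
    refine Finset.sum_congr rfl fun i _ => Finset.sum_congr rfl fun j _ => ?_
    rw [smul_mul_smul_comm]
  have hP0 : ∀ φ, P φ = 0 := by
    intro φ
    refine eq_zero_of_eval_natCast fun m => ?_
    have := congrArg φ (h m)
    rw [hmul] at this
    simp only [map_sum, map_smul, smul_eq_mul] at this
    simp only [hP, eval_sub, eval_finsetSum, eval_mul, eval_C, eval_natCast_binomPoly]
    rw [sub_eq_zero]
    simpa only [mul_comm] using this
  constructor
  · rw [← sub_eq_zero, ← Module.forall_dual_apply_eq_zero_iff ℝ]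
    intro φ
    have := congrArg (eval (-1)) (hP0 φ)
    rw [hmul, map_sub]
    simp only [hP, eval_sub, eval_finsetSum, eval_mul, eval_C, eval_neg_one_binomPoly,
      eval_zero] at this
    simp only [map_sum, map_smul, smul_eq_mul]
    simpa only [mul_comm] using this
  · intro hb hc
    rw [← Module.forall_dual_apply_eq_zero_iff ℝ]
    intro φ
    have h1 := congrArg (fun p => eval 0 (derivative p)) (hP0 φ)
    simp only [hP, derivative_sub, derivative_sum, derivative_mul, derivative_C, zero_mul, zero_add,
      eval_sub, eval_finsetSum, eval_mul, eval_C, eval_add, derivative_zero, eval_zero] at h1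
    -- In the product rule each summand keeps one underived factor, which vanishes at `0` when its
    -- index is positive; the index `0` is excluded by `b 0 = 0` and `c 0 = 0`.
    have h2 : ∀ i ∈ Finset.range (n + 1), ∀ j ∈ Finset.range (n + 1), φ (b i * c j) *
        (eval 0 (derivative (binomPoly i)) * eval 0 (binomPoly j) +
          eval 0 (binomPoly i) * eval 0 (derivative (binomPoly j))) = 0 := by
      intro i _ j _
      by_cases hi : i = 0
      · subst hi; simp [hb]
      by_cases hj : j = 0
      · subst hj; simp [hc]
      simp [eval_zero_binomPoly _ hi, eval_zero_binomPoly _ hj]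
    rw [Finset.sum_eq_zero fun i hi => Finset.sum_eq_zero (h2 i hi), sub_zero,
      Finset.range_eq_Ico, Finset.sum_eq_sum_Ico_succ_bot (by omega)] at h1
    simp only [eval_zero_derivative_binomPoly, if_true, mul_zero, zero_add] at h1
    rw [map_sum, ← h1]
    refine Finset.sum_congr ?_ fun k hk => ?_
    · ext; simp
    · have := (Finset.mem_Ico.1 hk).1
      rw [if_neg (by omega), map_smul, smul_eq_mul, mul_comm]

end Polynomials

end

end Lions

namespace Lions

noncomputable section

open scoped Classical

set_option linter.unusedSectionVars false

/-! ### Random tensors in coordinates: the commutative algebra of a forest -/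

section Coordinates

variable {d : ℕ} {Ω : Type u} [MeasurableSpace Ω] (P : Measure Ω) [IsProbabilityMeasure P]

/-- Germs of functions with values in the coordinate algebra of the tensors on `M`. -/
abbrev Alg (d : ℕ) (ι M : Type) [Fintype ι] : Type u :=
  Filter.Germ (ae (Measure.pi fun _ : ι => P)) ((M → Fin d) → ℝ)

/-- The ring homomorphism induced by an injection of the arguments and a map of the nodes. -/
def emb {ι κ M N : Type} [Fintype ι] [Fintype κ] (φ : ι → κ) (hφ : Function.Injective φ)
    (ν : M → N) : Alg P d ι M →+* Alg P d κ N where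
  toFun g := (g.compTendsto (fun (ω : κ → Ω) i => ω (φ i))
    (measurePreserving_precomp P hφ).quasiMeasurePreserving.tendsto_ae).map
      fun u i => u fun x => i (ν x)
  map_one' := rfl
  map_zero' := rfl
  map_mul' a b := by
    induction a using Filter.Germ.inductionOn
    induction b using Filter.Germ.inductionOn
    rfl
  map_add' a b := by
    induction a using Filter.Germ.inductionOn
    induction b using Filter.Germ.inductionOn
    rfl

variable {ι κ μ M N O : Type} [Fintype ι] [Fintype κ] [Fintype μ]

theorem emb_smul (φ : ι → κ) (hφ : Function.Injective φ) (ν : M → N) (r : ℝ) (a : Alg P d ι M) :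
    emb P φ hφ ν (r • a) = r • emb P φ hφ ν a := by
  induction a using Filter.Germ.inductionOn
  rfl

theorem emb_emb (φ : ι → κ) (hφ : Function.Injective φ) (ν : M → N)
    (φ' : κ → μ) (hφ' : Function.Injective φ') (ν' : N → O) (a : Alg P d ι M) :
    emb P φ' hφ' ν' (emb P φ hφ ν a) = emb P (φ' ∘ φ) (hφ'.comp hφ) (ν' ∘ ν) a := by
  induction a using Filter.Germ.inductionOn
  rfl

theorem emb_id (a : Alg P d ι M) : emb P id Function.injective_id id a = a := by
  induction a using Filter.Germ.inductionOn
  rfl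

instance : SMulCommClass ℝ (Alg P d ι M) (Alg P d ι M) where
  smul_comm r a b := by
    induction a using Filter.Germ.inductionOn with | _ a
    induction b using Filter.Germ.inductionOn with | _ b
    exact congrArg _ (smul_comm r a b)

instance : IsScalarTower ℝ (Alg P d ι M) (Alg P d ι M) where
  smul_assoc r a b := by
    induction a using Filter.Germ.inductionOn with | _ a
    induction b using Filter.Germ.inductionOn with | _ b
    exact congrArg _ (smul_assoc r a b)

/-- The coordinates of a random tensor. -/
def coords {T : HForest d} (f : L0 P T) : Alg P d (Idx T) T.N := f.toGerm.map WithLp.ofLp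

variable {T : HForest d}

theorem coords_injective : Function.Injective (coords P (T := T)) := by
  intro f g h
  apply AEEqFun.toGerm_injective
  have := congrArg (Filter.Germ.map (WithLp.toLp 2)) h
  have hid : ∀ f : L0 P T, (coords P f).map (WithLp.toLp 2) = f.toGerm := by
    intro f
    induction f using AEEqFun.induction_on
    rfl
  rwa [hid, hid] at this

theorem coords_add (f g : L0 P T) : coords P (f + g) = coords P f + coords P g := by
  induction f using AEEqFun.induction_on
  induction g using AEEqFun.induction_on
  rfl

theorem coords_zero : coords P (0 : L0 P T) = 0 := rfl

theorem coords_smul (r : ℝ) (f : L0 P T) : coords P (r • f) = r • coords P f := by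
  induction f using AEEqFun.induction_on
  rfl

/-- `coords` as a linear map. -/
def coordsₗ : L0 P T →ₗ[ℝ] Alg P d (Idx T) T.N where
  toFun := coords P
  map_add' := coords_add P
  map_smul' := coords_smul P

theorem coords_sum {ι : Type*} (s : Finset ι) (f : ι → L0 P T) :
    coords P (∑ i ∈ s, f i) = ∑ i ∈ s, coords P (f i) :=
  map_sum (coordsₗ P) f s

/-- The inclusion of the nodes of a restriction. -/
def incl (T : HForest d) (A : Finset ℕ) : (T.restrict A).N → T.N :=
  fun x => ⟨x.1, Finset.mem_of_mem_inter_left x.2⟩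

/-- In coordinates a tensor product multiplies one coordinate of each factor, so the coupled tensor
product becomes a product in a commutative ring. Sharing arguments is encoded in the two embeddings.
-/
theorem coords_couple (B A : Finset ℕ) (f : L0 P (T.restrict B)) (g : L0 P (T.restrict A)) :
    coords P (couple P T B A f g) =
      emb P (coupling T B) (coupling_injective T B) (incl T B) (coords P f) *
      emb P (coupling T A) (coupling_injective T A) (incl T A) (coords P g) := by
  induction f using AEEqFun.induction_on
  induction g using AEEqFun.induction_on
  rfl

theorem coords_transport {σ : Equiv.Perm ℕ} {T T' : HForest d} (h : HForest.IsIso σ T T')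
    (f : L0 P T) : coords P (transport P h f) =
      emb P (isoIdx h) (isoIdx_injective h) (fun x => ⟨σ x.1, (h.map_N _).2 x.2⟩) (coords P f) := by
  induction f using AEEqFun.induction_on
  rfl

theorem coords_detach (T : LionsForest d) (h : T.1.h0.Nonempty) (f : L0 P T.1) :
    coords (T := T.detach.1) P (pull P (detachIdx T h) (detachIdx_injective T h) f) =
      emb P (detachIdx T h) (detachIdx_injective T h) id (coords P f) := by
  induction f using AEEqFun.induction_on
  rfl

theorem coords_scalar (r : ℝ) : coords P (scalar P T r) = r • 1 := by
  unfold scalar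
  simp only [coords]
  have : (AEEqFun.const (Idx T → Ω) (WithLp.toLp 2 fun _ => r) : L0 P T).toGerm.map WithLp.ofLp =
    ((fun _ _ => r : (Idx T → Ω) → (T.N → Fin d) → ℝ) : Alg P d (Idx T) T.N) := rfl
  rw [this]
  have h1 : (fun _ _ => r : (Idx T → Ω) → (T.N → Fin d) → ℝ) = r • 1 := by
    ext; simp
  rw [h1]
  rfl

end Coordinates

/-! ### Iterated restriction of forests -/

namespace HForest

variable {d : ℕ}

theorem ext_of {S T : HForest d} (hN : S.N = T.N) (hE : S.E = T.E) (h0 : S.h0 = T.h0)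
    (hH : S.H = T.H) (hL : ∀ x (hx : x ∈ S.N) (hx' : x ∈ T.N), S.L ⟨x, hx⟩ = T.L ⟨x, hx'⟩) :
    S = T := by
  obtain ⟨N, E, h, H, L⟩ := S
  obtain ⟨N', E', h', H', L'⟩ := T
  dsimp only at *
  subst hN hE h0 hH
  congr 1
  ext x
  exact congrArg Fin.val (hL x.1 x.2 x.2)

theorem restrict_restrict (T : HForest d) (C A : Finset ℕ) :
    (T.restrict C).restrict A = T.restrict (C ∩ A) := by
  refine ext_of ?_ ?_ ?_ ?_ ?_
  · simp [restrict, Finset.inter_assoc]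
  · ext ⟨x, y⟩
    simp only [restrict, Finset.mem_filter, Finset.mem_inter]
    tauto
  · simp [restrict, Finset.inter_assoc]
  · ext h
    simp only [restrict, Finset.mem_erase, Finset.mem_image]
    constructor
    · rintro ⟨h1, k, ⟨h2, l, h3, rfl⟩, rfl⟩
      exact ⟨h1, l, h3, by rw [Finset.inter_assoc]⟩
    · rintro ⟨h1, k, h2, rfl⟩
      refine ⟨h1, k ∩ C, ⟨?_, k, h2, rfl⟩, by rw [Finset.inter_assoc]⟩
      rintro h3
      rw [← Finset.inter_assoc, h3] at h1
      simp at h1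
  · intro x hx hx'
    rfl

theorem restrict_self {T : HForest d} (hT : T.IsLions) : T.restrict T.N = T := by
  refine ext_of (Finset.inter_self _) ?_ (Finset.inter_eq_left.2 hT.h0_subset) ?_ ?_
  · ext ⟨x, y⟩
    simp only [restrict, Finset.mem_filter]
    exact ⟨fun h => h.1, fun h => ⟨h, hT.edge_mem x y h⟩⟩
  · ext h
    have hN : ∀ k ∈ T.H, k ∩ T.N = k := fun k hk =>
      Finset.inter_eq_left.2 ((hT.H_subset k hk).trans Finset.sdiff_subset)
    simp only [restrict, Finset.mem_erase, Finset.mem_image]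
    constructor
    · rintro ⟨h1, k, hk, rfl⟩
      rwa [hN k hk]
    · intro hh
      exact ⟨fun e => hT.H_nonempty (e ▸ hh), h, hh, hN h hh⟩
  · intro x hx hx'
    rfl

theorem mem_cuts {T : HForest d} {A : Finset ℕ} :
    A ∈ T.cuts ↔ A ⊆ T.N ∧ T.ParentClosed A := by
  simp [cuts]

end HForest

/-! ### Families evaluated on the parts of a forest -/

section Values

variable {d : ℕ} {Ω : Type u} [MeasurableSpace Ω] (P : Measure Ω) [IsProbabilityMeasure P]

variable (d) in
/-- Families of random variables indexed by all Lions forests. -/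
abbrev FullFam : Type u := ∀ T : LionsForest d, L0 P T.1

variable {P}

/-- The value of a family on raw data; it is `0` outside Lions forests. -/
def FullFam.raw (f : FullFam d P) (S : HForest d) : L0 P S :=
  if h : S.IsLions then f ⟨S, h⟩ else 0

theorem FullFam.raw_eq (f : FullFam d P) (S : LionsForest d) : f.raw S.1 = f S :=
  dif_pos S.2

/-- The value of a family on the restriction of `T` to `A`, in the algebra of `T`. -/
def FullFam.val (f : FullFam d P) (T : HForest d) (A : Finset ℕ) : Alg P d (Idx T) T.N :=
  emb P (coupling T A) (coupling_injective T A) (incl T A) (coords P (f.raw (T.restrict A)))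

theorem coupling_some_spec (T : HForest d) (A : Finset ℕ) (h : (T.restrict A).H) :
    ∃ k : T.H, coupling T A (some h) = some k ∧ k.1 ∩ A = h.1 :=
  ⟨_, rfl, (HForest.mem_H_restrict h.2).2.choose_spec.2⟩

theorem HForest.IsLions.H_unique {T : HForest d} (hT : T.IsLions) {h k : Finset ℕ} (hh : h ∈ T.H)
    (hk : k ∈ T.H) {x : ℕ} (hx : x ∈ h) (hx' : x ∈ k) : h = k := by
  by_contra hne
  exact Finset.disjoint_left.1 (hT.H_disjoint h hh k hk hne) hx hx'

/-- The hyperedges of `T` are disjoint and those of a restriction are nonempty, so the choice made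
in `coupling` is forced. -/
theorem coupling_some {T : HForest d} (hT : T.IsLions) {A : Finset ℕ} (h : (T.restrict A).H)
    (k : T.H) (hk : h.1 ⊆ k.1) : coupling T A (some h) = some k := by
  obtain ⟨k', h1, h2⟩ := coupling_some_spec T A h
  rw [h1]
  have hne := (HForest.mem_H_restrict h.2).1
  obtain ⟨x, hx⟩ := Finset.nonempty_iff_ne_empty.2 hne
  exact congrArg some (Subtype.ext (hT.H_unique k'.2 k.2
    (Finset.mem_inter.1 (h2.symm ▸ hx)).1 (hk hx)))

/-- Characterization of `val` by any embedding of the arguments and the nodes. -/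
theorem FullFam.emb_eq_val (f : FullFam d P) {S T : HForest d} (hT : T.IsLions) {A : Finset ℕ}
    (hS : S = T.restrict A) (φ : Idx S → Idx T) (hφ : Function.Injective φ) (ν : S.N → T.N)
    (hν : ∀ x, (ν x).1 = x.1) (h0 : φ none = none)
    (h1 : ∀ h : S.H, ∃ k : T.H, φ (some h) = some k ∧ h.1 ⊆ k.1) :
    emb P φ hφ ν (coords P (f.raw S)) = f.val T A := by
  subst hS
  have e1 : φ = coupling T A := by
    funext h
    rcases h with _ | h
    · exact h0
    · obtain ⟨k, hk, hk'⟩ := h1 h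
      rw [hk, coupling_some hT h k hk']
  have e2 : ν = incl T A := by
    funext x
    exact Subtype.ext (hν x)
  subst e1 e2
  rfl

/-- This transitivity moves a cut of a part of `T` into the algebra of `T` itself, where iterated
convolutions can be compared. -/
theorem FullFam.val_restrict (f : FullFam d P) {T : HForest d} (hT : T.IsLions)
    {C A : Finset ℕ} (hA : A ⊆ C) :
    emb P (coupling T C) (coupling_injective T C) (incl T C) (f.val (T.restrict C) A) =
      f.val T A := by
  rw [FullFam.val, emb_emb]
  refine f.emb_eq_val hT ?_ _ _ _ (fun x => rfl) rfl fun h => ?_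
  · rw [HForest.restrict_restrict, Finset.inter_eq_right.2 hA]
  · obtain ⟨k, hk, hk'⟩ := coupling_some_spec (T.restrict C) A h
    obtain ⟨l, hl, hl'⟩ := coupling_some_spec T C k
    refine ⟨l, by rw [Function.comp_apply, hk, hl], ?_⟩
    rw [← hk', ← hl']
    exact Finset.inter_subset_left.trans Finset.inter_subset_left

theorem FullFam.val_self (f : FullFam d P) (T : LionsForest d) :
    f.val T.1 T.1.N = coords P (f T) := by
  rw [← f.raw_eq T, ← emb_id P (coords P (f.raw T.1))]
  refine (f.emb_eq_val T.2 (HForest.restrict_self T.2).symm _ _ _ (fun x => rfl) rfl fun h => ?_).symm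
  exact ⟨h, rfl, subset_rfl⟩

/-- The convolution of full families. -/
def FullFam.conv (f g : FullFam d P) : FullFam d P := fun T =>
  ∑ A : T.1.cuts, couple P T.1 (T.1.N \ A.1) A.1
    (f (T.prune A.1 (HForest.parentClosed_of_mem_cuts A.2)))
    (g (T.root A.1 (HForest.parentClosed_of_mem_cuts A.2)))

theorem FullFam.coords_conv (f g : FullFam d P) (T : LionsForest d) :
    coords P (f.conv g T) = ∑ A ∈ T.1.cuts, f.val T.1 (T.1.N \ A) * g.val T.1 A := by
  rw [FullFam.conv, coords_sum, ← Finset.sum_coe_sort T.1.cuts]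
  refine Finset.sum_congr rfl fun A _ => ?_
  refine (coords_couple P _ _ _ _).trans ?_
  rw [← FullFam.raw_eq f, ← FullFam.raw_eq g]
  rfl

theorem FullFam.val_conv (f g : FullFam d P) {T : HForest d} (hT : T.IsLions) {C : Finset ℕ}
    (hC : C ⊆ T.N) (hTC : (T.restrict C).IsLions) :
    (f.conv g).val T C = ∑ A ∈ (T.restrict C).cuts, f.val T (C \ A) * g.val T A := by
  have hN : (T.restrict C).N = C := Finset.inter_eq_right.2 hC
  rw [FullFam.val, (f.conv g).raw_eq ⟨_, hTC⟩]
  refine (congrArg _ (f.coords_conv g ⟨_, hTC⟩)).trans ?_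
  rw [map_sum]
  refine Finset.sum_congr rfl fun A hA => ?_
  have hA' : A ⊆ C := hN ▸ (HForest.mem_cuts.1 hA).1
  rw [map_mul]
  have h1 : (T.restrict C).N \ A = C \ A := by rw [hN]
  refine congrArg₂ (· * ·) ((f.val_restrict hT (h1 ▸ Finset.sdiff_subset)).trans ?_)
    (g.val_restrict hT hA')
  rw [h1]

theorem FullFam.ext_coords {f g : FullFam d P} (h : ∀ T, coords P (f T) = coords P (g T)) :
    f = g :=
  funext fun T => coords_injective P (h T)

end Values

end

end Lions

namespace Lions

noncomputable section

open scoped Classical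

set_option linter.unusedSectionVars false

/-! ### The convolution ring of full families -/

namespace HForest

variable {d : ℕ}

theorem mem_cuts_restrict {T : HForest d} {A C : Finset ℕ} (hC : C ⊆ T.N) :
    A ∈ (T.restrict C).cuts ↔
      A ⊆ C ∧ ∀ x y, T.Edge x y → x ∈ C → y ∈ C → x ∈ A → y ∈ A := by
  rw [mem_cuts]
  have : (T.restrict C).N = C := Finset.inter_eq_right.2 hC
  rw [this]
  refine and_congr_right fun _ => ?_
  constructor
  · intro h x y hxy hx hy hxA
    exact h x y (edge_restrict.2 ⟨hxy, hx, hy⟩) hxA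
  · intro h x y hxy hxA
    rw [edge_restrict] at hxy
    exact h x y hxy.1 hxy.2.1 hxy.2.2 hxA

theorem IsLions.of_cut {T : HForest d} (hT : T.IsLions) {A : Finset ℕ} (hA : A ∈ T.cuts) :
    (T.restrict A).IsLions := hT.restrict_parentClosed (mem_cuts.1 hA).2

theorem IsLions.of_cut_compl {T : HForest d} (hT : T.IsLions) {A : Finset ℕ} (hA : A ∈ T.cuts) :
    (T.restrict (T.N \ A)).IsLions :=
  hT.restrict_childClosed (hT.childClosed_compl (mem_cuts.1 hA).2)

end HForest

variable {d : ℕ} {Ω : Type u} [MeasurableSpace Ω] {P : Measure Ω} [IsProbabilityMeasure P]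

namespace FullFam

theorem val_congr {f g : FullFam d P} {T : HForest d} {A : Finset ℕ}
    (h : ∀ hL : (T.restrict A).IsLions, f ⟨_, hL⟩ = g ⟨_, hL⟩) : f.val T A = g.val T A := by
  unfold FullFam.val FullFam.raw
  split_ifs with hL
  · rw [h hL]
  · rfl

theorem raw_add (f g : FullFam d P) (S : HForest d) : raw (f + g) S = f.raw S + g.raw S := by
  unfold FullFam.raw
  split_ifs
  · rfl
  · simp

theorem raw_smul (r : ℝ) (f : FullFam d P) (S : HForest d) : raw (r • f) S = r • f.raw S := by
  unfold FullFam.raw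
  split_ifs
  · rfl
  · exact (smul_zero (A := L0 P S) r).symm

theorem val_add (f g : FullFam d P) (T : HForest d) (A : Finset ℕ) :
    val (f + g) T A = f.val T A + g.val T A := by
  rw [val, raw_add, coords_add, map_add]; rfl

theorem val_smul (r : ℝ) (f : FullFam d P) (T : HForest d) (A : Finset ℕ) :
    val (r • f) T A = r • f.val T A := by
  rw [val, raw_smul, coords_smul, emb_smul]; rfl

/-- Evaluation at a restriction as a linear map. -/
def valₗ (T : HForest d) (A : Finset ℕ) : FullFam d P →ₗ[ℝ] Alg P d (Idx T) T.N where
  toFun f := f.val T A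
  map_add' f g := val_add f g T A
  map_smul' r f := val_smul r f T A

theorem val_zero (T : HForest d) (A : Finset ℕ) : val (0 : FullFam d P) T A = 0 :=
  map_zero (valₗ T A)

theorem val_sum {ι : Type*} (s : Finset ι) (f : ι → FullFam d P) (T : HForest d) (A : Finset ℕ) :
    val (∑ i ∈ s, f i) T A = ∑ i ∈ s, (f i).val T A := map_sum (valₗ T A) f s

theorem val_eq_zero {f : FullFam d P} {T : HForest d} {A : Finset ℕ}
    (h : ∀ hL : (T.restrict A).IsLions, f ⟨_, hL⟩ = 0) : f.val T A = 0 :=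
  (val_congr (g := (0 : FullFam d P)) h).trans (val_zero T A)

variable (d P) in
/-- The unit of the convolution. -/
def counit : FullFam d P := fun T => scalar P T.1 (if T.1.N = ∅ then 1 else 0)

theorem val_scalar {f : FullFam d P} {T : HForest d} {A : Finset ℕ} (r : ℝ)
    (hL : (T.restrict A).IsLions) (h : f ⟨_, hL⟩ = scalar P _ r) : f.val T A = r • 1 := by
  rw [val, f.raw_eq ⟨_, hL⟩, h, coords_scalar, emb_smul, map_one]

theorem val_counit {T : HForest d} {A : Finset ℕ} (hA : A ⊆ T.N) (hL : (T.restrict A).IsLions) :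
    (counit d P).val T A = if A = ∅ then 1 else 0 := by
  have hN : (T.restrict A).N = A := Finset.inter_eq_right.2 hA
  rw [val_scalar _ hL rfl, hN]
  split_ifs <;> simp

instance : Mul (FullFam d P) := ⟨FullFam.conv⟩

instance : One (FullFam d P) := ⟨counit d P⟩

theorem coords_mul (f g : FullFam d P) (T : LionsForest d) :
    coords P ((f * g) T) = ∑ A ∈ T.1.cuts, f.val T.1 (T.1.N \ A) * g.val T.1 A :=
  coords_conv f g T

theorem val_mul (f g : FullFam d P) {T : HForest d} (hT : T.IsLions) {C : Finset ℕ}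
    (hC : C ⊆ T.N) (hTC : (T.restrict C).IsLions) :
    (f * g).val T C = ∑ A ∈ (T.restrict C).cuts, f.val T (C \ A) * g.val T A :=
  val_conv f g hT hC hTC

theorem val_one {T : HForest d} {A : Finset ℕ} (hA : A ⊆ T.N) (hL : (T.restrict A).IsLions) :
    (1 : FullFam d P).val T A = if A = ∅ then 1 else 0 := val_counit hA hL

theorem one_mul' (f : FullFam d P) : 1 * f = f := by
  refine ext_coords fun T => ?_
  rw [coords_mul, Finset.sum_eq_single T.1.N]
  · have h : T.1.N ∈ T.1.cuts := HForest.mem_cuts.2 ⟨subset_rfl, fun x y h _ => (T.2.edge_mem x y h).2⟩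
    rw [val_one Finset.sdiff_subset (T.2.of_cut_compl h), Finset.sdiff_self, if_pos rfl, one_mul,
      val_self]
  · intro A hA hne
    rw [val_one Finset.sdiff_subset (T.2.of_cut_compl hA), if_neg, zero_mul]
    rw [Finset.sdiff_eq_empty_iff_subset]
    exact fun h => hne (subset_antisymm (HForest.mem_cuts.1 hA).1 h)
  · intro h
    exact absurd (HForest.mem_cuts.2 ⟨subset_rfl, fun x y h _ => (T.2.edge_mem x y h).2⟩) h

theorem mul_one' (f : FullFam d P) : f * 1 = f := by
  refine ext_coords fun T => ?_
  have h0 : ∅ ∈ T.1.cuts := HForest.mem_cuts.2 ⟨Finset.empty_subset _, fun x y _ h => by simp at h⟩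
  rw [coords_mul, Finset.sum_eq_single ∅]
  · rw [val_one (Finset.empty_subset _) (T.2.of_cut h0), if_pos rfl, mul_one, Finset.sdiff_empty,
      val_self]
  · intro A hA hne
    rw [val_one (HForest.mem_cuts.1 hA).1 (T.2.of_cut hA), if_neg hne, mul_zero]
  · intro h
    exact absurd h0 h

/-- Both sides are sums over chains of parent-closed sets `A ⊆ D ⊆ N`, with `h` on `A`, `g` on `D \
A` and `f` on `N \ D`. -/
theorem mul_assoc' (f g h : FullFam d P) : f * g * h = f * (g * h) := by
  refine ext_coords fun T => ?_
  rw [coords_mul, coords_mul]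
  have e1 : ∀ A ∈ T.1.cuts, (f * g).val T.1 (T.1.N \ A) * h.val T.1 A =
      ∑ B ∈ (T.1.restrict (T.1.N \ A)).cuts,
        f.val T.1 ((T.1.N \ A) \ B) * g.val T.1 B * h.val T.1 A := by
    intro A hA
    rw [val_mul f g T.2 Finset.sdiff_subset (T.2.of_cut_compl hA), Finset.sum_mul]
  have e2 : ∀ D ∈ T.1.cuts, f.val T.1 (T.1.N \ D) * (g * h).val T.1 D =
      ∑ A ∈ (T.1.restrict D).cuts,
        f.val T.1 (T.1.N \ D) * (g.val T.1 (D \ A) * h.val T.1 A) := by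
    intro D hD
    rw [val_mul g h T.2 (HForest.mem_cuts.1 hD).1 (T.2.of_cut hD), Finset.mul_sum]
  rw [Finset.sum_congr rfl e1, Finset.sum_congr rfl e2, Finset.sum_sigma', Finset.sum_sigma']
  -- On the left a cut `A` is followed by a cut `B` of the pruned part; the chain is `A ⊆ A ∪ B`.
  refine Finset.sum_bij' (fun x _ => ⟨x.1 ∪ x.2, x.1⟩) (fun x _ => ⟨x.2, x.1 \ x.2⟩) ?_ ?_ ?_ ?_ ?_
  · rintro ⟨A, B⟩ hx
    simp only [Finset.mem_sigma] at hx ⊢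
    obtain ⟨hA, hB⟩ := hx
    rw [HForest.mem_cuts_restrict Finset.sdiff_subset] at hB
    rw [HForest.mem_cuts] at hA
    have hD : A ∪ B ⊆ T.1.N := Finset.union_subset hA.1 (hB.1.trans Finset.sdiff_subset)
    rw [HForest.mem_cuts_restrict hD, HForest.mem_cuts]
    refine ⟨⟨hD, fun x y hxy hx => ?_⟩, Finset.subset_union_left, fun x y hxy _ _ hx => hA.2 x y hxy hx⟩
    rw [Finset.mem_union] at hx ⊢
    by_cases hy : y ∈ A
    · exact Or.inl hy
    rcases hx with hx | hx
    · exact Or.inl (hA.2 x y hxy hx)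
    · exact Or.inr (hB.2 x y hxy (hB.1 hx)
        (Finset.mem_sdiff.2 ⟨(T.2.edge_mem x y hxy).2, hy⟩) hx)
  · rintro ⟨D, A⟩ hx
    simp only [Finset.mem_sigma] at hx ⊢
    obtain ⟨hD, hA⟩ := hx
    rw [HForest.mem_cuts] at hD
    rw [HForest.mem_cuts_restrict hD.1] at hA
    rw [HForest.mem_cuts_restrict Finset.sdiff_subset, HForest.mem_cuts]
    refine ⟨⟨hA.1.trans hD.1, fun x y hxy hx => ?_⟩, Finset.sdiff_subset_sdiff hD.1 subset_rfl,
      fun x y hxy _ hy hx => ?_⟩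
    · exact hA.2 x y hxy (hA.1 hx) (hD.2 x y hxy (hA.1 hx)) hx
    · rw [Finset.mem_sdiff] at hx hy ⊢
      exact ⟨hD.2 x y hxy hx.1, hy.2⟩
  · rintro ⟨A, B⟩ hx
    simp only [Finset.mem_sigma] at hx
    rw [HForest.mem_cuts_restrict Finset.sdiff_subset] at hx
    have hdisj : Disjoint A B := (Finset.disjoint_of_subset_left hx.2.1 Finset.sdiff_disjoint).symm
    simp [Finset.union_sdiff_cancel_left hdisj]
  · rintro ⟨D, A⟩ hx
    simp only [Finset.mem_sigma] at hx
    rw [HForest.mem_cuts] at hx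
    have hA := ((HForest.mem_cuts_restrict hx.1.1).1 hx.2).1
    simp [Finset.union_sdiff_of_subset hA]
  · rintro ⟨A, B⟩ hx
    simp only [Finset.mem_sigma] at hx
    rw [HForest.mem_cuts_restrict Finset.sdiff_subset] at hx
    have hdisj : Disjoint A B := (Finset.disjoint_of_subset_left hx.2.1 Finset.sdiff_disjoint).symm
    dsimp only
    rw [Finset.union_sdiff_cancel_left hdisj, sdiff_sdiff_left, mul_assoc]
    rfl

instance : Ring (FullFam d P) where
  __ := (inferInstance : AddCommGroup (FullFam d P))
  mul := (· * ·)
  one := 1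
  mul_assoc := mul_assoc'
  one_mul := one_mul'
  mul_one := mul_one'
  zero_mul f := by
    refine ext_coords fun T => ?_
    rw [coords_mul]
    exact Finset.sum_eq_zero fun A _ => by rw [val_zero, zero_mul]
  mul_zero f := by
    refine ext_coords fun T => ?_
    rw [coords_mul]
    exact Finset.sum_eq_zero fun A _ => by rw [val_zero, mul_zero]
  left_distrib f g h := by
    refine ext_coords fun T => ?_
    rw [coords_mul, Pi.add_apply, coords_add, coords_mul, coords_mul, ← Finset.sum_add_distrib]
    exact Finset.sum_congr rfl fun A _ => by rw [val_add, mul_add]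
  right_distrib f g h := by
    refine ext_coords fun T => ?_
    rw [coords_mul, Pi.add_apply, coords_add, coords_mul, coords_mul, ← Finset.sum_add_distrib]
    exact Finset.sum_congr rfl fun A _ => by rw [val_add, add_mul]

theorem smul_mul' (r : ℝ) (f g : FullFam d P) : r • f * g = r • (f * g) := by
  refine ext_coords fun T => ?_
  rw [coords_mul, Pi.smul_apply, coords_smul, coords_mul, Finset.smul_sum]
  exact Finset.sum_congr rfl fun A _ => by rw [val_smul, smul_mul_assoc]

theorem mul_smul' (r : ℝ) (f g : FullFam d P) : f * r • g = r • (f * g) := by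
  refine ext_coords fun T => ?_
  rw [coords_mul, Pi.smul_apply, coords_smul, coords_mul, Finset.smul_sum]
  exact Finset.sum_congr rfl fun A _ => by rw [val_smul, mul_smul_comm]

instance : Algebra ℝ (FullFam d P) where
  smul r f := r • f
  algebraMap :=
    { toFun := fun r => r • (1 : FullFam d P)
      map_one' := funext fun T => one_smul ℝ ((1 : FullFam d P) T)
      map_zero' := funext fun T => zero_smul ℝ ((1 : FullFam d P) T)
      map_add' := fun r s => funext fun T => add_smul r s ((1 : FullFam d P) T)
      map_mul' := fun r s => by
        rw [smul_mul', one_mul', mul_smul] }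
  commutes' r f := (smul_mul' r 1 f).trans <| by
    rw [one_mul', ← mul_one' (r • f), smul_mul', ← mul_smul']
    rfl
  smul_def' r f := by
    refine Eq.trans ?_ (smul_mul' r 1 f).symm
    rw [one_mul']

/-! ### Truncation -/

theorem card_restrict_le (T : HForest d) (A : Finset ℕ) : (T.restrict A).N.card ≤ T.N.card :=
  Finset.card_le_card Finset.inter_subset_left

/-- Parts of a forest have no more nodes than the forest. This permits replacing a series by a
polynomial of fixed degree inside a convolution. -/
theorem mul_congr {f f' g g' : FullFam d P} (n : ℕ) (hf : ∀ T, T.1.N.card ≤ n → f T = f' T)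
    (hg : ∀ T, T.1.N.card ≤ n → g T = g' T) (T : LionsForest d) (hT : T.1.N.card ≤ n) :
    (f * g) T = (f' * g') T := by
  apply coords_injective P
  rw [coords_mul, coords_mul]
  exact Finset.sum_congr rfl fun A _ => congrArg₂ _
    (val_congr fun _ => hf _ ((card_restrict_le _ _).trans hT))
    (val_congr fun _ => hg _ ((card_restrict_le _ _).trans hT))

theorem pow_congr {f f' : FullFam d P} (n : ℕ) (hf : ∀ T, T.1.N.card ≤ n → f T = f' T) (k : ℕ)
    (T : LionsForest d) (hT : T.1.N.card ≤ n) : (f ^ k) T = (f' ^ k) T := by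
  induction k generalizing T with
  | zero => rw [pow_zero, pow_zero]
  | succ k ih => rw [pow_succ, pow_succ]; exact mul_congr n ih hf T hT

/-- With fewer than `k + l` nodes to share, either the root part has fewer than `l` or the pruned
part fewer than `k`. -/
theorem mul_eq_zero_of_card {f g : FullFam d P} {k l : ℕ} (hf : ∀ T, T.1.N.card < k → f T = 0)
    (hg : ∀ T, T.1.N.card < l → g T = 0) (T : LionsForest d) (hT : T.1.N.card < k + l) :
    (f * g) T = 0 := by
  apply coords_injective P
  rw [coords_mul, coords_zero]
  refine Finset.sum_eq_zero fun A hA => ?_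
  have hAN := (HForest.mem_cuts.1 hA).1
  have hc := Finset.card_sdiff_add_card_eq_card hAN
  by_cases h : A.card < l
  · rw [val_eq_zero (f := g) fun _ => hg _ ?_, mul_zero]
    exact (Finset.card_le_card Finset.inter_subset_right).trans_lt h
  · rw [val_eq_zero (f := f) fun _ => hf _ ?_, zero_mul]
    refine (Finset.card_le_card Finset.inter_subset_right).trans_lt ?_
    omega

theorem pow_eq_zero_of_card {f : FullFam d P} (hf : ∀ T, T.1.N = ∅ → f T = 0) (k : ℕ)
    (T : LionsForest d) (hT : T.1.N.card < k) : (f ^ k) T = 0 := by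
  induction k generalizing T with
  | zero => omega
  | succ k ih =>
    rw [pow_succ]
    refine mul_eq_zero_of_card (k := k) (l := 1) ih (fun T h => hf T ?_) T hT
    exact Finset.card_eq_zero.1 (by omega)

end FullFam

end

end Lions

namespace Lions

noncomputable section

open scoped Classical

set_option linter.unusedSectionVars false

/-! ### Families compatible with isomorphisms and with `detach` -/

namespace HForest

variable {d : ℕ}

theorem map_symm_map (σ : Equiv.Perm ℕ) (k : Finset ℕ) :
    (k.map σ.symm.toEmbedding).map σ.toEmbedding = k := by
  ext x; simp

theorem IsIso.restrict {σ : Equiv.Perm ℕ} {T T' : HForest d} (h : IsIso σ T T') (C : Finset ℕ) :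
    IsIso σ (T.restrict C) (T'.restrict (C.map σ.toEmbedding)) where
  map_N x := by simp [mem_N_restrict, h.map_N]
  map_E x y := by simp [edge_restrict, h.map_E]
  map_h0 x := by simp [HForest.restrict, h.map_h0]
  map_H k := by
    simp only [HForest.restrict, Finset.mem_erase, Finset.mem_image, ne_eq, Finset.map_eq_empty]
    refine and_congr_right fun _ => ?_
    constructor
    · rintro ⟨l, hl, hlk⟩
      refine ⟨l.map σ.symm.toEmbedding, ?_, ?_⟩
      · rwa [← h.map_H, map_symm_map]
      · apply Finset.map_injective σ.toEmbedding
        rw [Finset.map_inter, map_symm_map, hlk]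
    · rintro ⟨l, hl, rfl⟩
      exact ⟨l.map σ.toEmbedding, (h.map_H l).2 hl, by rw [Finset.map_inter]⟩
  map_L x hx hx' := h.map_L x _ _

theorem detach_restrict (T : HForest d) (C : Finset ℕ) :
    (T.restrict C).detach = T.detach.restrict C := by
  refine ext_of rfl rfl (by simp [detach, restrict]) ?_ fun x hx hx' => rfl
  ext k
  simp only [detach, restrict, Finset.mem_erase, Finset.mem_image, Finset.mem_insert]
  constructor
  · rintro ⟨h1, rfl | ⟨-, l, hl, rfl⟩⟩
    · exact ⟨h1, T.h0, ⟨fun e => h1 (by rw [e, Finset.empty_inter]), Or.inl rfl⟩, rfl⟩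
    · exact ⟨h1, l, ⟨fun e => h1 (by rw [e, Finset.empty_inter]), Or.inr hl⟩, rfl⟩
  · rintro ⟨h1, l, ⟨h2, rfl | hl⟩, rfl⟩
    · exact ⟨h1, Or.inl rfl⟩
    · exact ⟨h1, Or.inr ⟨h1, l, hl, rfl⟩⟩

/-- The hyperedge `h` becomes the distinguished one. -/
def attach (S : HForest d) (h : Finset ℕ) : HForest d where
  N := S.N
  E := S.E
  h0 := h
  H := S.H.erase h
  L := S.L

/-- A partial inverse of `detach`. The root `r` in `h` is what condition (i) demands of a
distinguished hyperedge. -/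
theorem IsLions.attach {S : HForest d} (hS : S.IsLions) (h0 : S.h0 = ∅) {h : Finset ℕ}
    (hh : h ∈ S.H) {r : ℕ} (hr : r ∈ h) (hd : S.depth r = 0) : (S.attach h).IsLions where
  edge_mem := hS.edge_mem
  parent_unique := hS.parent_unique
  acyclic := hS.acyclic
  h0_subset := (hS.H_subset h hh).trans Finset.sdiff_subset
  H_subset k hk x hx := by
    obtain ⟨hne, hk⟩ := Finset.mem_erase.1 hk
    refine Finset.mem_sdiff.2 ⟨(Finset.mem_sdiff.1 (hS.H_subset k hk hx)).1, fun hx' => ?_⟩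
    exact Finset.disjoint_left.1 (hS.H_disjoint k hk h hh hne) hx hx'
  H_nonempty hk := hS.H_nonempty (Finset.mem_erase.1 hk).2
  H_disjoint k hk l hl := hS.H_disjoint k (Finset.mem_erase.1 hk).2 l (Finset.mem_erase.1 hl).2
  H_cover x hx := by
    obtain ⟨hxN, hxh⟩ := Finset.mem_sdiff.1 hx
    obtain ⟨k, hk, hxk⟩ := hS.H_cover x (by rw [h0, Finset.sdiff_empty]; exact hxN)
    exact ⟨k, Finset.mem_erase.2 ⟨fun e => hxh (e ▸ hxk), hk⟩, hxk⟩
  h0_root _ := ⟨r, hr, fun y _ => hd.le.trans (Nat.zero_le _)⟩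
  chain k hk := hS.chain k (by
    simp only [HForest.attach, Finset.mem_insert, Finset.mem_erase] at hk ⊢
    rcases hk with rfl | hk
    · exact Or.inr hh
    · exact Or.inr hk.2)
  sibling k hk := hS.sibling k (by
    simp only [HForest.attach, Finset.mem_insert, Finset.mem_erase] at hk ⊢
    rcases hk with rfl | hk
    · exact Or.inr hh
    · exact Or.inr hk.2)

theorem IsLions.detach_attach {S : HForest d} (hS : S.IsLions) (h0 : S.h0 = ∅) {h : Finset ℕ}
    (hh : h ∈ S.H) : (S.attach h).detach = S := by
  refine ext_of rfl rfl h0.symm ?_ fun x hx hx' => rfl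
  simp only [HForest.detach, HForest.attach]
  rw [Finset.insert_erase hh, Finset.erase_eq_of_notMem hS.H_nonempty]

theorem IsLions.exists_root {S : HForest d} (hS : S.IsLions) (hN : S.N.Nonempty) :
    ∃ r ∈ S.N, S.depth r = 0 := by
  obtain ⟨r, hr, hmin⟩ := Finset.exists_min_image S.N S.depth hN
  refine ⟨r, hr, ?_⟩
  by_contra hne
  obtain ⟨p, hp⟩ := exists_parent hne
  have := hmin p (hS.edge_mem _ _ hp).2
  have := hS.depth_succ hp
  omega

end HForest

/-- Consequently a compatible family evaluated on a nonempty forest with empty `h0` does not depend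
on `ω_0`: the range of `detachIdx` omits the index `none`. -/
theorem LionsForest.exists_detach {d : ℕ} (S : LionsForest d) (h0 : S.1.h0 = ∅)
    (hN : S.1.N.Nonempty) : ∃ S₀ : LionsForest d, S₀.1.h0.Nonempty ∧ S₀.detach = S := by
  obtain ⟨r, hr, hd⟩ := S.2.exists_root hN
  obtain ⟨h, hh, hrh⟩ := S.2.H_cover r (by rw [h0, Finset.sdiff_empty]; exact hr)
  exact ⟨⟨_, S.2.attach h0 hh hrh hd⟩, ⟨r, hrh⟩, Subtype.ext (S.2.detach_attach h0 hh)⟩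

variable {d : ℕ} {Ω : Type u} [MeasurableSpace Ω] {P : Measure Ω} [IsProbabilityMeasure P]

theorem emb_congr {ι κ M N : Type} [Fintype ι] [Fintype κ] {φ φ' : ι → κ}
    {hφ : Function.Injective φ} {hφ' : Function.Injective φ'} {ν ν' : M → N} (h : φ = φ')
    (h' : ν = ν') (a : Alg P d ι M) : emb P φ hφ ν a = emb P φ' hφ' ν' a := by
  subst h h'; rfl

namespace FullFam

/-- Compatibility with isomorphisms and with `detach`; the value on the empty forest is a
constant. -/
structure IsCompat (f : FullFam d P) : Prop where
  natural : ∀ (T T' : LionsForest d) (σ : Equiv.Perm ℕ) (h : HForest.IsIso σ T.1 T'.1),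
    f T' = transport P h (f T)
  unit : ∃ c : ℝ, ∀ T : LionsForest d, T.1.N = ∅ → f T = scalar P T.1 c
  detach : ∀ (T : LionsForest d) (h : T.1.h0.Nonempty),
    coords P (f T.detach) = emb P (detachIdx T h) (detachIdx_injective T h) id (coords P (f T))

theorem emb_iso_val {f : FullFam d P} (hf : f.IsCompat) {σ : Equiv.Perm ℕ} {T T' : HForest d}
    (hT' : T'.IsLions) (h : HForest.IsIso σ T T') {C : Finset ℕ} (hC : (T.restrict C).IsLions)
    (hC' : (T'.restrict (C.map σ.toEmbedding)).IsLions) :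
    emb P (isoIdx h) (isoIdx_injective h) (fun x => ⟨σ x.1, (h.map_N _).2 x.2⟩) (f.val T C) =
      f.val T' (C.map σ.toEmbedding) := by
  rw [val, val, f.raw_eq ⟨_, hC⟩, f.raw_eq ⟨_, hC'⟩,
    hf.natural ⟨_, hC⟩ ⟨_, hC'⟩ σ (h.restrict C)]
  refine (emb_emb P _ _ _ _ _ _ _).trans ?_
  refine Eq.trans ?_ (congrArg _ (coords_transport P (h.restrict C) _).symm)
  refine Eq.trans ?_ (emb_emb P _ _ _ _ _ _ _).symm
  refine emb_congr (funext fun k => ?_) rfl _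
  rcases k with _ | k
  · rfl
  · obtain ⟨l, hl, hl'⟩ := coupling_some_spec T C k
    rw [Function.comp_apply, hl, Function.comp_apply]
    symm
    exact coupling_some hT' _ ⟨_, (h.map_H _).2 l.2⟩
      (Finset.map_subset_map.2 (hl' ▸ Finset.inter_subset_left))

theorem map_mem_cuts {σ : Equiv.Perm ℕ} {T T' : HForest d} (h : HForest.IsIso σ T T')
    {A : Finset ℕ} (hA : A ∈ T.cuts) : A.map σ.toEmbedding ∈ T'.cuts := by
  rw [HForest.mem_cuts] at hA ⊢
  refine ⟨fun x hx => ?_, fun x y hxy hx => ?_⟩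
  · obtain ⟨z, hz, rfl⟩ := Finset.mem_map.1 hx
    exact (h.map_N z).2 (hA.1 hz)
  · obtain ⟨z, hz, rfl⟩ := Finset.mem_map.1 hx
    obtain ⟨w, rfl⟩ := σ.surjective y
    exact Finset.mem_map_of_mem _ (hA.2 z w ((h.map_E z w).1 hxy) hz)

theorem map_N_eq {σ : Equiv.Perm ℕ} {T T' : HForest d} (h : HForest.IsIso σ T T') :
    T.N.map σ.toEmbedding = T'.N := by
  ext x
  obtain ⟨y, rfl⟩ := σ.surjective x
  simp [h.map_N]

theorem IsCompat.mul_natural {f g : FullFam d P} (hf : f.IsCompat) (hg : g.IsCompat)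
    (T T' : LionsForest d) (σ : Equiv.Perm ℕ) (h : HForest.IsIso σ T.1 T'.1) :
    (f * g) T' = transport P h ((f * g) T) := by
  apply coords_injective P
  rw [coords_transport, coords_mul, coords_mul, map_sum]
  symm
  refine Finset.sum_bij (fun A _ => A.map σ.toEmbedding) (fun A hA => map_mem_cuts h hA)
    (fun A _ B _ hAB => Finset.map_injective _ hAB) (fun A hA => ?_) (fun A hA => ?_)
  · exact ⟨_, map_mem_cuts h.symm hA, HForest.map_symm_map σ A⟩
  · have hA' := map_mem_cuts h hA
    have e : (T.1.N \ A).map σ.toEmbedding = T'.1.N \ A.map σ.toEmbedding := by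
      rw [Finset.map_sdiff, map_N_eq h]
    have hB' : (T'.1.restrict ((T.1.N \ A).map σ.toEmbedding)).IsLions := by
      rw [e]; exact T'.2.of_cut_compl hA'
    rw [map_mul, emb_iso_val hg T'.2 h (T.2.of_cut hA) (T'.2.of_cut hA'),
      emb_iso_val hf T'.2 h (T.2.of_cut_compl hA) hB', e]

theorem exists_emb_eq_val (f : FullFam d P) {S T : HForest d} {A : Finset ℕ}
    (hS : S = T.restrict A) : ∃ (φ : Idx S → Idx T) (hφ : Function.Injective φ) (ν : S.N → T.N),
      (∀ x, (ν x).1 = x.1) ∧ φ none = none ∧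
      (∀ h : S.H, ∃ k : T.H, φ (some h) = some k ∧ h.1 ⊆ k.1) ∧
      f.val T A = emb P φ hφ ν (coords P (f.raw S)) := by
  subst hS
  refine ⟨coupling T A, coupling_injective T A, incl T A, fun _ => rfl, rfl, fun h => ?_, rfl⟩
  obtain ⟨k, hk, hk'⟩ := coupling_some_spec T A h
  exact ⟨k, hk, hk' ▸ Finset.inter_subset_left⟩

/-- If `C` meets `h0`, this is compatibility with `detach` on `T|_C`. If not, detaching leaves
`T|_C` unchanged, but the left side feeds `ω_{h0}` where the right side feeds `ω_0`; the claim is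
then that the value on `T|_C` ignores this argument. -/
theorem emb_detach_val {f : FullFam d P} (hf : f.IsCompat) (T : LionsForest d)
    (h : T.1.h0.Nonempty) {C : Finset ℕ} (hC : (T.1.restrict C).IsLions) :
    emb P (detachIdx T h) (detachIdx_injective T h) id (f.val T.1 C) = f.val T.1.detach C := by
  obtain ⟨φ, hφ, ν, hν, hn, hs, e⟩ :=
    exists_emb_eq_val f (HForest.detach_restrict T.1 C)
  have hl : ∀ k ∈ (T.1.restrict C).H, ∃ (l : T.1.H) (hk : k ∈ (T.1.restrict C).H)
      (hl : l.1 ∈ T.1.detach.H), coupling T.1 C (some ⟨k, hk⟩) = some l ∧ k ⊆ l.1 ∧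
      detachIdx T h (some l) = some ⟨l.1, hl⟩ := by
    intro k hk
    obtain ⟨l, hl, hl'⟩ := coupling_some_spec T.1 C ⟨k, hk⟩
    exact ⟨l, hk, _, hl, (show l.1 ∩ C = k from hl') ▸ Finset.inter_subset_left, rfl⟩
  have key : ∀ (k : (T.1.restrict C).H) (k' : (T.1.restrict C).detach.H), k.1 = k'.1 →
      detachIdx T h (coupling T.1 C (some k)) = φ (some k') := by
    intro k k' hkk
    obtain ⟨l, _, hlm, h1, h2, h3⟩ := hl k.1 k.2
    obtain ⟨m, hm, hm'⟩ := hs k'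
    rw [h1, h3, hm]
    obtain ⟨x, hx⟩ := Finset.nonempty_iff_ne_empty.2 (fun e => hC.H_nonempty (e ▸ k.2))
    exact congrArg some (Subtype.ext (T.2.detach.H_unique hlm m.2 (h2 hx) (hm' (hkk ▸ hx))))
  have hdetach : f.raw (T.1.restrict C).detach = f (LionsForest.detach ⟨_, hC⟩) :=
    f.raw_eq (LionsForest.detach ⟨_, hC⟩)
  by_cases h0 : (T.1.restrict C).h0.Nonempty
  · rw [e, hdetach, val, f.raw_eq ⟨_, hC⟩]
    refine (emb_emb P _ _ _ _ _ _ _).trans ?_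
    refine Eq.trans ?_ (congrArg _ (hf.detach ⟨_, hC⟩ h0).symm)
    refine Eq.trans ?_ (emb_emb P _ _ _ _ _ _ _).symm
    refine emb_congr (funext fun k => ?_) (funext fun x => Subtype.ext (hν x).symm) _
    rcases k with _ | k
    · obtain ⟨m, hm, hm'⟩ := hs ⟨(T.1.restrict C).h0, by simp [HForest.detach, h0.ne_empty]⟩
      refine Eq.trans ?_ hm.symm
      obtain ⟨x, hx⟩ := h0
      exact congrArg some (Subtype.ext (T.2.detach.H_unique (by simp [HForest.detach, h.ne_empty])
        m.2 (Finset.mem_inter.1 hx).1 (hm' hx)))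
    · exact key k _ rfl
  · have h0' := Finset.not_nonempty_iff_eq_empty.1 h0
    have hS : (T.1.restrict C).detach = T.1.restrict C := by
      refine HForest.ext_of rfl rfl h0'.symm ?_ fun _ _ _ => rfl
      rw [HForest.detach, h0']
      dsimp only
      rw [Finset.erase_insert_eq_erase, Finset.erase_eq_of_notMem hC.H_nonempty]
    -- The empty forest is no image of a forest with nonempty `h0`, which is why `IsCompat` asks for
    -- a constant there. A nonempty `T|_C` is some `S.detach`.
    rcases (T.1.restrict C).N.eq_empty_or_nonempty with hN | hN
    · obtain ⟨c, hc⟩ := hf.unit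
      have hC' : (T.1.detach.restrict C).IsLions := by
        rw [← HForest.detach_restrict]
        exact hC.detach
      rw [val_scalar c hC (hc ⟨_, hC⟩ hN), val_scalar c hC' (hc ⟨_, hC'⟩ hN), emb_smul, map_one]
      rfl
    · obtain ⟨S, hS0, hSd⟩ := LionsForest.exists_detach ⟨_, hC⟩ h0' hN
      have hSd' : T.1.restrict C = S.1.detach := congrArg Subtype.val hSd.symm
      obtain ⟨ψ, hψ, ξ, hξ, hψn, hψs, e'⟩ := exists_emb_eq_val f hSd'.symm
      obtain ⟨χ, hχ, ζ, hζ, hχn, hχs, e''⟩ :=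
        exists_emb_eq_val f ((hSd'.symm.trans hS.symm).trans (HForest.detach_restrict T.1 C))
      have hval : coords P (f.raw S.1.detach) =
          emb P (detachIdx S hS0) (detachIdx_injective S hS0) id (coords P (f S)) := by
        rw [← hf.detach]
        exact congrArg _ (f.raw_eq S.detach)
      rw [e', e'', hval]
      refine (congrArg _ (emb_emb P _ _ _ _ _ _ _)).trans ?_
      refine (emb_emb P _ _ _ _ _ _ _).trans ?_
      refine Eq.trans ?_ (emb_emb P _ _ _ _ _ _ _).symm
      -- Only indices `some k` occur after `detachIdx S hS0`, so the disagreement of the two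
      -- embeddings at `none` is harmless.
      have key2 : ∀ k : S.1.detach.H, detachIdx T h (ψ (some k)) = χ (some k) := by
        intro k
        obtain ⟨l, hl1, hl2⟩ := hψs k
        obtain ⟨m, hm1, hm2⟩ := hχs k
        obtain ⟨x, hx⟩ := Finset.nonempty_iff_ne_empty.2 (fun e => S.2.detach.H_nonempty (e ▸ k.2))
        rw [hl1, hm1]
        have hlm : l.1 ∈ T.1.detach.H := by
          have : l.1 ≠ ∅ := Finset.ne_empty_of_mem (hl2 hx)
          simp [HForest.detach, this]
        exact congrArg some (Subtype.ext (T.2.detach.H_unique hlm m.2 (hl2 hx) (hm2 hx)))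
      refine emb_congr (funext fun k => ?_)
        (funext fun x => Subtype.ext ((hξ x).trans (hζ x).symm)) _
      rcases k with _ | k
      · exact key2 _
      · exact key2 _

theorem IsCompat.mul {f g : FullFam d P} (hf : f.IsCompat) (hg : g.IsCompat) :
    (f * g).IsCompat where
  natural := hf.mul_natural hg
  unit := by
    obtain ⟨a, ha⟩ := hf.unit
    obtain ⟨b, hb⟩ := hg.unit
    refine ⟨a * b, fun T hT => ?_⟩
    apply coords_injective P
    have hc : T.1.cuts = {∅} := by
      ext A
      rw [HForest.mem_cuts, hT, Finset.subset_empty, Finset.mem_singleton]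
      exact ⟨fun h => h.1, fun h => ⟨h, fun x y _ hx => by simp [h] at hx⟩⟩
    have hA : ∅ ∈ T.1.cuts := by simp [hc]
    rw [coords_mul, hc, Finset.sum_singleton, coords_scalar,
      val_scalar a (T.2.of_cut_compl hA) (ha ⟨_, _⟩ (by simp [HForest.restrict, hT])),
      val_scalar b (T.2.of_cut hA) (hb ⟨_, _⟩ (by simp [HForest.restrict])),
      smul_mul_smul_comm, mul_one]
  detach T h := by
    refine (coords_mul f g T.detach).trans ?_
    rw [coords_mul, map_sum]
    -- Cuts see only nodes and edges, which `detach` keeps.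
    have hcuts : T.detach.1.cuts = T.1.cuts := rfl
    rw [hcuts]
    refine Finset.sum_congr rfl fun A hA => ?_
    rw [map_mul, emb_detach_val hg T h (T.2.of_cut hA),
      emb_detach_val hf T h (T.2.of_cut_compl hA)]
    rfl

theorem IsCompat.add {f g : FullFam d P} (hf : f.IsCompat) (hg : g.IsCompat) :
    (f + g).IsCompat where
  natural T T' σ h := by
    apply coords_injective P
    rw [coords_transport, Pi.add_apply, Pi.add_apply, coords_add, coords_add, map_add,
      hf.natural T T' σ h, hg.natural T T' σ h, coords_transport, coords_transport]
  unit := by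
    obtain ⟨a, ha⟩ := hf.unit
    obtain ⟨b, hb⟩ := hg.unit
    refine ⟨a + b, fun T hT => ?_⟩
    apply coords_injective P
    rw [Pi.add_apply, coords_add, ha T hT, hb T hT, coords_scalar, coords_scalar, coords_scalar,
      add_smul]
  detach T h := by
    rw [Pi.add_apply, Pi.add_apply, coords_add, coords_add, map_add,
      hf.detach T h, hg.detach T h]
    rfl

theorem IsCompat.smul {f : FullFam d P} (hf : f.IsCompat) (r : ℝ) : (r • f).IsCompat where
  natural T T' σ h := by
    apply coords_injective P
    rw [coords_transport, Pi.smul_apply, Pi.smul_apply, coords_smul, coords_smul, emb_smul,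
      hf.natural T T' σ h, coords_transport]
  unit := by
    obtain ⟨a, ha⟩ := hf.unit
    refine ⟨r * a, fun T hT => ?_⟩
    apply coords_injective P
    rw [Pi.smul_apply, coords_smul, ha T hT, coords_scalar, coords_scalar, mul_smul]
  detach T h := by
    rw [Pi.smul_apply, Pi.smul_apply, coords_smul, coords_smul, emb_smul,
      hf.detach T h]
    rfl

theorem coords_one (T : LionsForest d) :
    coords P ((1 : FullFam d P) T) = if T.1.N = ∅ then 1 else 0 := by
  refine (coords_scalar P _).trans ?_
  split_ifs <;> simp

theorem isCompat_one : (1 : FullFam d P).IsCompat where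
  natural T T' σ h := by
    apply coords_injective P
    have : T'.1.N = ∅ ↔ T.1.N = ∅ := by
      rw [← map_N_eq h, Finset.map_eq_empty]
    rw [coords_transport, coords_one, coords_one]
    by_cases hN : T.1.N = ∅
    · rw [if_pos hN, if_pos (this.2 hN), map_one]
    · rw [if_neg hN, if_neg (mt this.1 hN), map_zero]
  unit := ⟨1, fun T hT => by
    apply coords_injective P
    rw [coords_one, if_pos hT, coords_scalar, one_smul]⟩
  detach T h := by
    have hN : T.1.N ≠ ∅ := (h.mono T.2.h0_subset).ne_empty
    have hN' : T.detach.1.N ≠ ∅ := hN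
    rw [coords_one, coords_one, if_neg hN, if_neg hN', map_zero]
    rfl

variable (d P) in
/-- The algebra of compatible families. -/
def compatSubalgebra : Subalgebra ℝ (FullFam d P) where
  carrier := {f | f.IsCompat}
  mul_mem' hf hg := hf.mul hg
  add_mem' hf hg := hf.add hg
  algebraMap_mem' r := by
    rw [Algebra.algebraMap_eq_smul_one]
    exact isCompat_one.smul r

end FullFam

end

end Lions

namespace Lions

noncomputable section

open scoped Classical

set_option linter.unusedSectionVars false

/-! ### Characters -/

namespace HForest

variable {d : ℕ}

theorem IsSplit.restrict {T : HForest d} {A : Finset ℕ} (h : T.IsSplit A) (C : Finset ℕ) :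
    (T.restrict C).IsSplit (C ∩ A) where
  subset x hx := by
    rw [Finset.mem_inter] at hx
    exact mem_N_restrict.2 ⟨h.subset hx.2, hx.1⟩
  edges x y hxy := by
    rw [edge_restrict] at hxy
    simp [hxy.2.1, hxy.2.2, h.edges x y hxy.1]
  hyperedges k hk := by
    obtain ⟨-, l, hl, rfl⟩ := mem_H_restrict hk
    rcases h.hyperedges l hl with h1 | h1
    · exact Or.inl fun x hx => by
        rw [Finset.mem_inter] at hx ⊢
        exact ⟨hx.2, h1 hx.1⟩
    · exact Or.inr (h1.mono Finset.inter_subset_left Finset.inter_subset_right)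

theorem IsSplit.mem_cuts {T : HForest d} {A : Finset ℕ} (h : T.IsSplit A) : A ∈ T.cuts :=
  HForest.mem_cuts.2 ⟨h.subset, h.parentClosed⟩

end HForest

variable {d : ℕ} {Ω : Type u} [MeasurableSpace Ω] {P : Measure Ω} [IsProbabilityMeasure P]

namespace FullFam

/-- Multiplicativity with respect to the product of forests. -/
def IsMul (f : FullFam d P) : Prop := ∀ (T : LionsForest d) (A : Finset ℕ), T.1.IsSplit A →
  f.val T.1 T.1.N = f.val T.1 (T.1.N \ A) * f.val T.1 A

/-- Characters, in terms of the algebra of compatible families. -/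
structure IsChar (f : FullFam d P) : Prop where
  compat : f.IsCompat
  unit : ∀ T : LionsForest d, T.1.N = ∅ → f T = scalar P T.1 1
  mul : f.IsMul

/-- A split of `T` induces a split of `T|_C`; multiplicativity there is carried into the algebra of
`T`. -/
theorem IsMul.val_eq {f : FullFam d P} (hf : f.IsMul) {T : HForest d} (hT : T.IsLions)
    {A C : Finset ℕ} (hA : T.IsSplit A) (hC : C ⊆ T.N) (hTC : (T.restrict C).IsLions) :
    f.val T C = f.val T (C \ A) * f.val T (C ∩ A) := by
  have hN : (T.restrict C).N = C := Finset.inter_eq_right.2 hC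
  have h := hf ⟨_, hTC⟩ _ (hA.restrict C)
  have h1 : (T.restrict C).N \ (C ∩ A) = C \ A := by
    rw [hN, Finset.sdiff_inter_self_left]
  have h2 := congrArg (emb P (coupling T C) (coupling_injective T C) (incl T C)) h
  rw [map_mul] at h2
  have e1 := f.val_restrict hT (C := C) (A := (T.restrict C).N) hN.le
  have e2 := f.val_restrict hT (C := C) (A := (T.restrict C).N \ (C ∩ A))
    (h1 ▸ Finset.sdiff_subset)
  have e3 := f.val_restrict hT (C := C) (A := C ∩ A) Finset.inter_subset_left
  have h3 := e1.symm.trans (h2.trans (congrArg₂ (· * ·) e2 e3))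
  rw [h1, hN] at h3
  exact h3

/-- No edge joins the two factors of a split, so a cut `D` is the same as the pair of cuts `D \ A`
and `D ∩ A`. Each summand becomes a product of four values, regrouped by commutativity. -/
theorem IsMul.mul {f g : FullFam d P} (hf : f.IsMul) (hg : g.IsMul) : (f * g).IsMul := by
  intro T A hA
  have hAc := hA.mem_cuts
  have hAN := hA.subset
  rw [val_self, coords_mul, val_mul f g T.2 Finset.sdiff_subset (T.2.of_cut_compl hAc),
    val_mul f g T.2 hAN (T.2.of_cut hAc), Finset.sum_mul_sum, ← Finset.sum_product']
  symm
  refine Finset.sum_bij' (fun x _ => x.1 ∪ x.2) (fun D _ => (D \ A, D ∩ A)) ?_ ?_ ?_ ?_ ?_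
  · rintro ⟨B, B'⟩ hx
    rw [Finset.mem_product, HForest.mem_cuts_restrict Finset.sdiff_subset,
      HForest.mem_cuts_restrict hAN] at hx
    obtain ⟨⟨h1, h2⟩, h3, h4⟩ := hx
    dsimp only at *
    refine HForest.mem_cuts.2 ⟨Finset.union_subset (h1.trans Finset.sdiff_subset) (h3.trans hAN),
      fun x y hxy hx => ?_⟩
    have hyN := (T.2.edge_mem x y hxy).2
    have hiff := hA.edges x y hxy
    rw [Finset.mem_union] at hx ⊢
    rcases hx with hx | hx
    · have hx' := Finset.mem_sdiff.1 (h1 hx)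
      exact Or.inl (h2 x y hxy (h1 hx) (Finset.mem_sdiff.2 ⟨hyN, fun h => hx'.2 (hiff.2 h)⟩) hx)
    · exact Or.inr (h4 x y hxy (h3 hx) (hiff.1 (h3 hx)) hx)
  · intro D hD
    rw [HForest.mem_cuts] at hD
    rw [Finset.mem_product, HForest.mem_cuts_restrict Finset.sdiff_subset,
      HForest.mem_cuts_restrict hAN]
    refine ⟨⟨Finset.sdiff_subset_sdiff hD.1 subset_rfl, fun x y hxy _ hy hx => ?_⟩,
      Finset.inter_subset_right, fun x y hxy _ hy hx => ?_⟩
    · exact Finset.mem_sdiff.2 ⟨hD.2 x y hxy (Finset.mem_sdiff.1 hx).1, (Finset.mem_sdiff.1 hy).2⟩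
    · exact Finset.mem_inter.2 ⟨hD.2 x y hxy (Finset.mem_inter.1 hx).1, hy⟩
  · rintro ⟨B, B'⟩ hx
    rw [Finset.mem_product, HForest.mem_cuts_restrict Finset.sdiff_subset,
      HForest.mem_cuts_restrict hAN] at hx
    have h1 := hx.1.1
    have h3 := hx.2.1
    dsimp only at *
    ext x
    · have := @h1 x; have := @h3 x
      simp only [Finset.mem_sdiff, Finset.mem_union] at *
      tauto
    · have := @h1 x; have := @h3 x
      simp only [Finset.mem_sdiff, Finset.mem_union, Finset.mem_inter] at *
      tauto
  · intro D _
    exact Finset.sdiff_union_inter D A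
  · rintro ⟨B, B'⟩ hx
    rw [Finset.mem_product, HForest.mem_cuts_restrict Finset.sdiff_subset,
      HForest.mem_cuts_restrict hAN] at hx
    have h1 := hx.1.1
    have h3 := hx.2.1
    dsimp only at *
    have hD : B ∪ B' ∈ T.1.cuts := by
      refine HForest.mem_cuts.2 ⟨Finset.union_subset (h1.trans Finset.sdiff_subset) (h3.trans hAN),
        fun x y hxy hx' => ?_⟩
      have hyN := (T.2.edge_mem x y hxy).2
      have hiff := hA.edges x y hxy
      rw [Finset.mem_union] at hx' ⊢
      rcases hx' with hx' | hx'
      · have hx'' := Finset.mem_sdiff.1 (h1 hx')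
        exact Or.inl (hx.1.2 x y hxy (h1 hx')
          (Finset.mem_sdiff.2 ⟨hyN, fun h => hx''.2 (hiff.2 h)⟩) hx')
      · exact Or.inr (hx.2.2 x y hxy (h3 hx') (hiff.1 (h3 hx')) hx')
    rw [hf.val_eq T.2 hA Finset.sdiff_subset (T.2.of_cut_compl hD),
      hg.val_eq T.2 hA (HForest.mem_cuts.1 hD).1 (T.2.of_cut hD)]
    have e1 : (B ∪ B') \ A = B := by
      ext x
      have := @h1 x; have := @h3 x
      simp only [Finset.mem_sdiff, Finset.mem_union] at *
      tauto
    have e2 : (B ∪ B') ∩ A = B' := by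
      ext x
      have := @h1 x; have := @h3 x
      simp only [Finset.mem_sdiff, Finset.mem_union, Finset.mem_inter] at *
      tauto
    have e3 : (T.1.N \ (B ∪ B')) \ A = (T.1.N \ A) \ B := by
      ext x
      have := @h3 x
      simp only [Finset.mem_sdiff, Finset.mem_union] at *
      tauto
    have e4 : (T.1.N \ (B ∪ B')) ∩ A = A \ B' := by
      ext x
      have := @h1 x; have := @hAN x
      simp only [Finset.mem_sdiff, Finset.mem_union, Finset.mem_inter] at *
      tauto
    rw [e1, e2, e3, e4]
    ring

theorem isMul_one : (1 : FullFam d P).IsMul := by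
  intro T A hA
  have hAc := hA.mem_cuts
  rw [val_one subset_rfl (by rw [HForest.restrict_self T.2]; exact T.2),
    val_one Finset.sdiff_subset (T.2.of_cut_compl hAc), val_one hA.subset (T.2.of_cut hAc)]
  have : T.1.N = ∅ ↔ T.1.N \ A = ∅ ∧ A = ∅ := by
    rw [Finset.sdiff_eq_empty_iff_subset]
    constructor
    · intro h
      have := hA.subset
      rw [h, Finset.subset_empty] at this
      simp [h, this]
    · rintro ⟨h, rfl⟩
      exact Finset.subset_empty.1 h
  rw [if_congr this rfl rfl]
  by_cases h1 : T.1.N \ A = ∅ <;> by_cases h2 : A = ∅ <;> simp only [h1, h2] <;> simp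

theorem one_apply (T : LionsForest d) (hT : T.1.N = ∅) : (1 : FullFam d P) T = scalar P T.1 1 := by
  change scalar P T.1 _ = _
  rw [if_pos hT]

theorem isChar_one : (1 : FullFam d P).IsChar := ⟨isCompat_one, one_apply, isMul_one⟩

theorem mul_apply_empty {f g : FullFam d P} {a b : ℝ}
    (hf : ∀ T : LionsForest d, T.1.N = ∅ → f T = scalar P T.1 a)
    (hg : ∀ T : LionsForest d, T.1.N = ∅ → g T = scalar P T.1 b) (T : LionsForest d)
    (hT : T.1.N = ∅) : (f * g) T = scalar P T.1 (a * b) := by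
  apply coords_injective P
  have hc : T.1.cuts = {∅} := by
    ext A
    rw [HForest.mem_cuts, hT, Finset.subset_empty, Finset.mem_singleton]
    exact ⟨fun h => h.1, fun h => ⟨h, fun x y _ hx => by simp [h] at hx⟩⟩
  have hA : ∅ ∈ T.1.cuts := by simp [hc]
  rw [coords_mul, hc, Finset.sum_singleton, coords_scalar,
    val_scalar a (T.2.of_cut_compl hA) (hf ⟨_, _⟩ (by simp [HForest.restrict, hT])),
    val_scalar b (T.2.of_cut hA) (hg ⟨_, _⟩ (by simp [HForest.restrict])),
    smul_mul_smul_comm, mul_one]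

theorem IsChar.conv {f g : FullFam d P} (hf : f.IsChar) (hg : g.IsChar) : (f * g).IsChar where
  compat := hf.compat.mul hg.compat
  unit T hT := by rw [mul_apply_empty hf.unit hg.unit T hT, mul_one]
  mul := hf.mul.mul hg.mul

theorem IsChar.pow {f : FullFam d P} (hf : f.IsChar) (n : ℕ) : (f ^ n).IsChar := by
  induction n with
  | zero => rw [pow_zero]; exact isChar_one
  | succ n ih => rw [pow_succ]; exact ih.conv hf

theorem isMVChar_iff (f : FullFam d P) : IsMVChar P f ↔ f.IsChar := by
  have hmul : ∀ (T : LionsForest d) (A : Finset ℕ) (h : T.1.IsSplit A),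
      f T = couple P T.1 (T.1.N \ A) A (f (T.prune A h.parentClosed)) (f (T.root A h.parentClosed))
      ↔ f.val T.1 T.1.N = f.val T.1 (T.1.N \ A) * f.val T.1 A := by
    intro T A h
    rw [val_self]
    have : coords P (couple P T.1 (T.1.N \ A) A (f (T.prune A h.parentClosed))
        (f (T.root A h.parentClosed))) = f.val T.1 (T.1.N \ A) * f.val T.1 A := by
      refine (coords_couple P _ _ _ _).trans ?_
      rw [← FullFam.raw_eq f, ← FullFam.raw_eq f]
      rfl
    rw [← this]
    exact (coords_injective P).eq_iff.symm
  have hdet : ∀ (T : LionsForest d) (h : T.1.h0.Nonempty),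
      f T.detach = pull P (detachIdx T h) (detachIdx_injective T h) (f T) ↔
      coords P (f T.detach) =
        emb P (detachIdx T h) (detachIdx_injective T h) id (coords P (f T)) := fun T h =>
    (coords_injective (T := T.detach.1) P).eq_iff.symm.trans
      (Eq.congr_right (coords_detach P T h (f T)))
  constructor
  · intro h
    exact ⟨⟨h.natural, ⟨1, h.unit⟩, fun T h0 => (hdet T h0).1 (h.detach T h0)⟩, h.unit,
      fun T A hA => (hmul T A hA).1 (h.mul T A hA)⟩
  · intro h
    exact ⟨h.compat.natural, h.unit, fun T A hA => (hmul T A hA).2 (h.mul T A hA),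
      fun T h0 => (hdet T h0).2 (h.compat.detach T h0)⟩

theorem IsChar.sub_one_apply {f : FullFam d P} (hf : f.IsChar) (T : LionsForest d)
    (hT : T.1.N = ∅) : (f - 1) T = 0 := by
  rw [Pi.sub_apply, hf.unit T hT, one_apply T hT, sub_self]

theorem val_pow_eq_zero {f : FullFam d P} (hf : ∀ T, T.1.N = ∅ → f T = 0) {k : ℕ} {T : HForest d}
    (hk : T.N.card < k) (A : Finset ℕ) : (f ^ k).val T A = 0 :=
  val_eq_zero fun _ => pow_eq_zero_of_card hf k _ ((card_restrict_le T A).trans_lt hk)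

/-- The binomial theorem for `f = 1 + (f - 1)`. The range of summation is independent of `m`, so the
right side is a polynomial in `m`. -/
theorem IsChar.val_pow {f : FullFam d P} (hf : f.IsChar) {n : ℕ} {T : HForest d}
    (hn : T.N.card ≤ n) (A : Finset ℕ) (m : ℕ) : (f ^ m).val T A =
      ∑ k ∈ Finset.range (n + 1), (m.choose k : ℝ) • ((f - 1) ^ k).val T A := by
  have h1 : f ^ m = ∑ k ∈ Finset.range (m + 1), (m.choose k : ℝ) • (f - 1) ^ k := by
    conv_lhs => rw [← sub_add_cancel f 1, (Commute.one_right (f - 1)).add_pow]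
    refine Finset.sum_congr rfl fun k _ => ?_
    rw [one_pow, mul_one, Nat.cast_smul_eq_nsmul, nsmul_eq_mul, Nat.cast_comm]
  rw [h1, val_sum]
  simp_rw [val_smul]
  have h2 : ∀ k, n < k → ((f - 1) ^ k).val T A = 0 := fun k hk =>
    val_pow_eq_zero hf.sub_one_apply (by omega) A
  -- Both sums are extended to a common range: terms with `k > m` vanish by the binomial
  -- coefficient, terms with `k > n` by the number of nodes.
  rw [Finset.sum_subset (Finset.range_mono (by omega : m + 1 ≤ m + n + 1)) fun k _ hk => ?_,
    Finset.sum_subset (Finset.range_mono (by omega : n + 1 ≤ m + n + 1)) fun k _ hk => ?_]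
  · rw [h2 k (by simpa using hk), smul_zero]
  · rw [Nat.choose_eq_zero_of_lt (by simpa using hk), Nat.cast_zero, zero_smul]

/-- The convolution inverse. -/
def antipode (f : FullFam d P) : FullFam d P := fun T =>
  ∑ i ∈ Finset.range (T.1.N.card + 1), ((1 - f) ^ i) T

/-- The convolution logarithm. -/
def log (f : FullFam d P) : FullFam d P := fun T =>
  ∑ n ∈ Finset.Icc 1 T.1.N.card, ((-1 : ℝ) ^ (n + 1) / n) • ((f - 1) ^ n) T

/-- The convolution exponential. -/
def exp (f : FullFam d P) : FullFam d P := fun T =>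
  ∑ n ∈ Finset.range (T.1.N.card + 1), (1 / (n.factorial : ℝ)) • (f ^ n) T

/-- On all forests with at most `n` nodes the series equals one fixed polynomial in `f`, so
identities of the ring apply. -/
theorem antipode_apply {f : FullFam d P} (hf : ∀ T, T.1.N = ∅ → (f - 1) T = 0) {n : ℕ}
    (T : LionsForest d) (hn : T.1.N.card ≤ n) :
    f.antipode T = (∑ i ∈ Finset.range (n + 1), (1 - f) ^ i) T := by
  rw [antipode, Finset.sum_apply]
  refine Finset.sum_subset (Finset.range_mono (by omega)) fun k _ hk => ?_
  refine pow_eq_zero_of_card (fun T hT => ?_) k T (by simpa using hk)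
  rw [← neg_sub, Pi.neg_apply, hf T hT, neg_zero]

theorem log_apply {f : FullFam d P} (hf : ∀ T, T.1.N = ∅ → (f - 1) T = 0) {n : ℕ}
    (T : LionsForest d) (hn : T.1.N.card ≤ n) :
    f.log T = (∑ k ∈ Finset.Icc 1 n, ((-1 : ℝ) ^ (k + 1) / k) • (f - 1) ^ k) T := by
  rw [log, Finset.sum_apply]
  refine Finset.sum_subset (Finset.Icc_subset_Icc_right hn) fun k hk hk' => ?_
  rw [Finset.mem_Icc] at hk hk'
  rw [pow_eq_zero_of_card hf k T (by omega)]
  exact smul_zero (M := ℝ) (A := L0 P T.1) _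

theorem exp_apply {f : FullFam d P} (hf : ∀ T, T.1.N = ∅ → f T = 0) {n : ℕ}
    (T : LionsForest d) (hn : T.1.N.card ≤ n) :
    f.exp T = (∑ k ∈ Finset.range (n + 1), (1 / (k.factorial : ℝ)) • f ^ k) T := by
  rw [exp, Finset.sum_apply]
  refine Finset.sum_subset (Finset.range_mono (by omega)) fun k _ hk => ?_
  rw [pow_eq_zero_of_card hf k T (by simpa using hk)]
  exact smul_zero (M := ℝ) (A := L0 P T.1) _

end FullFam

end

end Lions

namespace Lions

noncomputable section

open scoped Classical

set_option linter.unusedSectionVars false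

/-! ### Forests that are not trees -/

namespace HForest

variable {d : ℕ} {T : HForest d}

open Relation

theorem IsLions.eq_of_reach_root (hT : T.IsLions) {r s : ℕ} (hr : T.depth r = 0)
    (h : ReflTransGen T.Edge r s) : r = s := by
  rcases h.cases_head with h | ⟨z, hz, -⟩
  · exact h
  · have := hT.depth_succ hz
    omega

theorem IsLions.root_unique (hT : T.IsLions) {x r s : ℕ} (hr : T.depth r = 0)
    (hs : T.depth s = 0) (h : ReflTransGen T.Edge x r) (h' : ReflTransGen T.Edge x s) : r = s := by
  rcases ReflTransGen.total_of_right_unique (fun a b c => hT.parent_unique a b c) h h' with h1 | h1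
  · exact hT.eq_of_reach_root hr h1
  · exact (hT.eq_of_reach_root hs h1).symm

theorem IsLions.exists_reach_root (hT : T.IsLions) {x : ℕ} (hx : x ∈ T.N) :
    ∃ r ∈ T.N, T.depth r = 0 ∧ ReflTransGen T.Edge x r := by
  induction hn : T.depth x generalizing x with
  | zero => exact ⟨x, hx, hn, .refl⟩
  | succ n ih =>
    obtain ⟨p, hp⟩ := exists_parent (T := T) (x := x) (by omega)
    have := hT.depth_succ hp
    obtain ⟨r, hr, h0, h⟩ := ih (hT.edge_mem _ _ hp).2 (by omega)
    exact ⟨r, hr, h0, .head hp h⟩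

theorem IsLions.reach_of_edge (hT : T.IsLions) {x p r : ℕ} (hp : T.Edge x p) (hr : T.depth r = 0)
    (h : ReflTransGen T.Edge x r) : ReflTransGen T.Edge p r := by
  rcases h.cases_head with rfl | ⟨z, hz, hzr⟩
  · have := hT.depth_succ hp
    omega
  · rwa [hT.parent_unique _ _ _ hp hz]

/-- A hyperedge that meets two components contains their roots. -/
theorem IsLions.roots_mem (hT : T.IsLions) {h : Finset ℕ} (hh : h ∈ insert T.h0 T.H) {r s : ℕ}
    (hr : T.depth r = 0) (hs : T.depth s = 0) (hne : r ≠ s) {x y : ℕ} (hx : x ∈ h) (hy : y ∈ h)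
    (hxr : ReflTransGen T.Edge x r) (hys : ReflTransGen T.Edge y s) : r ∈ h ∧ s ∈ h := by
  -- The deeper node, or both nodes if they are equally deep, can be replaced by the parent without
  -- leaving `h`: by condition (ii), respectively (iii), the parents being distinct as they lie in
  -- different components.
  induction hn : T.depth x + T.depth y using Nat.strong_induction_on generalizing x y with
  | _ n ih =>
    rcases lt_trichotomy (T.depth x) (T.depth y) with hlt | heq | hlt
    · obtain ⟨z, hz, he⟩ := hT.chain h hh x hx y hy hlt
      have := hT.depth_succ he
      exact ih _ (by omega) hx hz hxr (hT.reach_of_edge he hs hys) rfl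
    · by_cases h0 : T.depth x = 0
      · rw [← hT.eq_of_reach_root h0 hxr, ← hT.eq_of_reach_root (heq ▸ h0) hys]
        exact ⟨hx, hy⟩
      · obtain ⟨p, hp⟩ := exists_parent h0
        obtain ⟨p', hp'⟩ := exists_parent (heq ▸ h0)
        have e1 := hT.depth_succ hp
        have e2 := hT.depth_succ hp'
        have h1 := hT.reach_of_edge hp hr hxr
        have h2 := hT.reach_of_edge hp' hs hys
        have hpp : p ≠ p' := by
          rintro rfl
          exact hne (hT.root_unique hr hs h1 h2)
        obtain ⟨a, b⟩ := hT.sibling h hh x hx y hy heq p p' hp hp' hpp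
        exact ih _ (by omega) a b h1 h2 rfl
    · obtain ⟨z, hz, he⟩ := hT.chain h hh y hy x hx hlt
      have := hT.depth_succ he
      exact ih _ (by omega) hz hy (hT.reach_of_edge he hr hxr) hys rfl

/-- `A` is the union of the components whose root is `r` or shares an ordinary hyperedge with `r`.
An ordinary hyperedge meeting two components contains both roots by `roots_mem`; since ordinary
hyperedges are disjoint, none can leave `A`. -/
theorem IsLions.exists_split (hT : T.IsLions) {r s : ℕ} (hrN : r ∈ T.N) (hr : T.depth r = 0)
    (hs : T.depth s = 0) (hne : r ≠ s) (hrs : ¬ ∃ h ∈ T.H, r ∈ h ∧ s ∈ h) :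
    ∃ A, T.IsSplit A ∧ r ∈ A ∧ s ∉ A := by
  set R : ℕ → Prop := fun t => t = r ∨ ∃ h ∈ T.H, r ∈ h ∧ t ∈ h with hR
  have hmem : ∀ x, x ∈ T.N.filter (fun x => ∃ t, R t ∧ T.depth t = 0 ∧ ReflTransGen T.Edge x t) ↔
      x ∈ T.N ∧ ∃ t, R t ∧ T.depth t = 0 ∧ ReflTransGen T.Edge x t := fun x => Finset.mem_filter
  refine ⟨_, ⟨Finset.filter_subset _ _, fun x y hxy => ?_, fun h hh => ?_⟩,
    (hmem r).2 ⟨hrN, r, Or.inl rfl, hr, .refl⟩, fun hsA => ?_⟩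
  · rw [hmem, hmem]
    have hN := hT.edge_mem x y hxy
    constructor
    · rintro ⟨-, t, h1, h2, h3⟩
      exact ⟨hN.2, t, h1, h2, hT.reach_of_edge hxy h2 h3⟩
    · rintro ⟨-, t, h1, h2, h3⟩
      exact ⟨hN.1, t, h1, h2, .head hxy h3⟩
  · by_cases hdis : Disjoint h (T.N.filter fun x =>
      ∃ t, R t ∧ T.depth t = 0 ∧ ReflTransGen T.Edge x t)
    · exact Or.inr hdis
    · left
      obtain ⟨x, hxh, hxA⟩ := Finset.not_disjoint_iff.1 hdis
      obtain ⟨hxN, t, ht, ht0, hxt⟩ := (hmem x).1 hxA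
      intro y hyh
      have hyN := (Finset.mem_sdiff.1 (hT.H_subset h hh hyh)).1
      obtain ⟨v, hvN, hv0, hyv⟩ := hT.exists_reach_root hyN
      refine (hmem y).2 ⟨hyN, v, ?_, hv0, hyv⟩
      by_cases htv : t = v
      · exact htv ▸ ht
      · obtain ⟨h1, h2⟩ := hT.roots_mem (Finset.mem_insert_of_mem hh) ht0 hv0 htv hxh hyh hxt hyv
        rcases ht with rfl | ⟨k, hk, hrk, htk⟩
        · exact Or.inr ⟨h, hh, h1, h2⟩
        · have hkh : k = h := by
            by_contra hkh
            exact Finset.disjoint_left.1 (hT.H_disjoint k hk h hh hkh) htk h1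
          exact Or.inr ⟨h, hh, hkh ▸ hrk, h2⟩
  · obtain ⟨-, t, ht, -, hst⟩ := (hmem s).1 hsA
    obtain rfl := hT.eq_of_reach_root hs hst
    rcases ht with h | h
    · exact hne h.symm
    · exact hrs h

theorem IsLions.exists_two_roots (hT : T.IsLions) (hN : T.N.Nonempty) (h : ¬ T.IsTree) :
    ∃ r ∈ T.N, ∃ s ∈ T.N, T.depth r = 0 ∧ T.depth s = 0 ∧ r ≠ s := by
  obtain ⟨r, hr, hr0⟩ := hT.exists_root hN
  by_contra hcon
  push Not at hcon
  refine h ⟨r, ⟨hr, fun y hy => ?_⟩, fun z hz => ?_⟩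
  · obtain ⟨s, hs, hs0, hys⟩ := hT.exists_reach_root hy
    exact hcon r hr s hs hr0 hs0 ▸ hys
  · exact (hT.eq_of_reach_root hr0 (hz.2 r hr)).symm

end HForest

/-- A forest that is not a tree is a nontrivial product, or it is obtained by `detach` from a
nontrivial product. -/
theorem LionsForest.exists_split_or_detach {d : ℕ} (T : LionsForest d) (hN : T.1.N.Nonempty)
    (h : ¬ T.1.IsTree) :
    (∃ A, T.1.IsSplit A ∧ A.Nonempty ∧ (T.1.N \ A).Nonempty) ∨
    ∃ S : LionsForest d, S.1.h0.Nonempty ∧ S.detach = T ∧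
      ∃ A, S.1.IsSplit A ∧ A.Nonempty ∧ (S.1.N \ A).Nonempty := by
  obtain ⟨r, hr, s, hs, hr0, hs0, hne⟩ := T.2.exists_two_roots hN h
  by_cases hrs : ∃ h ∈ T.1.H, r ∈ h ∧ s ∈ h
  · obtain ⟨k, hk, hrk, hsk⟩ := hrs
    rcases T.1.h0.eq_empty_or_nonempty with h0 | h0
    -- The hyperedge through both roots is made the distinguished one; it then no longer obstructs a
    -- split.
    · right
      have hS := T.2.attach h0 hk hrk hr0
      refine ⟨⟨_, hS⟩, ⟨r, hrk⟩, Subtype.ext (T.2.detach_attach h0 hk), ?_⟩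
      obtain ⟨A, hA, h1, h2⟩ := hS.exists_split (r := r) (s := s) hr hr0 hs0 hne (by
        rintro ⟨l, hl, hrl, -⟩
        obtain ⟨hlk, hl⟩ := Finset.mem_erase.1 hl
        exact Finset.disjoint_left.1 (T.2.H_disjoint l hl k hk hlk) hrl hrk)
      exact ⟨A, hA, ⟨r, h1⟩, ⟨s, Finset.mem_sdiff.2 ⟨hs, h2⟩⟩⟩
    · left
      -- Here the distinguished place is taken, but a nonempty `h0` contains a root `x`, which lies
      -- in no ordinary hyperedge and can be separated from `r`.
      obtain ⟨x, hx, hmin⟩ := T.2.h0_root h0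
      have hx0 : T.1.depth x = 0 := by
        have := hmin r hr
        omega
      have hxH : ∀ l ∈ T.1.H, x ∉ l := fun l hl hxl =>
        (Finset.mem_sdiff.1 (T.2.H_subset l hl hxl)).2 hx
      obtain ⟨A, hA, h1, h2⟩ := T.2.exists_split (r := x) (s := r) (T.2.h0_subset hx) hx0 hr0
        (by rintro rfl; exact hxH k hk hrk) (by
          rintro ⟨l, hl, hxl, -⟩
          exact hxH l hl hxl)
      exact ⟨A, hA, ⟨x, h1⟩, ⟨r, Finset.mem_sdiff.2 ⟨hr, h2⟩⟩⟩
  · left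
    obtain ⟨A, hA, h1, h2⟩ := T.2.exists_split hr hr0 hs0 hne hrs
    exact ⟨A, hA, ⟨r, h1⟩, ⟨s, Finset.mem_sdiff.2 ⟨hs, h2⟩⟩⟩

/-! ### Inverse, logarithm and exponential of characters -/

variable {d : ℕ} {Ω : Type u} [MeasurableSpace Ω] {P : Measure Ω} [IsProbabilityMeasure P]

namespace FullFam

/-- Each condition compares forests with equally many nodes, so compatibility of a series follows
from that of its truncations, which lie in `compatSubalgebra`. -/
theorem IsCompat.of_local {f : FullFam d P}
    (h : ∀ n, ∃ g : FullFam d P, g.IsCompat ∧ ∀ T, T.1.N.card ≤ n → f T = g T) : f.IsCompat where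
  natural T T' σ hσ := by
    obtain ⟨g, hg, hfg⟩ := h T.1.N.card
    rw [hfg T le_rfl, hfg T' (by rw [← map_N_eq hσ, Finset.card_map]), hg.natural T T' σ hσ]
  unit := by
    obtain ⟨g, hg, hfg⟩ := h 0
    obtain ⟨c, hc⟩ := hg.unit
    exact ⟨c, fun T hT => (hfg T (by rw [hT, Finset.card_empty])).trans (hc T hT)⟩
  detach T h0 := by
    obtain ⟨g, hg, hfg⟩ := h T.1.N.card
    rw [hfg T le_rfl, hfg T.detach le_rfl]
    exact hg.detach T h0

theorem val_congr_card {f g : FullFam d P} {n : ℕ} (h : ∀ T, T.1.N.card ≤ n → f T = g T)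
    {T : HForest d} (hT : T.N.card ≤ n) (A : Finset ℕ) : f.val T A = g.val T A :=
  val_congr fun _ => h _ ((card_restrict_le T A).trans hT)

theorem IsChar.mem_compat {f : FullFam d P} (hf : f.IsChar) : f ∈ compatSubalgebra d P := hf.compat

theorem IsChar.val_antipode {f : FullFam d P} (hf : f.IsChar) (T : HForest d) (A : Finset ℕ) :
    f.antipode.val T A =
      ∑ k ∈ Finset.range (T.N.card + 1), (-1 : ℝ) ^ k • ((f - 1) ^ k).val T A := by
  rw [val_congr_card (fun T hT => antipode_apply hf.sub_one_apply T hT) le_rfl, val_sum]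
  refine Finset.sum_congr rfl fun k _ => ?_
  rw [← val_smul]
  congr 1
  rw [← neg_sub f 1, neg_pow]
  rcases Nat.even_or_odd k with hk | hk
  · rw [hk.neg_one_pow, hk.neg_one_pow, one_mul, one_smul]
  · rw [hk.neg_one_pow, hk.neg_one_pow, neg_mul, one_mul, neg_smul, one_smul]

theorem IsChar.val_log {f : FullFam d P} (hf : f.IsChar) (T : HForest d) (A : Finset ℕ) :
    f.log.val T A =
      ∑ k ∈ Finset.Icc 1 T.N.card, ((-1 : ℝ) ^ (k + 1) / k) • ((f - 1) ^ k).val T A := by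
  rw [val_congr_card (fun T hT => log_apply hf.sub_one_apply T hT) le_rfl, val_sum]
  exact Finset.sum_congr rfl fun k _ => val_smul _ _ _ _

theorem IsChar.binomial {f : FullFam d P} (hf : f.IsChar) (T : LionsForest d) {A : Finset ℕ}
    (hA : T.1.IsSplit A) (m : ℕ) :
    ∑ k ∈ Finset.range (T.1.N.card + 1), (m.choose k : ℝ) • ((f - 1) ^ k).val T.1 T.1.N =
      (∑ k ∈ Finset.range (T.1.N.card + 1),
        (m.choose k : ℝ) • ((f - 1) ^ k).val T.1 (T.1.N \ A)) *
      ∑ k ∈ Finset.range (T.1.N.card + 1), (m.choose k : ℝ) • ((f - 1) ^ k).val T.1 A := by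
  rw [← hf.val_pow le_rfl, ← hf.val_pow le_rfl, ← hf.val_pow le_rfl]
  exact (hf.pow m).mul T A hA

/-- The multiplicativity of `f ^ m`, continued from natural `m` to `m = -1`. -/
theorem IsChar.isMul_antipode {f : FullFam d P} (hf : f.IsChar) : f.antipode.IsMul := by
  intro T A hA
  rw [hf.val_antipode, hf.val_antipode, hf.val_antipode]
  exact (binomial_transform_mul _ _ _ _ (hf.binomial T hA)).1

/-- The derivative at `m = 0` of the multiplicativity of `f ^ m`. At `m = 0` both factors are values
of the unit on nonempty forests and vanish, so the product rule gives zero. -/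
theorem IsChar.log_eq_zero_of_split {f : FullFam d P} (hf : f.IsChar) (T : LionsForest d)
    {A : Finset ℕ} (hA : T.1.IsSplit A) (h1 : A.Nonempty) (h2 : (T.1.N \ A).Nonempty) :
    f.log T = 0 := by
  apply coords_injective P
  rw [← val_self, hf.val_log, coords_zero]
  refine (binomial_transform_mul _ _ _ _ (hf.binomial T hA)).2 ?_ ?_
  · rw [pow_zero, val_one Finset.sdiff_subset (T.2.of_cut_compl hA.mem_cuts), if_neg h2.ne_empty]
  · rw [pow_zero, val_one hA.subset (T.2.of_cut hA.mem_cuts), if_neg h1.ne_empty]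

theorem IsChar.antipode {f : FullFam d P} (hf : f.IsChar) : f.antipode.IsChar where
  compat := IsCompat.of_local fun _ => ⟨_, sum_mem (S := compatSubalgebra d P) fun k _ =>
    pow_mem (sub_mem (one_mem _) hf.mem_compat) k,
    fun T hT => antipode_apply hf.sub_one_apply T hT⟩
  unit T hT := by
    rw [FullFam.antipode, Finset.card_eq_zero.2 hT, Finset.sum_range_one, pow_zero]
    exact one_apply T hT
  mul := hf.isMul_antipode

theorem IsChar.isCompat_log {f : FullFam d P} (hf : f.IsChar) : f.log.IsCompat :=
  IsCompat.of_local fun _ => ⟨_, sum_mem (S := compatSubalgebra d P) fun k _ =>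
    Subalgebra.smul_mem _ (pow_mem (sub_mem hf.mem_compat (one_mem _)) k) _,
    fun T hT => log_apply hf.sub_one_apply T hT⟩

theorem log_empty (f : FullFam d P) (T : LionsForest d) (hT : T.1.N = ∅) : f.log T = 0 := by
  rw [FullFam.log, Finset.card_eq_zero.2 hT]
  rfl

/-- The logarithm of a character is supported on trees. -/
theorem IsChar.log_eq_zero {f : FullFam d P} (hf : f.IsChar) (T : LionsForest d)
    (hT : ¬ T.1.IsTree) : f.log T = 0 := by
  rcases T.1.N.eq_empty_or_nonempty with hN | hN
  · exact log_empty f T hN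
  rcases T.exists_split_or_detach hN hT with ⟨A, hA, h1, h2⟩ | ⟨S, h0, rfl, A, hA, h1, h2⟩
  · exact hf.log_eq_zero_of_split T hA h1 h2
  · apply coords_injective P
    refine (hf.isCompat_log.detach S h0).trans ?_
    rw [hf.log_eq_zero_of_split S hA h1 h2, coords_zero, map_zero]
    rfl

/-- A geometric sum, whose remainder `(1 - f) ^ (n + 1)` vanishes on forests with `n` nodes. -/
theorem IsChar.antipode_mul {f : FullFam d P} (hf : f.IsChar) : f.antipode * f = 1 := by
  funext T
  rw [mul_congr T.1.N.card (fun S hS => antipode_apply hf.sub_one_apply S hS) (fun S _ => rfl) T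
    le_rfl]
  have h : (∑ i ∈ Finset.range (T.1.N.card + 1), (1 - f) ^ i) * f =
      1 - (1 - f) ^ (T.1.N.card + 1) := by
    conv_lhs => rw [← sub_sub_cancel 1 f]
    rw [sub_sub_cancel, geom_sum_mul_neg]
  rw [h, Pi.sub_apply, pow_eq_zero_of_card (f := 1 - f) (fun S hS => ?_) _ T (by omega)]
  · exact sub_zero _
  · rw [← neg_sub, Pi.neg_apply, hf.sub_one_apply S hS]
    exact neg_zero

/-- Inserting `f - 1` for `X` in `expPoly_comp_logPoly` leaves `f` plus a multiple of `(f - 1) ^ (n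
+ 1)`, which vanishes on forests with `n` nodes. -/
theorem IsChar.exp_log {f : FullFam d P} (hf : f.IsChar) : f.log.exp = f := by
  funext T
  set n := T.1.N.card with hn
  set L := Polynomial.aeval (f - 1) (logPoly n) with hL
  have hlog : ∀ S : LionsForest d, S.1.N.card ≤ n → f.log S = L S := by
    intro S hS
    rw [log_apply hf.sub_one_apply S hS, hL, logPoly, map_sum]
    refine congrFun (Finset.sum_congr rfl fun k _ => ?_) S
    rw [map_mul, Polynomial.aeval_C, map_pow, Polynomial.aeval_X, Algebra.smul_def]
  have h1 : f.log.exp T = (∑ k ∈ Finset.range (n + 1), (1 / (k.factorial : ℝ)) • L ^ k) T := by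
    rw [exp_apply (log_empty f) T hn.ge, Finset.sum_apply, Finset.sum_apply]
    refine Finset.sum_congr rfl fun k _ => ?_
    rw [Pi.smul_apply, Pi.smul_apply, pow_congr n hlog k T hn.ge]
  have h2 : ∑ k ∈ Finset.range (n + 1), (1 / (k.factorial : ℝ)) • L ^ k =
      Polynomial.aeval (f - 1) ((expPoly n).comp (logPoly n)) := by
    rw [Polynomial.aeval_comp, expPoly, map_sum]
    refine Finset.sum_congr rfl fun k _ => ?_
    rw [map_mul, Polynomial.aeval_C, map_pow, Polynomial.aeval_X, Algebra.smul_def]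
  obtain ⟨p, hp⟩ := expPoly_comp_logPoly n
  rw [sub_eq_iff_eq_add] at hp
  rw [h1, h2, hp]
  simp only [map_add, map_mul, map_pow, Polynomial.aeval_X, map_one]
  rw [add_sub_cancel, Pi.add_apply,
    mul_eq_zero_of_card (k := n + 1) (l := 0) (fun S hS => pow_eq_zero_of_card
      hf.sub_one_apply _ S hS) (fun S hS => absurd hS (by omega)) T (by omega)]
  exact zero_add _

/-! ### The grading -/

theorem val_scale (t : ℝ) (f : FullFam d P) {T : HForest d} {A : Finset ℕ} (hA : A ⊆ T.N) :
    val (fun T => t ^ T.1.N.card • f T : FullFam d P) T A = t ^ A.card • f.val T A := by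
  have hN : (T.restrict A).N = A := Finset.inter_eq_right.2 hA
  by_cases hL : (T.restrict A).IsLions
  · rw [val, raw_eq _ ⟨_, hL⟩, val, raw_eq _ ⟨_, hL⟩, ← emb_smul, ← coords_smul]
    have hc : (T.restrict A).N.card = A.card := by rw [hN]
    rw [← hc]
  · rw [val_eq_zero fun h => absurd h hL, val_eq_zero fun h => absurd h hL, smul_zero]

variable (d P) in
/-- Multiplication by `t ^ k` on the forests with `k` nodes. -/
def scale (t : ℝ) : FullFam d P →+* FullFam d P where
  toFun f := fun T => t ^ T.1.N.card • f T
  map_zero' := funext fun T => smul_zero (M := ℝ) (A := L0 P T.1) _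
  map_add' f g := funext fun T => smul_add (M := ℝ) (A := L0 P T.1) _ _ _
  map_one' := by
    refine ext_coords fun T => ?_
    rw [coords_smul, coords_one]
    split_ifs with h
    · rw [h, Finset.card_empty, pow_zero, one_smul]
    · rw [smul_zero]
  map_mul' f g := by
    refine ext_coords fun T => ?_
    rw [coords_smul, coords_mul, coords_mul, Finset.smul_sum]
    refine Finset.sum_congr rfl fun A hA => ?_
    have hA' := (HForest.mem_cuts.1 hA).1
    rw [val_scale t f Finset.sdiff_subset, val_scale t g hA', smul_mul_smul_comm, ← pow_add,
      Finset.card_sdiff_add_card_eq_card hA']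

theorem scale_apply (t : ℝ) (f : FullFam d P) (T : LionsForest d) :
    scale d P t f T = t ^ T.1.N.card • f T := rfl

theorem IsChar.scale {f : FullFam d P} (hf : f.IsChar) (t : ℝ) : (scale d P t f).IsChar where
  compat :=
    { natural := fun T T' σ h => by
        apply coords_injective P
        rw [scale_apply, scale_apply, hf.compat.natural T T' σ h, coords_transport, coords_smul,
          coords_smul, coords_transport, emb_smul,
          show T'.1.N.card = T.1.N.card by rw [← map_N_eq h, Finset.card_map]]
      unit := ⟨1, fun T hT => by
        rw [scale_apply, hf.unit T hT, Finset.card_eq_zero.2 hT, pow_zero]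
        exact one_smul ℝ (scalar P T.1 1)⟩
      detach := fun T h => by
        rw [scale_apply, scale_apply, coords_smul, coords_smul, hf.compat.detach T h, emb_smul]
        rfl }
  unit T hT := by
    rw [scale_apply, hf.unit T hT, Finset.card_eq_zero.2 hT, pow_zero]
    exact one_smul ℝ (scalar P T.1 1)
  mul T A hA := by
    refine (val_scale t f subset_rfl).trans ?_
    refine Eq.trans ?_ (congrArg₂ (· * ·) (val_scale t f Finset.sdiff_subset).symm
      (val_scale t f hA.subset).symm)
    rw [hf.mul T A hA, smul_mul_smul_comm, ← pow_add,
      Finset.card_sdiff_add_card_eq_card hA.subset]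

theorem exp_scale (t : ℝ) (f : FullFam d P) : (scale d P t f).exp = scale d P t f.exp := by
  funext T
  rw [scale_apply, exp, exp, Finset.smul_sum]
  refine Finset.sum_congr rfl fun k _ => ?_
  rw [← map_pow, scale_apply]
  exact smul_comm _ _ _

theorem antipode_scale (t : ℝ) (f : FullFam d P) :
    (scale d P t f).antipode = scale d P t f.antipode := by
  funext T
  rw [scale_apply, antipode, antipode, Finset.smul_sum]
  refine Finset.sum_congr rfl fun k _ => ?_
  rw [← scale_apply, map_pow, map_sub, map_one]

end FullFam

end

end Lions

namespace Lions

noncomputable section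

open scoped Classical

set_option linter.unusedSectionVars false

/-! ### Moments of random tensors -/

section Moments

variable {d : ℕ} {Ω : Type u} [MeasurableSpace Ω] (P : Measure Ω) [IsProbabilityMeasure P]

theorem sum_comp_le {ι κ : Type*} [Fintype ι] [Fintype κ] {g : ι → κ} (hg : Function.Injective g)
    {f : κ → ℝ} (hf : ∀ k, 0 ≤ f k) : ∑ i, f (g i) ≤ ∑ k, f k := by
  rw [← Finset.sum_image (s := Finset.univ) (f := f) hg.injOn]
  exact Finset.sum_le_sum_of_subset_of_nonneg (Finset.subset_univ _) fun k _ _ => hf k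

/-- A multi-index on `N` is determined by its restrictions to `B` and `A`, so the coordinates of the
tensor product occur among the products of coordinates, each at most once. -/
theorem norm_tensor_le {T : HForest d} {B A : Finset ℕ} (h : T.N ⊆ B ∪ A)
    (b : Tens (T.restrict B)) (a : Tens (T.restrict A)) : ‖tensor T B A b a‖ ≤ ‖b‖ * ‖a‖ := by
  rw [EuclideanSpace.norm_eq, EuclideanSpace.norm_eq, EuclideanSpace.norm_eq,
    ← Real.sqrt_mul (Finset.sum_nonneg fun _ _ => sq_nonneg _)]
  refine Real.sqrt_le_sqrt ?_
  rw [Finset.sum_mul_sum, ← Finset.sum_product', Finset.univ_product_univ]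
  set g : (T.N → Fin d) → ((T.restrict B).N → Fin d) × ((T.restrict A).N → Fin d) :=
    fun i => (fun x => i (incl T B x), fun x => i (incl T A x)) with hg
  have hinj : Function.Injective g := by
    intro i j hij
    funext x
    rcases Finset.mem_union.1 (h x.2) with hx | hx
    · exact congrFun (congrArg Prod.fst hij) ⟨x.1, Finset.mem_inter.2 ⟨x.2, hx⟩⟩
    · exact congrFun (congrArg Prod.snd hij) ⟨x.1, Finset.mem_inter.2 ⟨x.2, hx⟩⟩
  refine le_trans (Finset.sum_le_sum fun i _ => ?_) (sum_comp_le hinj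
    (f := fun x => ‖b x.1‖ ^ 2 * ‖a x.2‖ ^ 2) fun k => by positivity)
  rw [← mul_pow, ← norm_mul]
  rfl

theorem norm_isoTens_le {σ : Equiv.Perm ℕ} {T T' : HForest d} (h : HForest.IsIso σ T T')
    (a : Tens T) : ‖isoTens h a‖ ≤ ‖a‖ := by
  rw [EuclideanSpace.norm_eq, EuclideanSpace.norm_eq]
  refine Real.sqrt_le_sqrt ?_
  set g : (T'.N → Fin d) → (T.N → Fin d) :=
    fun i x => i ⟨σ x.1, (h.map_N _).2 x.2⟩ with hg
  have hinj : Function.Injective g := by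
    intro i j hij
    funext x
    have hx : σ.symm x.1 ∈ T.N := by
      rw [← h.map_N, Equiv.apply_symm_apply]; exact x.2
    have := congrFun hij ⟨_, hx⟩
    simpa [hg] using this
  exact sum_comp_le hinj (f := fun x => ‖a x‖ ^ 2) fun k => by positivity

theorem eLpNorm_pull {ι κ : Type} [Fintype ι] [Fintype κ] {E : Type} [NormedAddCommGroup E]
    (φ : ι → κ) (hφ : Function.Injective φ) (f : (ι → Ω) →ₘ[Measure.pi fun _ => P] E)
    (p : ℝ≥0∞) : eLpNorm (pull P φ hφ f) p (Measure.pi fun _ => P) =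
      eLpNorm f p (Measure.pi fun _ => P) := by
  rw [pull, eLpNorm_congr_ae (AEEqFun.coeFn_compMeasurePreserving f _),
    eLpNorm_comp_measurePreserving f.aestronglyMeasurable]
  exact measurePreserving_precomp P hφ

/-- Hölder's inequality with target exponent `(p⁻¹ + q⁻¹)⁻¹ ≥ r`, then monotonicity in the exponent
on a probability space. The factors share arguments, but no independence is needed. -/
theorem eLpNorm_couple_le {T : HForest d} {B A : Finset ℕ} (h : T.N ⊆ B ∪ A)
    (f : L0 P (T.restrict B)) (g : L0 P (T.restrict A)) {p q r : ℝ≥0∞} (hpq : p⁻¹ + q⁻¹ ≤ r⁻¹) :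
    eLpNorm (couple P T B A f g) r (Measure.pi fun _ => P) ≤
      eLpNorm f p (Measure.pi fun _ => P) * eLpNorm g q (Measure.pi fun _ => P) := by
  refine (eLpNorm_le_eLpNorm_of_exponent_le (q := (p⁻¹ + q⁻¹)⁻¹) (by
    rw [← ENNReal.inv_le_inv, inv_inv]; exact hpq)
    (AEEqFun.aestronglyMeasurable _)).trans ?_
  rw [couple, eLpNorm_congr_ae (AEEqFun.coeFn_comp₂ _ _ _ _),
    ← eLpNorm_pull P (coupling T B) (coupling_injective T B) f,
    ← eLpNorm_pull P (coupling T A) (coupling_injective T A) g]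
  have : ENNReal.HolderTriple p q (p⁻¹ + q⁻¹)⁻¹ := ⟨(inv_inv _).symm⟩
  have := eLpNorm_le_eLpNorm_mul_eLpNorm'_of_norm (p := p) (q := q) (r := (p⁻¹ + q⁻¹)⁻¹)
    (pull P (coupling T B) (coupling_injective T B) f).aestronglyMeasurable
    (pull P (coupling T A) (coupling_injective T A) g).aestronglyMeasurable
    (tensor T B A) 1 (Filter.Eventually.of_forall fun x => by
      rw [NNReal.coe_one, one_mul]; exact norm_tensor_le h _ _)
  simpa using this

theorem eLpNorm_transport_le {σ : Equiv.Perm ℕ} {T T' : HForest d} (h : HForest.IsIso σ T T')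
    (f : L0 P T) (p : ℝ≥0∞) : eLpNorm (transport P h f) p (Measure.pi fun _ => P) ≤
      eLpNorm f p (Measure.pi fun _ => P) := by
  rw [transport, eLpNorm_congr_ae (AEEqFun.coeFn_comp _ _ _),
    ← eLpNorm_pull P (isoIdx h) (isoIdx_injective h) f]
  exact eLpNorm_mono_ae (Filter.Eventually.of_forall fun x => norm_isoTens_le h _)

theorem eLpNorm_sum_coe_le {α E κ : Type*} [MeasurableSpace α] {μ : Measure α}
    [NormedAddCommGroup E] {p : ℝ≥0∞} (hp : 1 ≤ p) (s : Finset κ) (f : κ → α →ₘ[μ] E) :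
    eLpNorm (∑ i ∈ s, f i : α →ₘ[μ] E) p μ ≤ ∑ i ∈ s, eLpNorm (f i) p μ := by
  induction s using Finset.induction_on with
  | empty =>
    rw [Finset.sum_empty, Finset.sum_empty, eLpNorm_congr_ae AEEqFun.coeFn_zero, eLpNorm_zero]
  | insert i s hi ih =>
    rw [Finset.sum_insert hi, Finset.sum_insert hi, eLpNorm_congr_ae (AEEqFun.coeFn_add _ _)]
    exact (eLpNorm_add_le (AEEqFun.aestronglyMeasurable _) (AEEqFun.aestronglyMeasurable _)
      hp).trans (by gcongr)

theorem eLpNorm_smul_coe {α E : Type*} [MeasurableSpace α] {μ : Measure α}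
    [NormedAddCommGroup E] [NormedSpace ℝ E] (p : ℝ≥0∞) (r : ℝ) (f : α →ₘ[μ] E) :
    eLpNorm (r • f : α →ₘ[μ] E) p μ = ‖r‖ₑ * eLpNorm f p μ := by
  rw [eLpNorm_congr_ae (AEEqFun.coeFn_smul _ _), eLpNorm_const_smul]

theorem eLpNorm_scalar_le {T : HForest d} (hT : T.N = ∅) (r : ℝ) :
    eLpNorm (scalar P T r) ⊤ (Measure.pi fun _ => P) ≤ ‖r‖ₑ := by
  have he : IsEmpty T.N := Finset.isEmpty_coe_sort.2 hT
  rw [scalar, eLpNorm_congr_ae (AEEqFun.coeFn_const _ _)]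
  have hr : ‖(WithLp.toLp 2 fun _ => r : Tens T)‖ = ‖r‖ := by
    rw [EuclideanSpace.norm_eq]
    simp [Real.sqrt_sq_eq_abs]
  refine (eLpNorm_mono (g := fun _ => r) (fun x => hr.le)).trans ?_
  rw [eLpNorm_exponent_top]
  exact eLpNormEssSup_le_of_ae_enorm_bound (Filter.Eventually.of_forall fun x => le_rfl)

end Moments

/-! ### Restriction to the truncated forests -/

section Truncated

variable {d : ℕ} {Ω : Type u} [MeasurableSpace Ω] (P : Measure Ω) [IsProbabilityMeasure P]
variable {w : Weights}

variable {P} in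
/-- The restriction of a family to the truncated forests. -/
def FullFam.res (w : Weights) (f : FullFam d P) : Fam d P w := fun T => f T.1

/-- The parts of a truncated forest are truncated, so all truncated identities can be computed in
the ring `FullFam`. -/
theorem conv_res (f g : FullFam d P) : conv P (f.res w) (g.res w) = (f * g).res w := rfl

theorem counit_eq_res : counit d P w = (1 : FullFam d P).res w := rfl

theorem convPow_res (f : FullFam d P) (n : ℕ) : convPow P (f.res w) n = (f ^ n).res w := by
  induction n with
  | zero => rw [pow_zero]; rfl
  | succ n ih => rw [pow_succ, ← conv_res, ← ih]; rfl

theorem antipode_res (f : FullFam d P) : antipode P (f.res w) = f.antipode.res w := by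
  funext T
  refine Finset.sum_congr rfl fun i _ => ?_
  exact congrFun (convPow_res P (1 - f) i) T

theorem logStar_res (f : FullFam d P) : logStar P (f.res w) = f.log.res w := by
  funext T
  refine Finset.sum_congr rfl fun i _ => ?_
  change _ • convPow P ((f - 1).res w) i T = _
  rw [convPow_res]
  rfl

theorem expStar_res (f : FullFam d P) : expStar P (f.res w) = f.exp.res w := by
  funext T
  refine Finset.sum_congr rfl fun i _ => ?_
  exact congrArg _ (congrFun (convPow_res P f i) T)

/-- `scale` is a ring homomorphism, hence commutes with the exponential, and exponential and
logarithm cancel. -/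
theorem dilation_res {f : FullFam d P} (hf : f.IsChar) (t : ℝ) :
    dilation P t (f.res w) = (FullFam.scale d P t f).res w := by
  have h : (fun T => t ^ T.size • logStar P (f.res w) T : Fam d P w) =
      (FullFam.scale d P t f.log).res w := by
    rw [logStar_res]; rfl
  rw [dilation, h, expStar_res, FullFam.exp_scale, hf.exp_log]

/-! ### Sizes and cuts of truncated forests -/

variable (d w) in
/-- The maximal number of nodes of a truncated forest. -/
def maxSize : ℕ := ⌊w.γ d / min w.α w.β⌋₊

/-- Every node contributes at least `min α β` to a grade that is at most `γ`. -/
theorem TForest.size_le (T : TForest d w) : T.size ≤ maxSize d w := by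
  have hmin : 0 < min w.α w.β := lt_min w.α_pos w.β_pos
  refine Nat.le_floor ?_
  rw [le_div_iff₀ hmin]
  refine le_trans ?_ T.2
  have h : (T.size : ℝ) = (T.raw.h0.card : ℝ) + ((T.raw.N \ T.raw.h0).card : ℝ) := by
    rw [TForest.size, ← Finset.card_sdiff_add_card_eq_card T.1.2.h0_subset]
    push_cast
    ring
  rw [h, add_mul, mul_comm, mul_comm ((T.raw.N \ T.raw.h0).card : ℝ)]
  exact add_le_add (mul_le_mul_of_nonneg_right (min_le_left _ _) (Nat.cast_nonneg _))
    (mul_le_mul_of_nonneg_right (min_le_right _ _) (Nat.cast_nonneg _))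

theorem TForest.size_prune_add_size_root (T : TForest d w) (A : T.raw.cuts) :
    (T.prune A).size + (T.root A).size = T.size := by
  have hA := (HForest.mem_cuts.1 A.2).1
  have h1 : (T.prune A).raw.N = T.raw.N \ A.1 := Finset.inter_eq_right.2 Finset.sdiff_subset
  have h2 : (T.root A).raw.N = A.1 := Finset.inter_eq_right.2 hA
  rw [TForest.size, TForest.size, h1, h2, Finset.card_sdiff_add_card_eq_card hA]
  rfl

theorem TForest.card_cuts_le (T : TForest d w) : T.raw.cuts.card ≤ 2 ^ maxSize d w := by
  refine (Finset.card_le_card (fun A hA => Finset.mem_powerset.2 (HForest.mem_cuts.1 hA).1)).trans ?_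
  rw [Finset.card_powerset]
  exact Nat.pow_le_pow_right (by norm_num) T.size_le

theorem TForest.root_eq_self (T : TForest d w) (A : T.raw.cuts) (hA : (T.prune A).raw.N = ∅) :
    T.root A = T := by
  have h1 : (T.prune A).raw.N = T.raw.N \ A.1 := Finset.inter_eq_right.2 Finset.sdiff_subset
  rw [h1, Finset.sdiff_eq_empty_iff_subset] at hA
  have h2 : A.1 = T.raw.N := subset_antisymm (HForest.mem_cuts.1 A.2).1 hA
  refine Subtype.ext (Subtype.ext ?_)
  change T.raw.restrict A.1 = T.raw
  rw [h2, HForest.restrict_self T.1.2]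

theorem TForest.prune_eq_self (T : TForest d w) (A : T.raw.cuts) (hA : (T.root A).raw.N = ∅) :
    T.prune A = T := by
  have h1 : (T.root A).raw.N = A.1 := Finset.inter_eq_right.2 (HForest.mem_cuts.1 A.2).1
  refine Subtype.ext (Subtype.ext ?_)
  change T.raw.restrict (T.raw.N \ A.1) = T.raw
  rw [← h1, hA, Finset.sdiff_empty, HForest.restrict_self T.1.2]

/-- The exponent `q`, with the value `∞` at the empty forest. -/
def exponent (q : TForest d w → ℝ) (T : TForest d w) : ℝ≥0∞ :=
  if T.raw.N = ∅ then ⊤ else ENNReal.ofReal (q T)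

variable {p q : TForest d w → ℝ}

theorem IsDualPair.one_le_exponent (hpq : IsDualPair p q) (T : TForest d w) :
    1 ≤ exponent q T := by
  unfold exponent
  split_ifs with h
  · exact le_top
  · rw [← ENNReal.ofReal_one]
    exact ENNReal.ofReal_le_ofReal (hpq.one_le_q T (Finset.nonempty_iff_ne_empty.2 h))

/-- The exponent `∞` on the empty forest extends the cut inequality to the trivial cuts, where it is
an equality. -/
theorem IsDualPair.exponent_cut (hpq : IsDualPair p q) (T : TForest d w) (A : T.raw.cuts) :
    (exponent q (T.prune A))⁻¹ + (exponent q (T.root A))⁻¹ ≤ (exponent q T)⁻¹ := by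
  by_cases h1 : (T.prune A).raw.N = ∅
  · rw [T.root_eq_self A h1]
    simp [exponent, h1]
  by_cases h2 : (T.root A).raw.N = ∅
  · rw [T.prune_eq_self A h2]
    simp [exponent, h2]
  have n1 := Finset.nonempty_iff_ne_empty.2 h1
  have n2 := Finset.nonempty_iff_ne_empty.2 h2
  have h3 : T.raw.N.Nonempty := n1.mono Finset.inter_subset_left
  have q1 : 0 < q (T.prune A) := one_pos.trans_le (hpq.one_le_q _ n1)
  have q2 : 0 < q (T.root A) := one_pos.trans_le (hpq.one_le_q _ n2)
  have q3 : 0 < q T := one_pos.trans_le (hpq.one_le_q _ h3)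
  have := hpq.cut T A n1 n2
  rw [exponent, exponent, exponent, if_neg h1, if_neg h2, if_neg h3.ne_empty,
    ← ENNReal.ofReal_inv_of_pos q1, ← ENNReal.ofReal_inv_of_pos q2,
    ← ENNReal.ofReal_inv_of_pos q3, ← ENNReal.ofReal_add (by positivity) (by positivity)]
  refine ENNReal.ofReal_le_ofReal ?_
  simpa only [one_div] using this

/-- The moment of order `exponent q T`. -/
def nrm (q : TForest d w → ℝ) (W : Fam d P w) (T : TForest d w) : ℝ≥0∞ :=
  eLpNorm (W T) (exponent q T) (Measure.pi fun _ => P)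

theorem nrm_eq_moment (W : Fam d P w) {T : TForest d w} (hT : T.raw.N.Nonempty) :
    nrm P q W T = moment P q W T := by
  rw [nrm, exponent, if_neg hT.ne_empty, moment]

theorem nrm_conv_le (hpq : IsDualPair p q) (f g : Fam d P w) (T : TForest d w) :
    nrm P q (conv P f g) T ≤ ∑ A : T.raw.cuts, nrm P q f (T.prune A) * nrm P q g (T.root A) := by
  refine (eLpNorm_sum_coe_le (hpq.one_le_exponent T) _ _).trans (Finset.sum_le_sum fun A _ => ?_)
  exact eLpNorm_couple_le P (by rw [Finset.sdiff_union_self_eq_union]; exact Finset.subset_union_left)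
    _ _ (hpq.exponent_cut T A)

theorem nrm_add_le (hpq : IsDualPair p q) (f g : Fam d P w) (T : TForest d w) :
    nrm P q (f + g) T ≤ nrm P q f T + nrm P q g T := by
  have := eLpNorm_sum_coe_le (hpq.one_le_exponent T) Finset.univ ![f T, g T]
  rw [Fin.sum_univ_two, Fin.sum_univ_two] at this
  exact this

theorem nrm_smul (r : ℝ) (f : Fam d P w) (T : TForest d w) :
    nrm P q (r • f) T = ‖r‖ₑ * nrm P q f T :=
  eLpNorm_smul_coe _ r (f T)

theorem nrm_scalar_le {f : Fam d P w} {T : TForest d w} (hT : T.raw.N = ∅) {r : ℝ}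
    (hf : f T = scalar P T.raw r) : nrm P q f T ≤ ‖r‖ₑ := by
  rw [nrm, exponent, if_pos hT, hf]
  exact eLpNorm_scalar_le P hT r

end Truncated

end

end Lions

namespace Lions

noncomputable section

open scoped Classical

set_option linter.unusedSectionVars false

variable {d : ℕ} {Ω : Type u} [MeasurableSpace Ω] (P : Measure Ω) [IsProbabilityMeasure P]
variable {w : Weights} {p q : TForest d w → ℝ}

/-! ### The constant of the norm -/

theorem TForest.card_cuts_eq (T : TForest d w) :
    (T.raw.cuts.card : ℝ) = ∑ t ∈ T.cutTypes, (T.count t : ℝ) := by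
  have h := Finset.card_eq_sum_card_fiberwise (f := T.cutType) (s := Finset.univ)
    (t := T.cutTypes) (fun A _ => Finset.mem_image_of_mem _ (Finset.mem_univ A))
  rw [Finset.card_univ, Fintype.card_coe] at h
  rw [h]
  push_cast
  rfl

/-- The power mean inequality `(∑ c) ^ q ≤ C ^ (q - 1) * ∑ c ^ q`, applied to the multiplicities
`c(T, T₁, T₂)`, whose sum is the number of cuts. -/
theorem card_cuts_le_constK (hpq : IsDualPair p q) {T : TForest d w} (hT : T.raw.N.Nonempty) :
    (T.raw.cuts.card : ℝ≥0∞) ≤ constK q := by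
  refine le_iSup₂_of_le T hT ?_
  rw [← ENNReal.ofReal_natCast]
  refine ENNReal.ofReal_le_ofReal ?_
  have hq := hpq.one_le_q T hT
  have hq0 : q T ≠ 0 := by positivity
  have h := Real.rpow_sum_le_const_mul_sum_rpow_of_nonneg T.cutTypes
    (f := fun t => (T.count t : ℝ)) hq fun _ _ => Nat.cast_nonneg _
  rw [← T.card_cuts_eq] at h
  refine le_trans ?_ (Real.rpow_le_rpow (by positivity) h (by positivity))
  rw [one_div, Real.rpow_rpow_inv (by positivity) hq0]

/-- The number of pairs and each multiplicity are at most the number of cuts, hence at most `2 ^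
maxSize d w`; the expression defining `K` is at most the product of the two bounds. -/
theorem constK_le (hpq : IsDualPair p q) : constK q ≤ 4 ^ maxSize d w := by
  refine iSup₂_le fun T hT => ?_
  have hq := hpq.one_le_q T hT
  have hq0 : q T ≠ 0 := by positivity
  set C := T.cutTypes.card with hC
  set n := T.raw.cuts.card with hn
  have hn2 : n ≤ 2 ^ maxSize d w := T.card_cuts_le
  have hCn : C ≤ n := by
    refine Finset.card_image_le.trans ?_
    rw [Finset.card_univ, Fintype.card_coe]
  have hC0 : (0 : ℝ) < C := by
    rw [Nat.cast_pos, Finset.card_pos]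
    refine Finset.Nonempty.image ⟨⟨∅, ?_⟩, Finset.mem_univ _⟩ _
    exact HForest.mem_cuts.2 ⟨Finset.empty_subset _, fun x y _ h => by simp at h⟩
  have hsum : ∑ t ∈ T.cutTypes, (T.count t : ℝ) ^ q T ≤ C * (n : ℝ) ^ q T := by
    rw [← nsmul_eq_mul]
    refine Finset.sum_le_card_nsmul _ _ _ fun t _ => ?_
    refine Real.rpow_le_rpow (by positivity) (Nat.cast_le.2 ?_) (by positivity)
    refine (Finset.card_filter_le _ _).trans ?_
    rw [Finset.card_univ, Fintype.card_coe]
  have h1 : (C : ℝ) ^ (q T - 1) * ∑ t ∈ T.cutTypes, (T.count t : ℝ) ^ q T ≤ (C * n : ℝ) ^ q T := by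
    have hC1 : (0 : ℝ) ≤ (C : ℝ) ^ (q T - 1) := Real.rpow_nonneg hC0.le _
    refine (mul_le_mul_of_nonneg_left hsum hC1).trans ?_
    rw [← mul_assoc, Real.mul_rpow hC0.le (Nat.cast_nonneg n), Real.rpow_sub_one hC0.ne',
      div_mul_cancel₀ _ hC0.ne']
  have h2 : ((C : ℝ) ^ (q T - 1) * ∑ t ∈ T.cutTypes, (T.count t : ℝ) ^ q T) ^ (1 / q T) ≤
      (C * n : ℝ) := by
    have hn0 : (0 : ℝ) ≤ C * n := mul_nonneg hC0.le (Nat.cast_nonneg n)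
    have hs0 : (0 : ℝ) ≤ (C : ℝ) ^ (q T - 1) * ∑ t ∈ T.cutTypes, (T.count t : ℝ) ^ q T :=
      mul_nonneg (Real.rpow_nonneg hC0.le _)
        (Finset.sum_nonneg fun t _ => Real.rpow_nonneg (Nat.cast_nonneg _) _)
    refine (Real.rpow_le_rpow hs0 h1 (by positivity)).trans ?_
    rw [one_div, Real.rpow_rpow_inv hn0 hq0]
  refine (ENNReal.ofReal_le_ofReal h2).trans ?_
  have h3 : C * n ≤ 4 ^ maxSize d w := by
    have h4 : (4 : ℕ) ^ maxSize d w = 2 ^ maxSize d w * 2 ^ maxSize d w := by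
      rw [← mul_pow]; norm_num
    rw [h4]
    exact Nat.mul_le_mul (hCn.trans hn2) hn2
  rw [← Nat.cast_mul, ENNReal.ofReal_natCast]
  exact_mod_cast h3

theorem constK_ne_top (hpq : IsDualPair p q) : constK q ≠ ⊤ :=
  ((constK_le hpq).trans_lt (ENNReal.pow_lt_top (by simp))).ne

theorem one_le_constK (hpq : IsDualPair p q) {T : TForest d w} (hT : T.raw.N.Nonempty) :
    1 ≤ constK q := by
  refine le_trans ?_ (card_cuts_le_constK hpq hT)
  rw [← Nat.cast_one, Nat.cast_le]
  refine Finset.card_pos.2 ⟨∅, ?_⟩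
  exact HForest.mem_cuts.2 ⟨Finset.empty_subset _, fun x y _ h => by simp at h⟩

/-! ### The homogeneous norm -/

theorem TForest.size_pos {T : TForest d w} (hT : T.raw.N.Nonempty) : 0 < T.size :=
  Finset.card_pos.2 hT

theorem TForest.size_eq_zero {T : TForest d w} (hT : T.raw.N = ∅) : T.size = 0 :=
  Finset.card_eq_zero.2 hT

/-- The form in which the norm is used throughout: a forest with `k` nodes enters only the `k`-th
component, and all sizes lie in the range of the maximum. -/
theorem halfNorm_le_iff {W : Fam d P w} {a : ℝ≥0∞} :
    halfNorm P q W ≤ a ↔ ∀ T : TForest d w, T.raw.N.Nonempty →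
      (T.size.factorial : ℝ≥0∞) * (constK q * nrm P q W T) ≤ a ^ T.size := by
  rw [halfNorm, iSup₂_le_iff]
  have key : ∀ k : ℕ, 0 < k → ∀ x : ℝ≥0∞, x ^ (1 / (k : ℝ)) ≤ a ↔ x ≤ a ^ k := by
    intro k hk x
    rw [one_div, ENNReal.rpow_inv_le_iff (by positivity), ENNReal.rpow_natCast]
  constructor
  · intro h T hT
    have h1 := (key T.size (TForest.size_pos hT) _).1
      (h T.size (Finset.mem_Icc.2 ⟨TForest.size_pos hT, T.size_le⟩))
    refine le_trans ?_ h1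
    unfold boldNorm
    gcongr
    refine le_iSup₂_of_le T hT ?_
    rw [nrm_eq_moment P W hT, moment, moment, part, if_pos rfl]
  · intro h k hk
    have hk1 := (Finset.mem_Icc.1 hk).1
    rw [key k hk1, boldNorm, ENNReal.mul_iSup, ENNReal.mul_iSup]
    refine iSup_le fun T => ?_
    rw [ENNReal.mul_iSup, ENNReal.mul_iSup]
    refine iSup_le fun hT => ?_
    rw [moment, part]
    split_ifs with hs
    · subst hs
      have := h T hT
      rwa [nrm_eq_moment P W hT] at this
    · rw [eLpNorm_congr_ae AEEqFun.coeFn_zero, eLpNorm_zero, mul_zero, mul_zero]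
      exact zero_le

/-- The two parts of a convolution of total size `k` in which the pruned part has size `i`. -/
theorem sum_cuts_le (hpq : IsDualPair p q) {V W : Fam d P w} {a b : ℝ≥0∞}
    (hV : ∀ T : TForest d w, T.raw.N = ∅ → nrm P q V T ≤ 1)
    (hW : ∀ T : TForest d w, T.raw.N = ∅ → nrm P q W T ≤ 1)
    (ha : halfNorm P q V ≤ a) (hb : halfNorm P q W ≤ b) {T : TForest d w} (hT : T.raw.N.Nonempty)
    (i : ℕ) :
    ∑ A : T.raw.cuts with (T.prune A).size = i, (T.size.factorial : ℝ≥0∞) * (constK q *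
      (nrm P q V (T.prune A) * nrm P q W (T.root A))) ≤
      a ^ i * b ^ (T.size - i) * (T.size.choose i : ℝ≥0∞) := by
  rw [halfNorm_le_iff] at ha hb
  have hK := one_le_constK hpq hT
  have hK0 : constK q ≠ 0 := (one_pos.trans_le hK).ne'
  have hKt := constK_ne_top hpq
  -- The trivial cuts come apart: only one part then carries a factor `K`, leaving nothing to pay
  -- for a number of cuts, but there is just one such cut.
  rcases Nat.eq_zero_or_pos i with rfl | hi
  · have huniq : ∀ A ∈ Finset.univ.filter (fun A : T.raw.cuts => (T.prune A).size = 0),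
        (T.size.factorial : ℝ≥0∞) * (constK q *
          (nrm P q V (T.prune A) * nrm P q W (T.root A))) ≤ b ^ T.size := by
      intro A hA
      have hA' := Finset.card_eq_zero.1 (Finset.mem_filter.1 hA).2
      rw [T.root_eq_self A hA']
      refine le_trans ?_ (hb T hT)
      gcongr
      exact mul_le_of_le_one_left zero_le (hV _ hA')
    have hcard : (Finset.univ.filter (fun A : T.raw.cuts => (T.prune A).size = 0)).card ≤ 1 := by
      refine Finset.card_le_one.2 fun A hA B hB => Subtype.ext ?_
      have hN : ∀ C ∈ Finset.univ.filter (fun A : T.raw.cuts => (T.prune A).size = 0),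
          C.1 = T.raw.N := fun C hC => by
        have := Finset.card_eq_zero.1 (Finset.mem_filter.1 hC).2
        have h1 := congrArg HForest.N (congrArg TForest.raw (T.root_eq_self C this))
        exact (Finset.inter_eq_right.2 (HForest.mem_cuts.1 C.2).1).symm.trans h1
      rw [hN A hA, hN B hB]
    refine (Finset.sum_le_card_nsmul _ _ _ huniq).trans ?_
    rw [nsmul_eq_mul, pow_zero, one_mul, Nat.sub_zero, Nat.choose_zero_right, Nat.cast_one, mul_one]
    exact mul_le_of_le_one_left zero_le (by exact_mod_cast hcard)
  rcases eq_or_ne i T.size with rfl | hik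
  · have huniq : ∀ A ∈ Finset.univ.filter (fun A : T.raw.cuts => (T.prune A).size = T.size),
        (T.size.factorial : ℝ≥0∞) * (constK q *
          (nrm P q V (T.prune A) * nrm P q W (T.root A))) ≤ a ^ T.size := by
      intro A hA
      have h1 := T.size_prune_add_size_root A
      have h2 := (Finset.mem_filter.1 hA).2
      have hA' : (T.root A).raw.N = ∅ := Finset.card_eq_zero.1 (by
        change (T.root A).size = 0
        omega)
      rw [T.prune_eq_self A hA']
      refine le_trans ?_ (ha T hT)
      gcongr
      exact mul_le_of_le_one_right zero_le (hW _ hA')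
    have hcard :
        (Finset.univ.filter (fun A : T.raw.cuts => (T.prune A).size = T.size)).card ≤ 1 := by
      refine Finset.card_le_one.2 fun A hA B hB => Subtype.ext ?_
      have hN : ∀ C ∈ Finset.univ.filter (fun A : T.raw.cuts => (T.prune A).size = T.size),
          C.1 = ∅ := fun C hC => by
        have h1 := T.size_prune_add_size_root C
        have h2 := (Finset.mem_filter.1 hC).2
        have h3 : (T.root C).size = 0 := by omega
        have h4 : (T.root C).raw.N = C.1 :=
          Finset.inter_eq_right.2 (HForest.mem_cuts.1 C.2).1
        rw [← h4]
        exact Finset.card_eq_zero.1 h3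
      rw [hN A hA, hN B hB]
    refine (Finset.sum_le_card_nsmul _ _ _ huniq).trans ?_
    rw [nsmul_eq_mul, Nat.sub_self, pow_zero, mul_one, Nat.choose_self, Nat.cast_one, mul_one]
    exact mul_le_of_le_one_left zero_le (by exact_mod_cast hcard)
  -- For a proper cut the bounds of both parts contain `K`, and one is needed; the spare `K⁻¹`
  -- absorbs the number of cuts.
  · have hterm : ∀ A ∈ Finset.univ.filter (fun A : T.raw.cuts => (T.prune A).size = i),
        (T.size.factorial : ℝ≥0∞) * (constK q *
          (nrm P q V (T.prune A) * nrm P q W (T.root A))) ≤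
          (constK q)⁻¹ * (a ^ i * b ^ (T.size - i) * (T.size.choose i : ℝ≥0∞)) := by
      intro A hA
      have h1 := T.size_prune_add_size_root A
      have h2 := (Finset.mem_filter.1 hA).2
      have n1 : (T.prune A).raw.N.Nonempty := Finset.card_pos.1 (by
        change 0 < (T.prune A).size
        omega)
      have n2 : (T.root A).raw.N.Nonempty := Finset.card_pos.1 (by
        change 0 < (T.root A).size
        omega)
      have e1 := ha _ n1
      have e2 := hb _ n2
      have hj : (T.root A).size = T.size - i := by omega
      have hil : i ≤ T.size := by omega
      rw [h2] at e1
      rw [hj] at e2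
      have hfac : (T.size.factorial : ℝ≥0∞) =
          (T.size.choose i : ℝ≥0∞) * i.factorial * (T.size - i).factorial := by
        exact_mod_cast (Nat.choose_mul_factorial_mul_factorial hil).symm
      calc (T.size.factorial : ℝ≥0∞) * (constK q *
            (nrm P q V (T.prune A) * nrm P q W (T.root A)))
          = (constK q)⁻¹ * (((i.factorial : ℝ≥0∞) * (constK q * nrm P q V (T.prune A))) *
              (((T.size - i).factorial : ℝ≥0∞) * (constK q * nrm P q W (T.root A))) *
              (T.size.choose i : ℝ≥0∞)) := by
            rw [hfac]
            have : (constK q)⁻¹ * constK q = 1 := ENNReal.inv_mul_cancel hK0 hKt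
            calc _ = 1 * ((T.size.choose i : ℝ≥0∞) * i.factorial * (T.size - i).factorial *
                  (constK q * (nrm P q V (T.prune A) * nrm P q W (T.root A)))) := (one_mul _).symm
              _ = _ := by rw [← this]; ring
        _ ≤ _ := by gcongr
    refine (Finset.sum_le_card_nsmul _ _ _ hterm).trans ?_
    rw [nsmul_eq_mul, ← mul_assoc]
    refine mul_le_of_le_one_left zero_le ?_
    have hcard : ((Finset.univ.filter (fun A : T.raw.cuts => (T.prune A).size = i)).card : ℝ≥0∞) ≤
        constK q := by
      refine le_trans ?_ (card_cuts_le_constK hpq hT)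
      rw [← Fintype.card_coe T.raw.cuts]
      exact_mod_cast Finset.card_filter_le _ _
    refine (mul_le_mul_left hcard _).trans ?_
    rw [ENNReal.mul_inv_cancel hK0 hKt]

/-- Grouping the cuts by the size of the pruned part produces the binomial expansion of the `|T|`-th
power of the sum of the two norms; the factorials in the norm supply the binomial coefficients. -/
theorem halfNorm_conv_le (hpq : IsDualPair p q) {V W : Fam d P w}
    (hV : ∀ T : TForest d w, T.raw.N = ∅ → nrm P q V T ≤ 1)
    (hW : ∀ T : TForest d w, T.raw.N = ∅ → nrm P q W T ≤ 1) :
    halfNorm P q (conv P V W) ≤ halfNorm P q V + halfNorm P q W := by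
  rw [halfNorm_le_iff]
  intro T hT
  calc (T.size.factorial : ℝ≥0∞) * (constK q * nrm P q (conv P V W) T)
      ≤ (T.size.factorial : ℝ≥0∞) * (constK q *
          ∑ A : T.raw.cuts, nrm P q V (T.prune A) * nrm P q W (T.root A)) := by
        gcongr
        exact nrm_conv_le P hpq V W T
    _ = ∑ A : T.raw.cuts, (T.size.factorial : ℝ≥0∞) * (constK q *
          (nrm P q V (T.prune A) * nrm P q W (T.root A))) := by
        rw [Finset.mul_sum, Finset.mul_sum]
    _ = ∑ i ∈ Finset.range (T.size + 1), ∑ A : T.raw.cuts with (T.prune A).size = i,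
          (T.size.factorial : ℝ≥0∞) * (constK q *
            (nrm P q V (T.prune A) * nrm P q W (T.root A))) := by
        refine (Finset.sum_fiberwise_of_maps_to (fun A _ => ?_) _).symm
        have := T.size_prune_add_size_root A
        exact Finset.mem_range.2 (by omega)
    _ ≤ ∑ i ∈ Finset.range (T.size + 1), halfNorm P q V ^ i * halfNorm P q W ^ (T.size - i) *
          (T.size.choose i : ℝ≥0∞) :=
        Finset.sum_le_sum fun i _ => sum_cuts_le P hpq hV hW le_rfl le_rfl hT i
    _ = _ := (add_pow _ _ _).symm

/-! ### Families of geometric growth -/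

/-- The moments of `W` grow at most geometrically in the number of nodes. -/
def Growth (q : TForest d w → ℝ) (a c : ℝ≥0∞) (W : Fam d P w) : Prop :=
  ∀ T, nrm P q W T ≤ c * a ^ T.size

variable {P} {a c c' : ℝ≥0∞}

/-- The sizes of the two parts add up to `|T|`, so the rate `a` survives; the new constant counts
the cuts. -/
theorem Growth.conv (hpq : IsDualPair p q) {f g : Fam d P w} (hf : Growth P q a c f)
    (hg : Growth P q a c' g) : Growth P q a (2 ^ maxSize d w * (c * c')) (conv P f g) := by
  intro T
  refine (nrm_conv_le P hpq f g T).trans ?_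
  have h : ∀ A ∈ (Finset.univ : Finset T.raw.cuts), nrm P q f (T.prune A) * nrm P q g (T.root A) ≤
      c * c' * a ^ T.size := by
    intro A _
    refine (mul_le_mul' (hf _) (hg _)).trans ?_
    rw [← T.size_prune_add_size_root A, pow_add]
    exact (mul_mul_mul_comm _ _ _ _).le
  refine (Finset.sum_le_card_nsmul _ _ _ h).trans ?_
  rw [nsmul_eq_mul, Finset.card_univ, Fintype.card_coe, mul_assoc (2 ^ maxSize d w)]
  gcongr
  exact_mod_cast T.card_cuts_le

theorem nrm_of_eq_zero {f : Fam d P w} {T : TForest d w} (h : f T = 0) : nrm P q f T = 0 := by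
  rw [nrm, h, eLpNorm_congr_ae AEEqFun.coeFn_zero, eLpNorm_zero]

theorem growth_counit : Growth P q a 1 (counit d P w) := by
  intro T
  by_cases hT : T.raw.N = ∅
  · refine (nrm_scalar_le P hT (r := 1) ?_).trans ?_
    · rw [counit, if_pos hT]
    · rw [TForest.size_eq_zero hT]; simp
  · rw [nrm_of_eq_zero]
    · exact zero_le
    · rw [counit, if_neg hT]
      rfl

theorem Growth.convPow (hpq : IsDualPair p q) {f : Fam d P w} (hf : Growth P q a c f) (n : ℕ) :
    Growth P q a ((2 ^ maxSize d w * c) ^ n) (convPow P f n) := by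
  induction n with
  | zero => rw [pow_zero]; exact growth_counit
  | succ n ih =>
    have := ih.conv hpq hf
    have e : (2 ^ maxSize d w * c) ^ (n + 1) =
        2 ^ maxSize d w * ((2 ^ maxSize d w * c) ^ n * c) := by ring
    rw [e]
    exact this

/-- The growth constant of a polynomial in a family with growth constant `c`. -/
def seriesConst (M : ℕ) (s : Finset ℕ) (r : ℕ → ℝ) (c : ℝ≥0∞) : ℝ≥0∞ :=
  ∑ n ∈ s, ‖r n‖ₑ * (2 ^ M * c) ^ n

theorem seriesConst_ne_top {M : ℕ} {s : Finset ℕ} {r : ℕ → ℝ} (hc : c ≠ ⊤) :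
    seriesConst M s r c ≠ ⊤ := by
  refine ENNReal.sum_ne_top.2 fun n _ => ENNReal.mul_ne_top enorm_ne_top ?_
  exact ENNReal.pow_ne_top (ENNReal.mul_ne_top (ENNReal.pow_ne_top (by simp)) hc)

/-- The series may be truncated differently at each forest, as long as one finite `S` contains all
the exponents used. -/
theorem Growth.series (hpq : IsDualPair p q) {f g : Fam d P w} (hf : Growth P q a c f)
    {s : TForest d w → Finset ℕ} {S : Finset ℕ} (hs : ∀ T, s T ⊆ S) {r : ℕ → ℝ}
    (hg : ∀ T, g T = ∑ n ∈ s T, r n • Lions.convPow P f n T) :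
    Growth P q a (seriesConst (maxSize d w) S r c) g := by
  intro T
  have h1 : nrm P q g T ≤ ∑ n ∈ s T, ‖r n‖ₑ * nrm P q (Lions.convPow P f n) T := by
    rw [nrm, hg T]
    refine (eLpNorm_sum_coe_le (hpq.one_le_exponent T) _ _).trans
      (Finset.sum_le_sum fun n _ => ?_)
    rw [eLpNorm_smul_coe]
    rfl
  refine h1.trans ((Finset.sum_le_sum_of_subset (hs T)).trans ?_)
  rw [seriesConst, Finset.sum_mul]
  refine Finset.sum_le_sum fun n _ => ?_
  rw [mul_assoc]
  gcongr
  exact hf.convPow hpq n T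

theorem Growth.antipode (hpq : IsDualPair p q) {W : Fam d P w}
    (hW : Growth P q a c (counit d P w - W)) :
    Growth P q a (seriesConst (maxSize d w) (Finset.range (maxSize d w + 1)) 1 c)
      (antipode P W) := by
  refine hW.series hpq (s := fun T => Finset.range (T.size + 1))
    (fun T => Finset.range_mono (by have := T.size_le; omega)) fun T => ?_
  refine Finset.sum_congr rfl fun n _ => ?_
  exact (one_smul ℝ (Lions.convPow P (counit d P w - W) n T)).symm

theorem Growth.logStar (hpq : IsDualPair p q) {W : Fam d P w}
    (hW : Growth P q a c (W - counit d P w)) :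
    Growth P q a (seriesConst (maxSize d w) (Finset.Icc 1 (maxSize d w))
      (fun n => (-1 : ℝ) ^ (n + 1) / n) c) (logStar P W) :=
  hW.series hpq (s := fun T => Finset.Icc 1 T.size)
    (fun T => Finset.Icc_subset_Icc_right T.size_le) fun _ => rfl

theorem Growth.expStar (hpq : IsDualPair p q) {f : Fam d P w} (hf : Growth P q a c f) :
    Growth P q a (seriesConst (maxSize d w) (Finset.range (maxSize d w + 1))
      (fun n => 1 / (n.factorial : ℝ)) c) (expStar P f) :=
  hf.series hpq (s := fun T => Finset.range (T.size + 1))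
    (fun T => Finset.range_mono (by have := T.size_le; omega)) fun _ => rfl

theorem Growth.sub (hpq : IsDualPair p q) {f g : Fam d P w} (hf : Growth P q a c f)
    (hg : Growth P q a c' g) : Growth P q a (c + c') (f - g) := by
  intro T
  have h : f - g = f + (-1 : ℝ) • g := by
    funext S
    change f S - g S = f S + (-1 : ℝ) • g S
    rw [sub_eq_add_neg]
    exact congrArg _ (neg_one_smul ℝ (g S)).symm
  rw [h]
  refine (nrm_add_le P hpq _ _ T).trans ?_
  rw [nrm_smul, add_mul]
  refine add_le_add (hf T) ?_
  simpa using hg T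

/-- A bound of the homogeneous norm in terms of the growth. -/
theorem Growth.halfNorm_le (hpq : IsDualPair p q) {W : Fam d P w} (hW : Growth P q a c W)
    {D : ℝ≥0∞} (hD : 1 ≤ D)
    (hcD : ((maxSize d w).factorial : ℝ≥0∞) * 4 ^ maxSize d w * c ≤ D) :
    halfNorm P q W ≤ D * a := by
  rw [halfNorm_le_iff]
  intro T hT
  calc (T.size.factorial : ℝ≥0∞) * (constK q * nrm P q W T)
      ≤ ((maxSize d w).factorial : ℝ≥0∞) * (4 ^ maxSize d w * (c * a ^ T.size)) := by
        gcongr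
        · exact T.size_le
        · exact constK_le hpq
        · exact hW T
    _ = ((maxSize d w).factorial : ℝ≥0∞) * 4 ^ maxSize d w * c * a ^ T.size := by ring
    _ ≤ D ^ T.size * a ^ T.size := by
        gcongr
        exact hcD.trans (le_self_pow₀ hD (TForest.size_pos hT).ne')
    _ = _ := (mul_pow _ _ _).symm

/-- The constant is `1` because `|T|! K ≥ 1` can be dropped. Removing the counit matters at the
empty forest, where the norm gives no information. -/
theorem growth_of_halfNorm_le (hpq : IsDualPair p q) {W : Fam d P w} (h0 : ∀ T : TForest d w,
    T.raw.N = ∅ → (W - counit d P w) T = 0) (h : halfNorm P q W ≤ a) :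
    Growth P q a 1 (W - counit d P w) := by
  intro T
  by_cases hT : T.raw.N = ∅
  · rw [nrm_of_eq_zero (h0 T hT)]
    exact zero_le
  · have hT' := Finset.nonempty_iff_ne_empty.2 hT
    have h1 := halfNorm_le_iff P |>.1 h T hT'
    have h2 : (W - counit d P w) T = W T := by
      have : counit d P w T = 0 := by rw [counit, if_neg hT]; rfl
      change W T - counit d P w T = W T
      rw [this, sub_zero]
    rw [nrm, h2, one_mul]
    refine le_trans ?_ h1
    rw [← mul_assoc]
    refine le_mul_of_one_le_left zero_le ?_
    refine one_le_mul ?_ (one_le_constK hpq hT')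
    exact_mod_cast Nat.succ_le_of_lt (Nat.factorial_pos _)

end

end Lions

namespace Lions

noncomputable section

open scoped Classical

set_option linter.unusedSectionVars false

variable {d : ℕ} {w : Weights}

/-! ### There are finitely many truncated forests up to isomorphism -/

/-- A bijection of `N` with an initial segment extends to a permutation, as both complements are
countably infinite. -/
theorem exists_perm_lt (N : Finset ℕ) : ∃ σ : Equiv.Perm ℕ, ∀ x ∈ N, σ x < N.card := by
  have e1 : {x // x ∈ N} ≃ {x // x ∈ Finset.range N.card} :=
    Finset.equivOfCardEq (Finset.card_range _).symm
  have hinf : ∀ s : Finset ℕ, Infinite {x // x ∉ s} := fun s =>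
    Set.infinite_coe_iff.2 s.finite_toSet.infinite_compl
  have := hinf N
  have := hinf (Finset.range N.card)
  obtain ⟨e2⟩ := nonempty_equiv_of_countable (α := {x // x ∉ N})
    (β := {x // x ∉ Finset.range N.card})
  refine ⟨Equiv.subtypeCongr e1 e2, fun x hx => ?_⟩
  have : (Equiv.subtypeCongr e1 e2) x = e1 ⟨x, hx⟩ := by
    simp [Equiv.subtypeCongr, Equiv.sumCompl, hx]
  rw [this]
  exact Finset.mem_range.1 (e1 ⟨x, hx⟩).2

namespace TForest

/-- A naming of the nodes by numbers less than `maxSize d w`. -/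
def naming (T : TForest d w) : Equiv.Perm ℕ := (exists_perm_lt T.raw.N).choose

theorem naming_lt (T : TForest d w) {x : ℕ} (hx : x ∈ T.raw.N) : T.naming x < maxSize d w :=
  ((exists_perm_lt T.raw.N).choose_spec x hx).trans_le T.size_le

/-- The data of a truncated forest, with renamed nodes. -/
def code (T : TForest d w) : Set (Fin (maxSize d w)) ×
    Set (Fin (maxSize d w) × Fin (maxSize d w)) × Set (Fin (maxSize d w)) ×
    Set (Finset (Fin (maxSize d w))) × (Fin (maxSize d w) → Option (Fin d)) :=
  ({i | T.naming.symm i ∈ T.raw.N},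
    {e | T.raw.Edge (T.naming.symm e.1) (T.naming.symm e.2)},
    {i | T.naming.symm i ∈ T.raw.h0},
    {S | (S.map Fin.valEmbedding).map T.naming.symm.toEmbedding ∈ T.raw.H},
    fun i => if h : T.naming.symm i ∈ T.raw.N then some (T.raw.L ⟨_, h⟩) else none)

theorem notMem_of_naming (T : TForest d w) {i : ℕ} (hi : ¬ i < maxSize d w) :
    T.naming.symm i ∉ T.raw.N := fun h => hi (by simpa using T.naming_lt h)

theorem exists_map_eq (T : TForest d w) {h : Finset ℕ}
    (hh : h.map T.naming.symm.toEmbedding ∈ T.raw.H) :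
    ∃ S : Finset (Fin (maxSize d w)), S.map Fin.valEmbedding = h := by
  have hlt : ∀ x ∈ h, x < maxSize d w := fun x hx => by
    by_contra hlt
    refine T.notMem_of_naming hlt ?_
    exact (Finset.mem_sdiff.1 (T.1.2.H_subset _ hh
      (Finset.mem_map_of_mem T.naming.symm.toEmbedding hx))).1
  exact ⟨h.attachFin hlt, Finset.map_valEmbedding_attachFin hlt⟩

/-- Codes live in a finite type, so this bounds the number of isomorphism classes. They record all
of a forest, since no node is named by a number from `maxSize d w` on. -/
theorem isIso_of_code_eq {T T' : TForest d w} (h : T.code = T'.code) :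
    HForest.IsIso (T.naming.trans T'.naming.symm) T.raw T'.raw := by
  obtain ⟨hN, hE, h0, hH, hL⟩ : _ ∧ _ ∧ _ ∧ _ ∧ _ := by
    simpa only [code, Prod.mk.injEq] using h
  have hN' : ∀ i : ℕ, T'.naming.symm i ∈ T'.raw.N ↔ T.naming.symm i ∈ T.raw.N := fun i => by
    by_cases hi : i < maxSize d w
    · exact (Set.ext_iff.1 hN ⟨i, hi⟩).symm
    · exact iff_of_false (T'.notMem_of_naming hi) (T.notMem_of_naming hi)
  have hE' : ∀ i j : ℕ, T'.raw.Edge (T'.naming.symm i) (T'.naming.symm j) ↔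
      T.raw.Edge (T.naming.symm i) (T.naming.symm j) := fun i j => by
    by_cases hi : i < maxSize d w
    · by_cases hj : j < maxSize d w
      · exact (Set.ext_iff.1 hE (⟨i, hi⟩, ⟨j, hj⟩)).symm
      · exact iff_of_false (fun e => T'.notMem_of_naming hj (T'.1.2.edge_mem _ _ e).2)
          (fun e => T.notMem_of_naming hj (T.1.2.edge_mem _ _ e).2)
    · exact iff_of_false (fun e => T'.notMem_of_naming hi (T'.1.2.edge_mem _ _ e).1)
        (fun e => T.notMem_of_naming hi (T.1.2.edge_mem _ _ e).1)
  have h0' : ∀ i : ℕ, T'.naming.symm i ∈ T'.raw.h0 ↔ T.naming.symm i ∈ T.raw.h0 := fun i => by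
    by_cases hi : i < maxSize d w
    · exact (Set.ext_iff.1 h0 ⟨i, hi⟩).symm
    · exact iff_of_false (fun e => T'.notMem_of_naming hi (T'.1.2.h0_subset e))
        (fun e => T.notMem_of_naming hi (T.1.2.h0_subset e))
  have hH' : ∀ k : Finset ℕ, k.map T'.naming.symm.toEmbedding ∈ T'.raw.H ↔
      k.map T.naming.symm.toEmbedding ∈ T.raw.H := fun k => by
    constructor
    · intro hk
      obtain ⟨S, rfl⟩ := T'.exists_map_eq hk
      exact (Set.ext_iff.1 hH S).2 hk
    · intro hk
      obtain ⟨S, rfl⟩ := T.exists_map_eq hk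
      exact (Set.ext_iff.1 hH S).1 hk
  refine ⟨fun x => ?_, fun x y => ?_, fun x => ?_, fun k => ?_, fun x hx hx' => ?_⟩
  · simpa using hN' (T.naming x)
  · simpa using hE' (T.naming x) (T.naming y)
  · simpa using h0' (T.naming x)
  · have h1 : (k.map T.naming.toEmbedding).map T.naming.symm.toEmbedding = k := by
      rw [Finset.map_map]
      have : T.naming.toEmbedding.trans T.naming.symm.toEmbedding =
          Function.Embedding.refl ℕ := by
        ext x
        exact T.naming.symm_apply_apply x
      rw [this, Finset.map_refl]
    have h2 : k.map (T.naming.trans T'.naming.symm).toEmbedding =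
        (k.map T.naming.toEmbedding).map T'.naming.symm.toEmbedding := by
      rw [Finset.map_map]; rfl
    rw [h2, hH', h1]
  · have hi := T.naming_lt hx
    have e := congrFun hL ⟨T.naming x, hi⟩
    have hx1 : T.naming.symm (T.naming x) ∈ T.raw.N := by simpa using hx
    dsimp only at e
    rw [dif_pos hx1, dif_pos (show T'.naming.symm (T.naming x) ∈ T'.raw.N from hx')] at e
    refine (Option.some.inj e).symm.trans (congrArg T.raw.L (Subtype.ext ?_))
    simp

end TForest

variable {Ω : Type u} [MeasurableSpace Ω] {P : Measure Ω} [IsProbabilityMeasure P]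
variable {p q : TForest d w → ℝ}

theorem FullFam.IsChar.moment_le_of_iso {F : FullFam d P} (hF : F.IsChar) (hpq : IsDualPair p q)
    {T T' : TForest d w} {σ : Equiv.Perm ℕ} (h : HForest.IsIso σ T.raw T'.raw) :
    moment P q (F.res w) T' ≤ moment P q (F.res w) T := by
  have e : F T'.1 = transport P h (F T.1) :=
    ((FullFam.isMVChar_iff F).2 hF).natural T.1 T'.1 σ h
  rw [moment, moment, hpq.q_iso T T' ⟨σ, h⟩]
  change eLpNorm (F T'.1) _ _ ≤ eLpNorm (F T.1) _ _
  rw [e]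
  exact eLpNorm_transport_le P h _ _

/-- Finite moments of a character are bounded, as there are finitely many forests. -/
theorem FullFam.IsChar.exists_bound {F : FullFam d P} (hF : F.IsChar) (hpq : IsDualPair p q)
    (h : ∀ T : TForest d w, T.raw.N.Nonempty → moment P q (F.res w) T < ⊤) :
    ∃ B : ℝ≥0∞, B ≠ ⊤ ∧ ∀ T : TForest d w, T.raw.N.Nonempty → moment P q (F.res w) T ≤ B := by
  -- The bound is the sum of the moments of one representative per code; every other forest with
  -- that code is isomorphic to it.
  let S : Set _ := Set.range fun T : {T : TForest d w // T.raw.N.Nonempty} => T.1.code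
  choose g hg using fun c : S => c.2
  have : Fintype S := Fintype.ofFinite S
  refine ⟨∑ c : S, moment P q (F.res w) (g c).1,
    ENNReal.sum_ne_top.2 fun c _ => (h _ (g c).2).ne, fun T hT => ?_⟩
  let c : S := ⟨T.code, ⟨T, hT⟩, rfl⟩
  refine (hF.moment_le_of_iso hpq (TForest.isIso_of_code_eq (hg c))).trans ?_
  exact Finset.single_le_sum (f := fun c : S => moment P q (F.res w) (g c).1)
    (fun _ _ => zero_le) (Finset.mem_univ c)

theorem halfNorm_ne_top (hpq : IsDualPair p q) {W : Fam d P w} {B : ℝ≥0∞} (hB : B ≠ ⊤)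
    (h : ∀ T : TForest d w, T.raw.N.Nonempty → moment P q W T ≤ B) : halfNorm P q W ≠ ⊤ := by
  have hK := constK_ne_top hpq
  -- The maximum with `1` gives `D ≤ D ^ |T|`.
  set D : ℝ≥0∞ := max 1 (((maxSize d w).factorial : ℝ≥0∞) * (constK q * B)) with hD
  have hDt : D ≠ ⊤ :=
    max_ne_top (by simp) (ENNReal.mul_ne_top (by simp) (ENNReal.mul_ne_top hK hB))
  refine ne_top_of_le_ne_top hDt ((halfNorm_le_iff P).2 fun T hT => ?_)
  calc (T.size.factorial : ℝ≥0∞) * (constK q * nrm P q W T)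
      ≤ ((maxSize d w).factorial : ℝ≥0∞) * (constK q * B) := by
        gcongr
        · exact T.size_le
        · rw [nrm_eq_moment P W hT]
          exact h T hT
    _ ≤ D := le_max_right _ _
    _ ≤ D ^ T.size := le_self_pow₀ (le_max_left _ _) (TForest.size_pos hT).ne'

end

end Lions

namespace Lions

noncomputable section

open scoped Classical

set_option linter.unusedSectionVars false

variable {d : ℕ} {w : Weights} {Ω : Type u} [MeasurableSpace Ω] {P : Measure Ω}
  [IsProbabilityMeasure P] {p q : TForest d w → ℝ}

/-! ### The group -/

theorem Growth.nrm_ne_top {c : ℝ≥0∞} {W : Fam d P w} (h : Growth P q 1 c W) (hc : c ≠ ⊤)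
    (T : TForest d w) : nrm P q W T ≠ ⊤ :=
  ne_top_of_le_ne_top (by rwa [one_pow, mul_one]) (h T)

theorem FullFam.IsChar.nrm_le_one {F : FullFam d P} (hF : F.IsChar) {T : TForest d w}
    (hT : T.raw.N = ∅) : nrm P q (F.res w) T ≤ 1 := by
  refine (nrm_scalar_le P hT (r := 1) (hF.unit T.1 hT)).trans ?_
  simp

namespace MVGroup

/-- A character on all forests that restricts to `W`. -/
def extend (W : MVGroup P q) : FullFam d P := W.2.1.choose

theorem isChar_extend (W : MVGroup P q) : W.extend.IsChar :=
  (FullFam.isMVChar_iff _).1 W.2.1.choose_spec.1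

theorem extend_res (W : MVGroup P q) : W.extend.res w = W.1 :=
  funext W.2.1.choose_spec.2

/-- The restriction of a character with finite moments. -/
def ofChar (F : FullFam d P) (hF : F.IsChar)
    (h : ∀ T : TForest d w, T.raw.N.Nonempty → nrm P q (F.res w) T ≠ ⊤) : MVGroup P q :=
  ⟨F.res w, ⟨F, (FullFam.isMVChar_iff F).2 hF, fun _ => rfl⟩, fun T hT => by
    rw [← nrm_eq_moment P _ hT]
    exact (h T hT).lt_top⟩

theorem exists_bound (hpq : IsDualPair p q) (W : MVGroup P q) :
    ∃ B : ℝ≥0∞, B ≠ ⊤ ∧ ∀ T : TForest d w, T.raw.N.Nonempty → moment P q W.1 T ≤ B := by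
  rw [← W.extend_res]
  refine W.isChar_extend.exists_bound hpq fun T hT => ?_
  rw [W.extend_res]
  exact W.2.2 T hT

theorem nrm_le_one (W : MVGroup P q) {T : TForest d w} (hT : T.raw.N = ∅) :
    nrm P q W.1 T ≤ 1 := by
  rw [← W.extend_res]
  exact W.isChar_extend.nrm_le_one hT

theorem exists_growth (hpq : IsDualPair p q) (W : MVGroup P q) :
    ∃ c : ℝ≥0∞, c ≠ ⊤ ∧ Growth P q 1 c W.1 := by
  obtain ⟨B, hB, h⟩ := W.exists_bound hpq
  refine ⟨max 1 B, max_ne_top (by simp) hB, fun T => ?_⟩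
  rw [one_pow, mul_one]
  by_cases hT : T.raw.N = ∅
  · exact (W.nrm_le_one hT).trans (le_max_left _ _)
  · rw [nrm_eq_moment P _ (Finset.nonempty_iff_ne_empty.2 hT)]
    exact (h T (Finset.nonempty_iff_ne_empty.2 hT)).trans (le_max_right _ _)

/-- The convolution of two elements of the group. -/
def mul (hpq : IsDualPair p q) (V W : MVGroup P q) : MVGroup P q :=
  ofChar (V.extend * W.extend) (V.isChar_extend.conv W.isChar_extend) fun T _ => by
    obtain ⟨b, hb, h1⟩ := V.exists_growth hpq
    obtain ⟨c, hc, h2⟩ := W.exists_growth hpq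
    rw [← conv_res, V.extend_res, W.extend_res]
    exact (h1.conv hpq h2).nrm_ne_top
      (ENNReal.mul_ne_top (ENNReal.pow_ne_top (by simp)) (ENNReal.mul_ne_top hb hc)) T

/-- The counit as an element of the group. -/
def one : MVGroup P q :=
  ofChar 1 FullFam.isChar_one fun T _ => (growth_counit (a := 1)).nrm_ne_top (by simp) T

/-- The antipode of an element of the group. -/
def inv (hpq : IsDualPair p q) (W : MVGroup P q) : MVGroup P q :=
  ofChar W.extend.antipode W.isChar_extend.antipode fun T _ => by
    obtain ⟨c, hc, h⟩ := W.exists_growth hpq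
    rw [← antipode_res, W.extend_res]
    exact (((growth_counit).sub hpq h).antipode hpq).nrm_ne_top
      (seriesConst_ne_top (ENNReal.add_ne_top.2 ⟨by simp, hc⟩)) T

theorem mul_val (hpq : IsDualPair p q) (V W : MVGroup P q) :
    (mul hpq V W).1 = conv P V.1 W.1 := by
  conv_rhs => rw [← V.extend_res, ← W.extend_res]
  rfl

theorem inv_val (hpq : IsDualPair p q) (W : MVGroup P q) :
    (inv hpq W).1 = antipode P W.1 := by
  conv_rhs => rw [← W.extend_res, antipode_res]
  rfl

theorem one_val : (one : MVGroup P q).1 = counit d P w := rfl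

/-- The group of characters with finite moments. -/
abbrev group (hpq : IsDualPair p q) : Group (MVGroup P q) :=
  letI : Mul (MVGroup P q) := ⟨mul hpq⟩
  letI : One (MVGroup P q) := ⟨one⟩
  letI : Inv (MVGroup P q) := ⟨inv hpq⟩
  -- Each axiom is checked after extension to characters on all forests, where it is an identity of
  -- the ring `FullFam`.
  Group.ofLeftAxioms
    (fun U V W => Subtype.ext <| by
      change (mul hpq (mul hpq U V) W).1 = (mul hpq U (mul hpq V W)).1
      rw [mul_val, mul_val, mul_val, mul_val, ← U.extend_res, ← V.extend_res, ← W.extend_res,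
        conv_res, conv_res, conv_res, conv_res, mul_assoc])
    (fun W => Subtype.ext <| by
      change (mul hpq one W).1 = W.1
      rw [mul_val, one_val, ← W.extend_res, counit_eq_res, conv_res, one_mul])
    (fun W => Subtype.ext <| by
      change (mul hpq (inv hpq W) W).1 = (one : MVGroup P q).1
      rw [mul_val, inv_val, one_val, ← W.extend_res, antipode_res, conv_res,
        W.isChar_extend.antipode_mul, counit_eq_res])

end MVGroup

/-! ### Dilations -/

theorem halfNorm_scale_le {V W : Fam d P w} {t : ℝ} (h : ∀ T, V T = t ^ T.size • W T) :
    halfNorm P q V ≤ ENNReal.ofReal |t| * halfNorm P q W := by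
  refine (halfNorm_le_iff P).2 fun T hT => ?_
  have h1 := (halfNorm_le_iff P).1 (le_refl (halfNorm P q W)) T hT
  have h2 : nrm P q V T = ENNReal.ofReal |t| ^ T.size * nrm P q W T := by
    rw [nrm, h T, eLpNorm_smul_coe, enorm_pow, Real.enorm_eq_ofReal_abs]
    rfl
  rw [h2, mul_pow]
  calc (T.size.factorial : ℝ≥0∞) * (constK q * (ENNReal.ofReal |t| ^ T.size * nrm P q W T))
      = ENNReal.ofReal |t| ^ T.size *
          ((T.size.factorial : ℝ≥0∞) * (constK q * nrm P q W T)) := by ring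
    _ ≤ _ := by gcongr

/-- For `t ≠ 0` the reverse inequality is the direct one for `t⁻¹`. -/
theorem halfNorm_scale {V W : Fam d P w} {t : ℝ} (h : ∀ T, V T = t ^ T.size • W T) :
    halfNorm P q V = ENNReal.ofReal |t| * halfNorm P q W := by
  refine le_antisymm (halfNorm_scale_le h) ?_
  rcases eq_or_ne t 0 with rfl | ht
  · simp
  have h' : ∀ T, W T = t⁻¹ ^ T.size • V T := fun T => by
    rw [h T, smul_smul, ← mul_pow, inv_mul_cancel₀ ht, one_pow]
    exact (one_smul ℝ (W T)).symm
  refine (mul_le_mul_right (halfNorm_scale_le h') _).trans ?_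
  rw [← mul_assoc, ← ENNReal.ofReal_mul (abs_nonneg _), ← abs_mul, mul_inv_cancel₀ ht, abs_one,
    ENNReal.ofReal_one, one_mul]

/-- The dilated element is the scaled character. Scaling commutes with the antipode, so both halves
of the norm are homogeneous. -/
theorem MVGroup.exists_dilation (W : MVGroup P q) (t : ℝ) : ∃ V : MVGroup P q,
    V.1 = dilation P t W.1 ∧ ccNorm P q V.1 = ENNReal.ofReal |t| * ccNorm P q W.1 := by
  have h : ∀ (F : FullFam d P) (T : TForest d w),
      (FullFam.scale d P t F).res w T = t ^ T.size • F.res w T :=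
    fun F T => FullFam.scale_apply t F T.1
  refine ⟨ofChar (FullFam.scale d P t W.extend) (W.isChar_extend.scale t) fun T hT => ?_, ?_, ?_⟩
  · rw [nrm, h, W.extend_res, eLpNorm_smul_coe]
    refine ENNReal.mul_ne_top enorm_ne_top ?_
    have := (W.2.2 T hT).ne
    rw [← nrm_eq_moment P _ hT] at this
    exact this
  · refine (dilation_res P W.isChar_extend t).symm.trans ?_
    rw [W.extend_res]
  · change ccNorm P q ((FullFam.scale d P t W.extend).res w) = _
    rw [← W.extend_res, ccNorm, ccNorm, antipode_res, antipode_res, FullFam.antipode_scale,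
      halfNorm_scale (h _), halfNorm_scale (h _), mul_add]

/-! ### The homogeneous norm on the group -/

namespace MVGroup

/-- Since `|T|! K` is positive, all moments on nonempty forests vanish, and with them the random
variables; on the empty forest a character is `1` anyway. -/
theorem eq_one_of_halfNorm (hpq : IsDualPair p q) {W : MVGroup P q} (h : halfNorm P q W.1 = 0) :
    W = one := by
  refine Subtype.ext (funext fun T => ?_)
  by_cases hT : T.raw.N = ∅
  · rw [one_val, counit, if_pos hT, ← W.extend_res]
    exact W.isChar_extend.unit T.1 hT
  · have hT' := Finset.nonempty_iff_ne_empty.2 hT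
    have h1 := (halfNorm_le_iff P).1 h.le T hT'
    rw [zero_pow (TForest.size_pos hT').ne', nonpos_iff_eq_zero, mul_eq_zero, mul_eq_zero] at h1
    have hK : constK q ≠ 0 := (one_pos.trans_le (one_le_constK hpq hT')).ne'
    have h2 : nrm P q W.1 T = 0 := by
      rcases h1 with h1 | h1 | h1
      · exact absurd (Nat.cast_eq_zero.1 h1) (Nat.factorial_ne_zero _)
      · exact absurd h1 hK
      · exact h1
    have he : exponent q T ≠ 0 := (one_pos.trans_le (hpq.one_le_exponent T)).ne'
    rw [nrm, eLpNorm_eq_zero_iff (AEEqFun.aestronglyMeasurable _) he] at h2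
    rw [one_val, counit, if_neg hT]
    exact AEEqFun.ext (h2.trans AEEqFun.coeFn_zero.symm)

theorem halfNorm_one : halfNorm P q (counit d P w) = 0 := by
  refine le_antisymm ((halfNorm_le_iff P).2 fun T hT => ?_) zero_le
  rw [nrm_of_eq_zero, mul_zero, mul_zero]
  · exact zero_le
  · rw [counit, if_neg hT.ne_empty]
    rfl

theorem halfNorm_mul_le (hpq : IsDualPair p q) (V W : MVGroup P q) :
    halfNorm P q (mul hpq V W).1 ≤ halfNorm P q V.1 + halfNorm P q W.1 := by
  rw [mul_val]
  exact halfNorm_conv_le P hpq (fun _ => V.nrm_le_one) fun _ => W.nrm_le_one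

theorem halfNorm_ne_top (hpq : IsDualPair p q) (W : MVGroup P q) : halfNorm P q W.1 ≠ ⊤ :=
  have ⟨_, hB, h⟩ := W.exists_bound hpq
  Lions.halfNorm_ne_top hpq hB h

theorem ccNorm_eq (hpq : IsDualPair p q) (W : MVGroup P q) :
    ccNorm P q W.1 = halfNorm P q W.1 + halfNorm P q (inv hpq W).1 := by
  rw [inv_val, ccNorm]

end MVGroup

end

end Lions

namespace Lions

noncomputable section

open scoped Classical

set_option linter.unusedSectionVars false

variable {d : ℕ} {w : Weights} {Ω : Type u} [MeasurableSpace Ω] {P : Measure Ω}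
  [IsProbabilityMeasure P] {p q : TForest d w → ℝ}

/-! ### The metric -/

namespace MVGroup

theorem ccNorm_ne_top (hpq : IsDualPair p q) (W : MVGroup P q) : ccNorm P q W.1 ≠ ⊤ := by
  rw [ccNorm_eq hpq]
  exact ENNReal.add_ne_top.2 ⟨W.halfNorm_ne_top hpq, (inv hpq W).halfNorm_ne_top hpq⟩

theorem ccNorm_inv (hpq : IsDualPair p q) (W : MVGroup P q) :
    ccNorm P q (inv hpq W).1 = ccNorm P q W.1 := by
  let _ := group (P := P) hpq
  have h : inv hpq (inv hpq W) = W := inv_inv W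
  rw [ccNorm_eq hpq, ccNorm_eq hpq W, h, add_comm]

theorem ccNorm_eq_zero_iff (hpq : IsDualPair p q) (W : MVGroup P q) :
    ccNorm P q W.1 = 0 ↔ W = one := by
  let _ := group (P := P) hpq
  constructor
  · intro h
    exact eq_one_of_halfNorm hpq (add_eq_zero.1 h).1
  · rintro rfl
    have h : inv hpq (one : MVGroup P q) = one := inv_one
    rw [ccNorm_eq hpq, h, one_val, halfNorm_one, add_zero]

/-- Inversion reverses the product, which does no harm to the sum of the two halves. -/
theorem ccNorm_mul_le (hpq : IsDualPair p q) (V W : MVGroup P q) :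
    ccNorm P q (mul hpq V W).1 ≤ ccNorm P q V.1 + ccNorm P q W.1 := by
  let _ := group (P := P) hpq
  have h : inv hpq (mul hpq V W) = mul hpq (inv hpq W) (inv hpq V) := mul_inv_rev V W
  rw [ccNorm_eq hpq, ccNorm_eq hpq V, ccNorm_eq hpq W, h, add_add_add_comm,
    add_comm (halfNorm P q (inv hpq V).1)]
  exact add_le_add (halfNorm_mul_le hpq V W) (halfNorm_mul_le hpq _ _)

/-- The left-invariant metric of the homogeneous norm. -/
abbrev metricSpace (hpq : IsDualPair p q) : MetricSpace (MVGroup P q) :=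
  letI := group (P := P) hpq
  have comm : ∀ V W : MVGroup P q, ccNorm P q (W⁻¹ * V).1 = ccNorm P q (V⁻¹ * W).1 :=
    fun V W => by
      have h : W⁻¹ * V = (V⁻¹ * W)⁻¹ := by rw [mul_inv_rev, inv_inv]
      rw [h]
      exact ccNorm_inv hpq _
  { dist := fun V W => (ccNorm P q (W⁻¹ * V).1).toReal
    dist_self := fun V => by
      rw [inv_mul_cancel, (ccNorm_eq_zero_iff hpq 1).2 rfl, ENNReal.toReal_zero]
    dist_comm := fun V W => by rw [comm]
    dist_triangle := fun U V W => by
      have h : W⁻¹ * U = mul hpq (W⁻¹ * V) (V⁻¹ * U) := by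
        change _ = W⁻¹ * V * (V⁻¹ * U)
        rw [mul_assoc, mul_inv_cancel_left]
      have hU := ccNorm_ne_top hpq (V⁻¹ * U)
      have hV := ccNorm_ne_top hpq (W⁻¹ * V)
      rw [add_comm, ← ENNReal.toReal_add hV hU, h]
      exact ENNReal.toReal_mono (ENNReal.add_ne_top.2 ⟨hV, hU⟩) (ccNorm_mul_le hpq _ _)
    eq_of_dist_eq_zero := fun {V W} h => by
      have h1 := (ENNReal.toReal_eq_zero_iff _).1 h
      have h2 : W⁻¹ * V = 1 :=
        (ccNorm_eq_zero_iff hpq _).1 (h1.resolve_right (ccNorm_ne_top hpq _))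
      exact (inv_mul_eq_one.1 h2).symm }

/-! ### Comparison with the norm of the logarithm -/

theorem sub_counit_apply (W : MVGroup P q) (T : TForest d w) (hT : T.raw.N = ∅) :
    (W.1 - counit d P w) T = 0 := by
  rw [← W.extend_res]
  exact W.isChar_extend.sub_one_apply T.1 hT

/-- `W - ε` grows at rate `‖W‖` with constant `1`, and the logarithm series keeps the rate. The
maximum with `1` allows the constant to be moved under the `|T|`-th power. -/
theorem logNorm_le (hpq : IsDualPair p q) (W : MVGroup P q) :
    logNorm P q W.1 ≤ max 1 (seriesConst (maxSize d w) (Finset.Icc 1 (maxSize d w))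
      (fun n => (-1 : ℝ) ^ (n + 1) / n) 1) * ccNorm P q W.1 := by
  have h := (growth_of_halfNorm_le hpq W.sub_counit_apply
    (le_self_add : halfNorm P q W.1 ≤ ccNorm P q W.1)).logStar hpq
  refine iSup₂_le fun T hT => ?_
  obtain ⟨x, ⟨hx, -⟩, -⟩ := hT
  have hs := TForest.size_pos ⟨x, hx⟩
  rw [one_div, ENNReal.rpow_inv_le_iff (by positivity), ENNReal.rpow_natCast, mul_pow,
    ← nrm_eq_moment P _ ⟨x, hx⟩]
  refine (h T).trans ?_
  gcongr
  · exact (le_max_right _ _).trans (le_self_pow₀ (le_max_left _ _) hs.ne')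
  · exact le_rfl

/-- On trees this is the definition of the logarithmic norm, and elsewhere the logarithm vanishes.
This is why a supremum over trees controls the whole of `W`. -/
theorem growth_logStar (W : MVGroup P q) :
    Growth P q (logNorm P q W.1) 1 (logStar P W.1) := by
  intro T
  by_cases hT : T.raw.IsTree
  · obtain ⟨x, ⟨hx, -⟩, -⟩ := id hT
    have hs := TForest.size_pos ⟨x, hx⟩
    have h : moment P q (logStar P W.1) T ^ (1 / (T.size : ℝ)) ≤ logNorm P q W.1 :=
      le_iSup₂_of_le T hT le_rfl
    rw [one_div, ENNReal.rpow_inv_le_iff (by positivity), ENNReal.rpow_natCast] at h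
    rw [one_mul, nrm_eq_moment P _ ⟨x, hx⟩]
    exact h
  · rw [nrm_of_eq_zero]
    · exact zero_le
    · rw [← W.extend_res, logStar_res]
      exact W.isChar_extend.log_eq_zero T.1 hT

theorem expStar_logStar (W : MVGroup P q) : expStar P (logStar P W.1) = W.1 := by
  rw [← W.extend_res, logStar_res, expStar_res, W.isChar_extend.exp_log]

/-- The growth constant of a character in terms of its logarithm. -/
def expConst (d : ℕ) (w : Weights) : ℝ≥0∞ :=
  seriesConst (maxSize d w) (Finset.range (maxSize d w + 1)) (fun n => 1 / (n.factorial : ℝ)) 1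

/-- The growth constant of the inverse of a character in terms of its logarithm. -/
def invConst (d : ℕ) (w : Weights) : ℝ≥0∞ :=
  seriesConst (maxSize d w) (Finset.range (maxSize d w + 1)) 1 (1 + expConst d w)

/-- The constant by which the homogeneous norm exceeds a growth constant. -/
def normConst (d : ℕ) (w : Weights) (c : ℝ≥0∞) : ℝ≥0∞ :=
  max 1 (((maxSize d w).factorial : ℝ≥0∞) * 4 ^ maxSize d w * c)

theorem normConst_ne_top {c : ℝ≥0∞} (hc : c ≠ ⊤) : normConst d w c ≠ ⊤ :=
  max_ne_top (by simp) (ENNReal.mul_ne_top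
    (ENNReal.mul_ne_top (by simp) (ENNReal.pow_ne_top (by simp))) hc)

/-- Recovering `W` as the exponential of its logarithm and then inverting preserves the growth rate,
and a growth rate bounds each half of the norm. -/
theorem ccNorm_le (hpq : IsDualPair p q) (W : MVGroup P q) :
    ccNorm P q W.1 ≤ (normConst d w (expConst d w) + normConst d w (invConst d w)) *
      logNorm P q W.1 := by
  have h := W.growth_logStar.expStar hpq
  rw [expStar_logStar] at h
  -- The inverse is a series in `ε - W`, whose constant is `1 + expConst d w`.
  have h' := ((growth_counit).sub hpq h).antipode hpq
  rw [add_mul]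
  exact add_le_add (h.halfNorm_le hpq (le_max_left _ _) (le_max_right _ _))
    (h'.halfNorm_le hpq (le_max_left _ _) (le_max_right _ _))

end MVGroup

end

end Lions

/-! ### The proposition -/

theorem mainTheorem8 (d : ℕ) (hd : 0 < d) (w : Lions.Weights) (p q : Lions.TForest d w → ℝ)
    (hpq : Lions.IsDualPair p q) :
    (∀ (Ω : Type u) [MeasurableSpace Ω] (P : Measure Ω) [IsProbabilityMeasure P],
      ∃ (_ : Group (Lions.MVGroup P q)) (_ : MetricSpace (Lions.MVGroup P q)),
        -- the group operations are the convolution, the counit and the antipode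
        (∀ V W : Lions.MVGroup P q, (V * W).1 = Lions.conv P V.1 W.1) ∧
        ((1 : Lions.MVGroup P q).1 = Lions.counit d P w) ∧
        (∀ W : Lions.MVGroup P q, (W⁻¹).1 = Lions.antipode P W.1) ∧
        -- the norm is a finite homogeneous norm
        (∀ W : Lions.MVGroup P q, Lions.ccNorm P q W.1 ≠ ⊤) ∧
        (∀ W : Lions.MVGroup P q, Lions.ccNorm P q W.1 = 0 ↔ W = 1) ∧
        (∀ (t : ℝ) (W : Lions.MVGroup P q), ∃ V : Lions.MVGroup P q,
          V.1 = Lions.dilation P t W.1 ∧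
          Lions.ccNorm P q V.1 = ENNReal.ofReal |t| * Lions.ccNorm P q W.1) ∧
        -- it is symmetric and sub-additive
        (∀ W : Lions.MVGroup P q, Lions.ccNorm P q (W⁻¹).1 = Lions.ccNorm P q W.1) ∧
        (∀ V W : Lions.MVGroup P q,
          Lions.ccNorm P q (V * W).1 ≤ Lions.ccNorm P q V.1 + Lions.ccNorm P q W.1) ∧
        -- it induces a left-invariant metric
        (∀ V W : Lions.MVGroup P q, dist V W = (Lions.ccNorm P q (W⁻¹ * V).1).toReal) ∧
        (∀ U V W : Lions.MVGroup P q, dist (U * V) (U * W) = dist V W)) ∧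
    -- it is equivalent to the norm defined through the moments of the logarithm
    (∃ c C : ℝ≥0, 0 < c ∧ 0 < C ∧
      ∀ (Ω : Type u) [MeasurableSpace Ω] (P : Measure Ω) [IsProbabilityMeasure P]
        (W : Lions.MVGroup P q),
        Lions.logNorm P q W.1 ≤ c * Lions.ccNorm P q W.1 ∧
        Lions.ccNorm P q W.1 ≤ C * Lions.logNorm P q W.1) := by
  refine ⟨fun Ω _ P _ => ⟨Lions.MVGroup.group hpq, Lions.MVGroup.metricSpace hpq,
    Lions.MVGroup.mul_val hpq, Lions.MVGroup.one_val, Lions.MVGroup.inv_val hpq,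
    Lions.MVGroup.ccNorm_ne_top hpq, Lions.MVGroup.ccNorm_eq_zero_iff hpq,
    fun t W => W.exists_dilation t, Lions.MVGroup.ccNorm_inv hpq,
    Lions.MVGroup.ccNorm_mul_le hpq, fun _ _ => rfl, fun U V W => ?_⟩, ?_⟩
  · let _ := Lions.MVGroup.group (P := P) hpq
    change (Lions.ccNorm P q ((U * W)⁻¹ * (U * V)).1).toReal =
      (Lions.ccNorm P q (W⁻¹ * V).1).toReal
    rw [mul_inv_rev, mul_assoc, inv_mul_cancel_left]
  · have hc : max 1 (Lions.seriesConst (Lions.maxSize d w) (Finset.Icc 1 (Lions.maxSize d w))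
        (fun n => (-1 : ℝ) ^ (n + 1) / n) 1) ≠ ⊤ :=
      max_ne_top (by simp) (Lions.seriesConst_ne_top (by simp))
    have he : Lions.MVGroup.expConst d w ≠ ⊤ := Lions.seriesConst_ne_top (by simp)
    have hi : Lions.MVGroup.invConst d w ≠ ⊤ :=
      Lions.seriesConst_ne_top (ENNReal.add_ne_top.2 ⟨by simp, he⟩)
    have hC := ENNReal.add_ne_top.2 ⟨Lions.MVGroup.normConst_ne_top (d := d) (w := w) he,
      Lions.MVGroup.normConst_ne_top (d := d) (w := w) hi⟩
    -- The constants are those of `logNorm_le` and `ccNorm_le`. They are built from `d` and `w`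
    -- alone, so they are chosen before the probability space, and the maxima with `1` make them
    -- positive.
    refine ⟨ENNReal.toNNReal _, ENNReal.toNNReal _, ENNReal.toNNReal_pos ?_ hc,
      ENNReal.toNNReal_pos ?_ hC, fun Ω _ P _ W => ?_⟩
    · exact (one_pos.trans_le (le_max_left _ _)).ne'
    · exact (one_pos.trans_le ((le_max_left _ _).trans le_self_add)).ne'
    · rw [ENNReal.coe_toNNReal hc, ENNReal.coe_toNNReal hC]
      exact ⟨W.logNorm_le hpq, W.ccNorm_le hpq⟩
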